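/- **Lemma 2.2.** Let $R^{-1}=\sqrt{\tfrac{2\pi}{3}-\tfrac{\sqrt3}{2}}$ and let $\mathcal X_\infty$ be the standard lens cluster in $\mathbb R^2$, with chambers $$\mathcal X_\infty(1)=\{|x|\le \tfrac{\sqrt3}{2}R,\ |y|\le \sqrt{R^2-x^2}-\tfrac R2\},\quad \mathcal X_\infty(2)=\{y\ge 0\}\setminus\operatorname{Int}\mathcal X_\infty(1),\quad \mathcal X_\infty(3)=\{y\le 0\}\setminus\operatorname{Int}\mathcal X_\infty(1).$$ For $A>0$ let $\mathcal D_A=(\mathcal D_A(1),\mathcal D_A(2),\mathcal D_A(3))$ be a standard double bubble with area vector $(1,A,\infty)$: $\mathcal D_A(1),\mathcal D_A(2)$ are the two open bounded regions of areas $1$ and $A$ determined by three circular arcs (the common one is a segment if $A=1$) with the same two endpoints, at each of which they meet pairwise at $120$ degrees, and $\mathcal D_A(3)=\mathbb R^2\setminus\overline{\mathcal D_A(1)\cup\mathcal D_A(2)}$. It is placed so that the circle supporting the interface of $\mathcal D_A(2)$ and $\mathcal D_A(3)$ is tangent to the $x$-axis at the origin and centered on the positive $y$-axis, the $y$-axis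 is the axis of symmetry exchanging the two triple junctions, and $\mathcal D_A(1)$ lies below $\mathcal D_A(2)$, that is, the arc separating $\mathcal D_A(1)$ from $\mathcal D_A(3)$ lies below the chord joining the triple junctions. Call an $(N,M)$-cluster in $\mathbb R^2$ a family of $N+M$ sets of locally finite perimeter, the first $N$ of positive finite area and the last $M$ of infinite area, which pairwise overlap in null sets and cover $\mathbb R^2$ up to a null set. For such families $\mathcal X,\mathcal X'$ of three sets, let $$d_K(\mathcal X,\mathcal X')=\sum_{j=1}^3|K\cap(\mathcal X(j)\,\Delta\,\mathcal X'(j))|,\qquad P(\mathcal X;U)=\sum_{1\le j<k\le 3}\mathcal H^1\big(U\cap\partial^*\mathcal X(j)\cap\partial^*\mathcal X(k)\big),$$ where $\partial^*$ is the reduced boundary. Then $\mathcal X_\infty$ is a $(1,2)$-cluster, a double bubble $\mathcal D_A$ as above exists for every $A>0$, and every such $\mathcal D_A$ is a $(2,1)$-cluster. For every choice of $\mathcal D_A$, $A>0$, as above, $\mathcal D_A$ converges locally to $\mathcal X_\infty$ as $A\to\infty$: $\lim_{A\to\infty}d_K(\mathcal D_A,\mathcal X_\infty)=0$ for every compact $K\subset\mathbb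 R^2$. Moreover, for every bounded open set $U\subset\mathbb R^2$, $$P(\mathcal X_\infty;U)\le\liminf_{A\to\infty}P(\mathcal D_A;U).$$ -/

import Mathlib

open Real Set Filter Topology MeasureTheory
open scoped ENNReal

/-- The Euclidean plane; `z 0` is the `x`-coordinate and `z 1` the `y`-coordinate. -/
abbrev Plane : Type := EuclideanSpace ℝ (Fin 2)

/-! ### Sets of locally finite perimeter and their reduced boundary -/

/-- The divergence of a vector field on the plane. -/
noncomputable def divergence (T : Plane → Plane) (x : Plane) : ℝ :=
  ∑ i : Fin 2, (fderiv ℝ T x (EuclideanSpace.single i 1)) i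

/-- The vector-valued Radon measure `ν μ`, given by its polar decomposition (`μ` is its total
variation and `ν` its direction, `|ν| = 1` almost everywhere), is the Gauss-Green measure of `E`:
`∫_E div T = ∫ T · ν dμ` for all compactly supported `C¹` vector fields `T`. -/
structure IsGaussGreen (E : Set Plane) (μ : Measure Plane) (ν : Plane → Plane) : Prop where
  locallyFinite : IsLocallyFiniteMeasure μ
  measurable : Measurable ν
  norm_eq_one : ∀ᵐ x ∂μ, ‖ν x‖ = 1
  gauss_green : ∀ T : Plane → Plane, ContDiff ℝ 1 T → HasCompactSupport T →
    ∫ x in E, divergence T x = ∫ x, inner ℝ (T x) (ν x) ∂μ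

/-- `E` is Lebesgue measurable and has locally finite perimeter, that is, it has a
Gauss-Green measure. -/
def HasLocallyFinitePerimeter (E : Set Plane) : Prop :=
  NullMeasurableSet E volume ∧ ∃ μ ν, IsGaussGreen E μ ν

/-- The reduced boundary `∂*E` in the sense of De Giorgi: the points `x` of the support of the
Gauss-Green measure of `E` at which the means of the direction `ν` over the balls `B(x, r)`
converge to a unit vector as `r → 0⁺`. (The pair `μ, ν` is unique up to `μ`-null sets.) -/
def reducedBoundary (E : Set Plane) : Set Plane :=
  {x | ∃ μ ν, IsGaussGreen E μ ν ∧ (∀ r > 0, 0 < μ (Metric.ball x r)) ∧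
    ∃ n : Plane, ‖n‖ = 1 ∧
      Tendsto (fun r : ℝ => ⨍ y in Metric.ball x r, ν y ∂μ) (𝓝[>] 0) (𝓝 n)}

/-! ### Clusters -/

/-- An `(N, M)`-cluster in the plane: the first `N` chambers are proper (positive finite area),
the last `M` are improper (infinite area). -/
structure IsCluster (N M : ℕ) (X : Fin (N + M) → Set Plane) : Prop where
  locallyFinitePerimeter : ∀ j, HasLocallyFinitePerimeter (X j)
  proper : ∀ j, j.val < N → 0 < volume (X j) ∧ volume (X j) < ∞
  improper : ∀ j, N ≤ j.val → volume (X j) = ∞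
  null_overlap : ∀ j k, j ≠ k → volume (X j ∩ X k) = 0
  full_measure : volume (⋃ j, X j)ᶜ = 0

/-- The area vector of a cluster. -/
noncomputable def areaVector {m : ℕ} (X : Fin m → Set Plane) : Fin m → ℝ≥0∞ :=
  fun j => volume (X j)

/-- The interface between two chambers. -/
def interface {m : ℕ} (X : Fin m → Set Plane) (j k : Fin m) : Set Plane :=
  reducedBoundary (X j) ∩ reducedBoundary (X k)

/-- The relative perimeter `P(X; F)`: the total length inside `F` of all the interfaces. -/
noncomputable def relPerimeter {m : ℕ} (X : Fin m → Set Plane) (F : Set Plane) : ℝ≥0∞ :=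
  ∑ j : Fin m, ∑ k ∈ Finset.Ioi j, Measure.hausdorffMeasure 1 (F ∩ interface X j k)

/-- The cluster distance in `F`. -/
noncomputable def clusterDist {m : ℕ} (F : Set Plane) (X Y : Fin m → Set Plane) : ℝ≥0∞ :=
  ∑ j : Fin m, volume (F ∩ symmDiff (X j) (Y j))

/-- Local convergence of a family of clusters along a filter. -/
def LocallyConverges {ι : Type*} {m : ℕ} (l : Filter ι) (X : ι → Fin m → Set Plane)
    (Y : Fin m → Set Plane) : Prop :=
  ∀ K : Set Plane, IsCompact K → Tendsto (fun i => clusterDist K (X i) Y) l (𝓝 0)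

/-! ### The standard lens cluster -/

/-- The radius `R` of the arcs of the lens of unit area. -/
noncomputable def lensRadius : ℝ := (√(2 * π / 3 - √3 / 2))⁻¹

/-- The closed lens bounded by two symmetric arcs of radius `R`. -/
noncomputable def lens : Set Plane :=
  {z | |z 0| ≤ √3 / 2 * lensRadius ∧ |z 1| ≤ √(lensRadius ^ 2 - z 0 ^ 2) - lensRadius / 2}

/-- The standard lens cluster: the lens, and what remains of the closed upper and of the closed
lower half-plane outside the interior of the lens. -/
noncomputable def lensCluster : Fin 3 → Set Plane :=
  ![lens, {z | 0 ≤ z 1} \ interior lens, {z | z 1 ≤ 0} \ interior lens]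

/-! ### Standard double bubbles with a vertical axis of symmetry

The triple junctions are `(-h, s)` and `(h, s)`. For `-π < φ < π` consider the arc from `(-h, s)`
to `(h, s)` which leaves `(-h, s)` in the direction `(cos φ, sin φ)`: it is a circular arc,
above the chord if `φ > 0` and below it if `φ < 0`, and it is the chord if `φ = 0`. -/

/-- Centre of the circle which supports the arc of direction `φ` (for `φ ≠ 0`). -/
noncomputable def arcCenter (s h φ : ℝ) : Plane := !₂[0, s - h * cos φ / sin φ]

/-- Radius of the circle which supports the arc of direction `φ` (for `φ ≠ 0`). -/
noncomputable def arcRadius (h φ : ℝ) : ℝ := h / |sin φ|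

/-- The region enclosed by the arc of direction `φ₁` (below the chord) and the arc of
direction `φ₂` (above the chord). -/
def enclosedRegion (s h φ₁ φ₂ : ℝ) : Set Plane :=
  {z | (s ≤ z 1 ∧ z ∈ Metric.ball (arcCenter s h φ₂) (arcRadius h φ₂)) ∨
    (z 1 ≤ s ∧ z ∈ Metric.ball (arcCenter s h φ₁) (arcRadius h φ₁))}

/-- The side of the (generalized) circle supporting the arc of direction `φ` that contains the
points just below this arc: the inside of the circle if the arc is bent upwards, the outside
if it is bent downwards, and the lower half-plane if the arc is the chord. -/
def belowArc (s h φ : ℝ) : Set Plane :=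
  {z | (0 < φ ∧ dist z (arcCenter s h φ) < arcRadius h φ) ∨ (φ = 0 ∧ z 1 < s) ∨
    (φ < 0 ∧ arcRadius h φ < dist z (arcCenter s h φ))}

/-- The opposite side of the (generalized) circle supporting the arc of direction `φ`. -/
def aboveArc (s h φ : ℝ) : Set Plane :=
  {z | (0 < φ ∧ arcRadius h φ < dist z (arcCenter s h φ)) ∨ (φ = 0 ∧ s < z 1) ∨
    (φ < 0 ∧ dist z (arcCenter s h φ) < arcRadius h φ)}

/-- The two bounded chambers (the first one below, the second one above the arc of
direction `φ₀`) and the exterior chamber. -/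
def bubbleCluster (s h φ₀ φ₁ φ₂ : ℝ) : Fin 3 → Set Plane :=
  ![enclosedRegion s h φ₁ φ₂ ∩ belowArc s h φ₀,
    enclosedRegion s h φ₁ φ₂ ∩ aboveArc s h φ₀,
    (closure (enclosedRegion s h φ₁ φ₂ ∩ belowArc s h φ₀ ∪
      enclosedRegion s h φ₁ φ₂ ∩ aboveArc s h φ₀))ᶜ]

/-- `D` is the standard double bubble with area vector `(1, A, ∞)`: three circular arcs (the
common one of which may be a segment) meeting at angles of 120 degrees in the two triple
junctions. It is placed so that the `y`-axis is its axis of symmetry, the chamber `D 0` of unit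
area lies below `D 1`, and the circle which supports the interface between `D 1` and the
exterior `D 2` is tangent to the `x`-axis at the origin, with centre on the positive
`y`-axis. -/
def IsNormalizedDoubleBubble (A : ℝ) (D : Fin 3 → Set Plane) : Prop :=
  ∃ s h φ₀ φ₁ φ₂ : ℝ, 0 < h ∧ (-π < φ₁ ∧ φ₁ < 0) ∧ (0 < φ₂ ∧ φ₂ < π) ∧
    φ₀ - φ₁ = 2 * π / 3 ∧ φ₂ - φ₀ = 2 * π / 3 ∧
    D = bubbleCluster s h φ₀ φ₁ φ₂ ∧
    areaVector D = ![1, ENNReal.ofReal A, ∞] ∧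
    ∃ ρ : ℝ, 0 < ρ ∧ arcCenter s h φ₂ = !₂[0, ρ] ∧ arcRadius h φ₂ = ρ

/-!
All circles through the two triple junctions `(-h, s)` and `(h, s)` form a pencil, and the circle
supporting the arc of direction `φ` is the zero set of a function `arcFn s h φ` which is linear in
`(sin φ, cos φ)`. The three functions of directions `φ - 2π/3`, `φ`, `φ + 2π/3`
therefore sum to zero, so that off a null set each point lies in exactly one of three sectors
`{0 < arcFn s h ψ, arcFn s h (ψ + 2π/3) < 0}`. These sectors are the chambers of the double bubble
(`bubbleCluster_ae_eq`) and, for `s = 0`, `h = √3 R / 2` and `φ = π/3`, those of the lens cluster,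
whose third arc has direction `π` and consists of two half-lines (`lensCluster_ae_eq`). Double
bubbles and lens thus belong to a single continuous family, and the theorem becomes a statement
about its parameters.

* Sectors have locally finite perimeter: the divergence theorem is proved in discs by polar
  coordinates and in half-planes by slicing, and it passes to intersections because finitely many
  corners are removed by cutoff functions (`gaussGreenOn_inter`). The normal is continuous along
  the arcs, so that the interfaces are the arcs up to their endpoints
  (`relPerimeter_sectorCluster_le`, `le_relPerimeter_sectorCluster`).
* The areas are `h ^ 2 * V ψ`, with `V` continuous and finite on `(-π, π/3)` and infinite at both
  ends. By the intermediate value theorem a double bubble with areas `1` and `A` exists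
  (`exists_volume_sector_eq_mul`). If `V φ = A * V (φ - 2π/3)` with `A → ∞`, then `φ → π/3`
  (`tendsto_direction`). Hence `h ^ 2 = 1 / V (φ - 2π/3)` tends to `1 / V (-π/3)`, which is its
  value for the lens because the lens has area one, and the tangency to the `x`-axis forces
  `s → 0` (`tendsto_parameters`).
* Convergence of the parameters implies pointwise convergence of the indicator functions off the
  limiting circles, hence local convergence. The arcs, parametrized by arc length from the lowest
  point of the circle, converge pointwise, and Fatou's lemma for sets gives the lower semicontinuity
  of their lengths in an open set. For the outer arc, whose radius tends to infinity, this uses the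
  tangency at the origin (`hausdorffMeasure_le_liminf_openArc_pi`).
-/

/-! ### Length on circles and horizontal lines -/

theorem dist_plane_sq (z w : Plane) : dist z w ^ 2 = (z 0 - w 0) ^ 2 + (z 1 - w 1) ^ 2 := by
  rw [EuclideanSpace.dist_eq, Real.sq_sqrt (by positivity)]
  simp [Fin.sum_univ_two, Real.dist_eq, sq_abs]

theorem plane_ext {z w : Plane} (h0 : z 0 = w 0) (h1 : z 1 = w 1) : z = w := by
  ext i; fin_cases i
  · exact h0
  · exact h1

/-- Arc length parametrization of the circle with centre `c` and radius `r`; the point of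
parameter `0` is the one at angle `θ`. -/
noncomputable def circleCurve (c : Plane) (r θ t : ℝ) : Plane :=
  !₂[c 0 + r * cos (t / r + θ), c 1 + r * sin (t / r + θ)]

@[simp] theorem circleCurve_zero (c : Plane) (r θ t : ℝ) :
    circleCurve c r θ t 0 = c 0 + r * cos (t / r + θ) := by simp [circleCurve]

@[simp] theorem circleCurve_one (c : Plane) (r θ t : ℝ) :
    circleCurve c r θ t 1 = c 1 + r * sin (t / r + θ) := by simp [circleCurve]

theorem continuous_circleCurve (c : Plane) (r θ : ℝ) : Continuous (circleCurve c r θ) := by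
  unfold circleCurve
  fun_prop

theorem dist_circleCurve (c : Plane) {r : ℝ} (hr : 0 < r) (θ t u : ℝ) :
    dist (circleCurve c r θ t) (circleCurve c r θ u) = 2 * r * |sin ((t - u) / (2 * r))| := by
  rw [← sq_eq_sq₀ dist_nonneg (by positivity), dist_plane_sq]
  simp only [circleCurve_zero, circleCurve_one]
  obtain ⟨m, hm⟩ : ∃ m, m = (t + u) / (2 * r) + θ := ⟨_, rfl⟩
  obtain ⟨d, hd⟩ : ∃ d, d = (t - u) / (2 * r) := ⟨_, rfl⟩
  have et : t / r + θ = m + d := by rw [hm, hd]; field_simp; ring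
  have eu : u / r + θ = m - d := by rw [hm, hd]; field_simp; ring
  rw [et, eu, ← hd, cos_add, cos_sub, sin_add, sin_sub, mul_pow, sq_abs]
  linear_combination 4 * r ^ 2 * sin d ^ 2 * sin_sq_add_cos_sq m

theorem circleCurve_image (c : Plane) {r : ℝ} (hr : 0 < r) (θ : ℝ) :
    circleCurve c r θ '' Ioc (-(π * r)) (π * r) = Metric.sphere c r := by
  ext z
  constructor
  · rintro ⟨t, -, rfl⟩
    rw [Metric.mem_sphere, ← sq_eq_sq₀ dist_nonneg hr.le, dist_plane_sq]
    simp only [circleCurve_zero, circleCurve_one]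
    linear_combination r ^ 2 * sin_sq_add_cos_sq (t / r + θ)
  · intro hz
    rw [Metric.mem_sphere, ← sq_eq_sq₀ dist_nonneg hr.le, dist_plane_sq] at hz
    set w : ℂ := ⟨z 0 - c 0, z 1 - c 1⟩ with hw
    have hn : ‖w‖ = r := by
      rw [← sq_eq_sq₀ (norm_nonneg _) hr.le, ← Complex.normSq_eq_norm_sq, Complex.normSq_apply]
      simp only [hw]; linarith
    have hw0 : w ≠ 0 := by rw [← norm_pos_iff, hn]; exact hr
    set φ := Complex.arg w with hφ
    have hc : r * cos φ = z 0 - c 0 := by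
      rw [hφ, Complex.cos_arg hw0, hn]; field_simp; simp [hw]
    have hs : r * sin φ = z 1 - c 1 := by
      rw [hφ, Complex.sin_arg, hn]; field_simp; simp [hw]
    have hm := toIocMod_mem_Ioc two_pi_pos (-π) (φ - θ)
    have e : toIocMod two_pi_pos (-π) (φ - θ) + θ
        = φ - (toIocDiv two_pi_pos (-π) (φ - θ)) * (2 * π) := by
      rw [toIocMod]; simp only [zsmul_eq_mul]; ring
    refine ⟨r * toIocMod two_pi_pos (-π) (φ - θ), ⟨?_, ?_⟩, plane_ext ?_ ?_⟩
    · nlinarith [hm.1]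
    · nlinarith [hm.2]
    · rw [circleCurve_zero, mul_div_cancel_left₀ _ hr.ne', e, cos_sub_int_mul_two_pi, hc]; ring
    · rw [circleCurve_one, mul_div_cancel_left₀ _ hr.ne', e, sin_sub_int_mul_two_pi, hs]; ring

theorem injOn_circleCurve (c : Plane) {r : ℝ} (hr : 0 < r) (θ : ℝ) :
    InjOn (circleCurve c r θ) (Ioc (-(π * r)) (π * r)) := by
  intro t ht u hu h
  have h0 := dist_circleCurve c hr θ t u
  rw [h, dist_self] at h0
  have h1 : sin ((t - u) / (2 * r)) = 0 := by
    have : |sin ((t - u) / (2 * r))| = 0 := by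
      rcases mul_eq_zero.1 h0.symm with h | h
      · linarith
      · exact h
    simpa using this
  have h2 : (t - u) / (2 * r) = 0 := by
    refine (sin_eq_zero_iff_of_lt_of_lt ?_ ?_).1 h1
    · rw [lt_div_iff₀ (by positivity)]; linarith [ht.1, hu.2]
    · rw [div_lt_iff₀ (by positivity)]; linarith [ht.2, hu.1]
  rw [div_eq_zero_iff] at h2
  rcases h2 with h | h <;> linarith

theorem lipschitzWith_circleCurve (c : Plane) {r : ℝ} (hr : 0 < r) (θ : ℝ) :
    LipschitzWith 1 (circleCurve c r θ) := by
  refine LipschitzWith.of_dist_le_mul fun t u => ?_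
  rw [dist_circleCurve c hr, Real.dist_eq, NNReal.coe_one, one_mul]
  have : |sin ((t - u) / (2 * r))| ≤ |(t - u) / (2 * r)| := abs_sin_le_abs
  rw [abs_div, abs_of_pos (by positivity : 0 < 2 * r), le_div_iff₀ (by positivity)] at this
  linarith

/-- On a parameter set of diameter at most `2 * r * δ`, the curve shrinks lengths by a factor
at most `1 - δ ^ 2 / 6`. -/
theorem le_hausdorffMeasure_circleCurve_image_small (c : Plane) {r : ℝ} (hr : 0 < r) (θ : ℝ)
    {δ : ℝ} (hδ : 0 < δ) (hδ1 : δ ≤ 1) {S : Set ℝ}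
    (hS : ∀ t ∈ S, ∀ u ∈ S, |t - u| ≤ 2 * r * δ) :
    ENNReal.ofReal (1 - δ ^ 2 / 6) * volume S
      ≤ Measure.hausdorffMeasure 1 (circleCurve c r θ '' S) := by
  have hk : 0 < 1 - δ ^ 2 / 6 := by nlinarith
  set K : NNReal := ⟨(1 - δ ^ 2 / 6)⁻¹, by positivity⟩ with hK
  have hanti : AntilipschitzWith K (fun t : S => circleCurve c r θ t) := by
    refine AntilipschitzWith.of_le_mul_dist fun t u => ?_
    rw [dist_circleCurve c hr, Subtype.dist_eq, Real.dist_eq]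
    have key : ∀ x : ℝ, 0 ≤ x → x ≤ δ → (1 - δ ^ 2 / 6) * x ≤ sin x := by
      intro x hx0 hx
      rcases hx0.eq_or_lt with rfl | hx0
      · simp
      · have := sin_gt_sub_cube hx0
        have : x ^ 2 ≤ δ ^ 2 := by gcongr
        nlinarith
    have h1 : |(t : ℝ) - u| / (2 * r) ≤ δ := by
      rw [div_le_iff₀ (by positivity)]; linarith [hS t t.2 u u.2]
    have h2 := key _ (by positivity) h1
    have h3 : |sin (((t : ℝ) - u) / (2 * r))| = |sin (|(t : ℝ) - u| / (2 * r))| := by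
      rcases abs_choice ((t : ℝ) - u) with h | h <;> rw [h]
      rw [neg_div, sin_neg, abs_neg]
    have h4 : (K : ℝ) = (1 - δ ^ 2 / 6)⁻¹ := rfl
    rw [h3, h4, inv_mul_eq_div, le_div_iff₀ hk]
    have h5 := h2.trans (le_abs_self _)
    rw [mul_div_assoc', div_le_iff₀ (by positivity)] at h5
    linarith
  have h1 := hanti.le_hausdorffMeasure_image zero_le_one univ
  have h2 : Measure.hausdorffMeasure 1 (univ : Set S) = volume S := by
    rw [← hausdorffMeasure_real, ← (isometry_subtype_coe (s := S)).hausdorffMeasure_image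
      (Or.inl zero_le_one)]
    simp
  have h3 : (fun t : S => circleCurve c r θ t) '' univ = circleCurve c r θ '' S := by
    ext; simp
  rw [h2, h3, ENNReal.rpow_one] at h1
  calc _ ≤ ENNReal.ofReal (1 - δ ^ 2 / 6) * (K * _) := by gcongr
    _ = _ := by
      have : (K : ℝ≥0∞) = (ENNReal.ofReal (1 - δ ^ 2 / 6))⁻¹ := by
        rw [← ENNReal.ofReal_inv_of_pos hk, ENNReal.ofReal, Real.toNNReal_of_nonneg (by positivity)]
        rfl
      rw [this, ← mul_assoc, ENNReal.mul_inv_cancel (by simpa using hk) ENNReal.ofReal_ne_top,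
        one_mul]

/-- The parametrization by arc length preserves length. -/
theorem hausdorffMeasure_circleCurve_image (c : Plane) {r : ℝ} (hr : 0 < r) (θ : ℝ) {S : Set ℝ}
    (hS : MeasurableSet S) (hSI : S ⊆ Ioc (-(π * r)) (π * r)) :
    Measure.hausdorffMeasure 1 (circleCurve c r θ '' S) = volume S := by
  apply le_antisymm
  · simpa [hausdorffMeasure_real] using
      (lipschitzWith_circleCurve c hr θ).hausdorffMeasure_image_le zero_le_one S
  · have key : ∀ N : ℕ, 4 ≤ N → ENNReal.ofReal (1 - (π / N) ^ 2 / 6) * volume S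
        ≤ Measure.hausdorffMeasure 1 (circleCurve c r θ '' S) := by
      intro N hN
      have hN0 : (0 : ℝ) < N := by positivity
      set a : ℕ → ℝ := fun i => -(π * r) + i * (2 * π * r / N) with ha
      have hstep : 0 ≤ 2 * π * r / N := by positivity
      have hmono : Monotone a := by
        intro i j hij
        simp only [ha]
        gcongr
      have hunion : ⋃ i ∈ Finset.range N, S ∩ Ioc (a i) (a (i + 1)) = S := by
        rw [← Set.inter_iUnion₂, Set.inter_eq_left]
        refine hSI.trans ?_
        intro t ht
        have hx : 0 < (t + π * r) / (2 * π * r / N) := by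
          have := ht.1
          apply div_pos (by linarith) (by positivity)
        set k := ⌈(t + π * r) / (2 * π * r / N)⌉₊ with hk
        have hk0 : 0 < k := Nat.ceil_pos.2 hx
        have hk1 := Nat.le_ceil ((t + π * r) / (2 * π * r / N))
        have hk2 := Nat.ceil_lt_add_one hx.le
        rw [← hk] at hk1 hk2
        have hkN : k ≤ N := by
          rw [hk, Nat.ceil_le, div_le_iff₀ (by positivity)]
          have := ht.2
          field_simp
          linarith
        simp only [mem_iUnion, Finset.mem_range, exists_prop]
        refine ⟨k - 1, by omega, ?_, ?_⟩
        · have : ((k - 1 : ℕ) : ℝ) = k - 1 := by push_cast [Nat.cast_sub hk0]; simp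
          simp only [ha, this]
          have := (lt_div_iff₀ (by positivity : 0 < 2 * π * r / N)).1 (sub_lt_iff_lt_add.2 hk2)
          linarith
        · rw [Nat.sub_add_cancel hk0]
          simp only [ha]
          rw [div_le_iff₀ (by positivity)] at hk1
          linarith
      have hdisj : Pairwise (Function.onFun Disjoint (fun i => S ∩ Ioc (a i) (a (i + 1)))) := by
        intro i j hij
        exact (hmono.pairwise_disjoint_on_Ioc_succ hij).mono inter_subset_right inter_subset_right
      have hmeas : ∀ i, MeasurableSet (S ∩ Ioc (a i) (a (i + 1))) :=
        fun i => hS.inter measurableSet_Ioc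
      have himg : circleCurve c r θ '' S
          = ⋃ i ∈ Finset.range N, circleCurve c r θ '' (S ∩ Ioc (a i) (a (i + 1))) := by
        rw [← image_iUnion₂, hunion]
      have hinj := injOn_circleCurve c hr θ
      rw [himg, measure_biUnion_finset]
      · nth_rewrite 1 [← hunion]
        rw [measure_biUnion_finset (fun i _ j _ hij => hdisj hij) (fun i _ => hmeas i),
          Finset.mul_sum]
        refine Finset.sum_le_sum fun i _ => ?_
        refine le_hausdorffMeasure_circleCurve_image_small c hr θ (by positivity) ?_ ?_
        · rw [div_le_one hN0]
          have : (4 : ℝ) ≤ N := by exact_mod_cast hN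
          linarith [pi_lt_four]
        · intro t ht u hu
          have h1 := ht.2.1; have h2 := ht.2.2; have h3 := hu.2.1; have h4 := hu.2.2
          have h5 : a (i + 1) - a i = 2 * r * (π / N) := by
            simp only [ha]; push_cast; ring
          rw [abs_le]; constructor <;> linarith
      · intro i _ j _ hij
        exact (hdisj hij).image hinj (inter_subset_left.trans hSI) (inter_subset_left.trans hSI)
      · intro i _
        exact (hmeas i).image_of_continuousOn_injOn (continuous_circleCurve c r θ).continuousOn
          (hinj.mono (inter_subset_left.trans hSI))
    have hlim : Tendsto (fun N : ℕ => ENNReal.ofReal (1 - (π / N) ^ 2 / 6) * volume S) atTop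
        (𝓝 (ENNReal.ofReal (1 - 0 ^ 2 / 6) * volume S)) := by
      refine ENNReal.Tendsto.mul_const ?_ (Or.inl (by simp))
      refine ENNReal.tendsto_ofReal ?_
      have : Tendsto (fun N : ℕ => π / (N : ℝ)) atTop (𝓝 0) := tendsto_const_div_atTop_nhds_zero_nat π
      exact ((this.pow 2).div_const 6).const_sub 1
    have := le_of_tendsto hlim (eventually_atTop.2 ⟨4, key⟩)
    simpa using this

/-- Length of a subset of a circle. -/
theorem hausdorffMeasure_inter_sphere (c : Plane) {r : ℝ} (hr : 0 < r) (θ : ℝ) {B : Set Plane}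
    (hB : MeasurableSet B) :
    Measure.hausdorffMeasure 1 (B ∩ Metric.sphere c r)
      = volume (Ioc (-(π * r)) (π * r) ∩ circleCurve c r θ ⁻¹' B) := by
  rw [← hausdorffMeasure_circleCurve_image c hr θ
    (measurableSet_Ioc.inter ((continuous_circleCurve c r θ).measurable hB)) inter_subset_left,
    image_inter_preimage, circleCurve_image c hr, inter_comm]

/-- The length measure of a circle is the image of Lebesgue measure under the parametrization
by arc length. -/
theorem hausdorffMeasure_restrict_sphere (c : Plane) {r : ℝ} (hr : 0 < r) (θ : ℝ) :
    (Measure.hausdorffMeasure 1).restrict (Metric.sphere c r)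
      = (volume.restrict (Ioc (-(π * r)) (π * r))).map (circleCurve c r θ) := by
  ext B hB
  rw [Measure.restrict_apply hB, hausdorffMeasure_inter_sphere c hr θ hB,
    Measure.map_apply (continuous_circleCurve c r θ).measurable hB,
    Measure.restrict_apply ((continuous_circleCurve c r θ).measurable hB), inter_comm]

/-- Arc length parametrization of the horizontal line at height `s`. -/
noncomputable def lineCurve (s t : ℝ) : Plane := !₂[t, s]

@[simp] theorem lineCurve_zero (s t : ℝ) : lineCurve s t 0 = t := by simp [lineCurve]

@[simp] theorem lineCurve_one (s t : ℝ) : lineCurve s t 1 = s := by simp [lineCurve]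

theorem continuous_lineCurve (s : ℝ) : Continuous (lineCurve s) := by
  unfold lineCurve
  fun_prop

theorem isometry_lineCurve (s : ℝ) : Isometry (lineCurve s) := by
  refine Isometry.of_dist_eq fun t u => ?_
  rw [← sq_eq_sq₀ dist_nonneg dist_nonneg, dist_plane_sq, Real.dist_eq, sq_abs]
  simp

theorem hausdorffMeasure_inter_line (s : ℝ) (B : Set Plane) :
    Measure.hausdorffMeasure 1 (B ∩ {z | z 1 = s}) = volume (lineCurve s ⁻¹' B) := by
  rw [← hausdorffMeasure_real,
    ← (isometry_lineCurve s).hausdorffMeasure_image (Or.inl zero_le_one), image_preimage_eq_inter_range]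
  congr 2
  ext z
  simp only [mem_ofPred_eq, mem_range]
  constructor
  · intro h; exact ⟨z 0, plane_ext (by simp) (by simp [h])⟩
  · rintro ⟨t, rfl⟩; simp

theorem hausdorffMeasure_restrict_line (s : ℝ) :
    (Measure.hausdorffMeasure 1).restrict {z : Plane | z 1 = s}
      = (volume : Measure ℝ).map (lineCurve s) := by
  ext B hB
  rw [Measure.restrict_apply hB, hausdorffMeasure_inter_line s B,
    Measure.map_apply (continuous_lineCurve s).measurable hB]

/-! ### The divergence theorem in discs and half-planes -/

theorem divergence_eq (T : Plane → Plane) (x : Plane) :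
    divergence T x = fderiv ℝ T x (EuclideanSpace.single 0 1) 0
      + fderiv ℝ T x (EuclideanSpace.single 1 1) 1 := by
  simp [divergence, Fin.sum_univ_two]

theorem plane_eq_sum (v : Plane) :
    v = v 0 • EuclideanSpace.single 0 (1 : ℝ) + v 1 • EuclideanSpace.single 1 (1 : ℝ) := by
  apply plane_ext <;> simp

theorem inner_plane (v w : Plane) : inner ℝ v w = v 0 * w 0 + v 1 * w 1 := by
  simp [PiLp.inner_apply, Fin.sum_univ_two, mul_comm]

theorem continuous_divergence {T : Plane → Plane} (hT : ContDiff ℝ 1 T) :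
    Continuous (divergence T) := by
  have h := hT.continuous_fderiv one_ne_zero
  simp only [funext (divergence_eq T)]
  fun_prop

theorem divergence_eq_zero_of_notMem_tsupport {T : Plane → Plane} {x : Plane}
    (hx : x ∉ tsupport T) : divergence T x = 0 := by
  have : fderiv ℝ T x = 0 := by
    by_contra h
    exact hx (support_fderiv_subset ℝ h)
  simp [divergence_eq, this]

theorem hasCompactSupport_divergence {T : Plane → Plane} (hT : HasCompactSupport T) :
    HasCompactSupport (divergence T) :=
  HasCompactSupport.intro hT fun _ hx => divergence_eq_zero_of_notMem_tsupport hx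

theorem integrable_divergence {T : Plane → Plane} (hT : ContDiff ℝ 1 T)
    (hc : HasCompactSupport T) : Integrable (divergence T) :=
  (continuous_divergence hT).integrable_of_hasCompactSupport (hasCompactSupport_divergence hc)

theorem divergence_add {T T' : Plane → Plane} (hT : ContDiff ℝ 1 T) (hT' : ContDiff ℝ 1 T')
    (x : Plane) : divergence (T + T') x = divergence T x + divergence T' x := by
  have h1 := (hT.differentiable one_ne_zero) x
  have h2 := (hT'.differentiable one_ne_zero) x
  simp only [divergence_eq, fderiv_add h1 h2, add_apply, PiLp.add_apply]
  ring

theorem divergence_smul {η : Plane → ℝ} {T : Plane → Plane} (hη : ContDiff ℝ 1 η)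
    (hT : ContDiff ℝ 1 T) (x : Plane) :
    divergence (fun z => η z • T z) x = η x * divergence T x + fderiv ℝ η x (T x) := by
  have h1 := (hη.differentiable one_ne_zero) x
  have h2 := (hT.differentiable one_ne_zero) x
  have h3 : fderiv ℝ η x (T x) = T x 0 * fderiv ℝ η x (EuclideanSpace.single 0 1)
      + T x 1 * fderiv ℝ η x (EuclideanSpace.single 1 1) := by
    conv_lhs => rw [plane_eq_sum (T x)]
    rw [map_add, map_smul, map_smul, smul_eq_mul, smul_eq_mul]
  rw [divergence_eq, divergence_eq, fderiv_fun_smul h1 h2, h3]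
  simp
  ring

/-- The divergence theorem for the set `E` with boundary `Γ`, carrying the length measure, and
outer normal `w`. -/
def GaussGreenOn (E Γ : Set Plane) (w : Plane → Plane) : Prop :=
  ∀ T : Plane → Plane, ContDiff ℝ 1 T → HasCompactSupport T →
    ∫ x in E, divergence T x = ∫ x in Γ, inner ℝ (T x) (w x) ∂(Measure.hausdorffMeasure 1)

theorem integral_plane (F : Plane → ℝ) :
    ∫ z, F z = ∫ p : ℝ × ℝ, F !₂[p.1, p.2] := by
  have h1 := (EuclideanSpace.volume_preserving_symm_measurableEquiv_toLp (Fin 2)).symm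
  have h2 := (volume_preserving_finTwoArrow ℝ).symm
  rw [← h1.integral_comp (MeasurableEquiv.measurableEmbedding _),
    ← h2.integral_comp (MeasurableEquiv.measurableEmbedding _)]
  rfl

/-- Integration over a disc in polar coordinates. -/
theorem setIntegral_ball_eq (c : Plane) {r : ℝ} (hr : 0 < r) {f : Plane → ℝ} (hf : Continuous f) :
    ∫ z in Metric.ball c r, f z
      = ∫ ρ in (0 : ℝ)..r, ∫ θ in (-π)..π, ρ * f !₂[c 0 + ρ * cos θ, c 1 + ρ * sin θ] := by
  rw [← integral_indicator Metric.isOpen_ball.measurableSet,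
    ← integral_add_left_eq_self _ c, integral_plane, ← integral_comp_polarCoord_symm]
  have h1 : ∀ p : ℝ × ℝ, p ∈ polarCoord.target →
      p.1 • (Metric.ball c r).indicator f (c + !₂[(polarCoord.symm p).1, (polarCoord.symm p).2])
      = (Ioo 0 r ×ˢ Ioo (-π) π).indicator
        (fun p : ℝ × ℝ => p.1 * f !₂[c 0 + p.1 * cos p.2, c 1 + p.1 * sin p.2]) p := by
    rintro ⟨ρ, θ⟩ hp
    rw [polarCoord_target] at hp
    have hρ : 0 < ρ := hp.1
    have e : c + !₂[(polarCoord.symm (ρ, θ)).1, (polarCoord.symm (ρ, θ)).2]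
        = !₂[c 0 + ρ * cos θ, c 1 + ρ * sin θ] := by
      apply plane_ext <;> simp
    have hmem : !₂[c 0 + ρ * cos θ, c 1 + ρ * sin θ] ∈ Metric.ball c r ↔ ρ < r := by
      rw [Metric.mem_ball, ← sq_lt_sq₀ dist_nonneg hr.le, dist_plane_sq, ← sq_lt_sq₀ hρ.le hr.le]
      have : (!₂[c 0 + ρ * cos θ, c 1 + ρ * sin θ] 0 - c 0) ^ 2
          + (!₂[c 0 + ρ * cos θ, c 1 + ρ * sin θ] 1 - c 1) ^ 2 = ρ ^ 2 := by
        simp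
        linear_combination ρ ^ 2 * sin_sq_add_cos_sq θ
      rw [this]
    rw [e]
    by_cases h : ρ < r
    · rw [indicator_of_mem (hmem.2 h), indicator_of_mem (show (ρ, θ) ∈ Ioo 0 r ×ˢ Ioo (-π) π from ⟨⟨hρ, h⟩, hp.2⟩),
        smul_eq_mul]
    · rw [indicator_of_notMem (fun h' => h (hmem.1 h')),
        indicator_of_notMem (fun h' : (ρ, θ) ∈ Ioo 0 r ×ˢ Ioo (-π) π => h h'.1.2), smul_zero]
  rw [setIntegral_congr_fun polarCoord.open_target.measurableSet h1,
    setIntegral_indicator (measurableSet_Ioo.prod measurableSet_Ioo)]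
  have h2 : polarCoord.target ∩ Ioo 0 r ×ˢ Ioo (-π) π = Ioo 0 r ×ˢ Ioo (-π) π := by
    rw [inter_eq_right, polarCoord_target]
    exact prod_mono Ioo_subset_Ioi_self subset_rfl
  have hcont : Continuous
      (fun p : ℝ × ℝ => p.1 * f !₂[c 0 + p.1 * cos p.2, c 1 + p.1 * sin p.2]) := by
    fun_prop
  rw [h2, Measure.volume_eq_prod, setIntegral_prod]
  · rw [intervalIntegral.integral_of_le hr.le, integral_Ioc_eq_integral_Ioo]
    refine integral_congr_ae (Eventually.of_forall fun ρ => ?_)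
    simp only
    rw [intervalIntegral.integral_of_le (by linarith [pi_pos]), integral_Ioc_eq_integral_Ioo]
  · have : IntegrableOn (fun p : ℝ × ℝ => p.1 * f !₂[c 0 + p.1 * cos p.2, c 1 + p.1 * sin p.2])
        (Icc 0 r ×ˢ Icc (-π) π) (volume.prod volume) :=
      hcont.continuousOn.integrableOn_compact (isCompact_Icc.prod isCompact_Icc)
    exact this.mono_set (prod_mono Ioo_subset_Icc_self Ioo_subset_Icc_self)

/-- The divergence theorem in a disc, with the boundary integral over the angle: `ρ div T` is the
sum of the radial derivative of `ρ T_ρ` and of the angular derivative of `T_θ`. -/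
theorem setIntegral_ball_divergence (c : Plane) {r : ℝ} (hr : 0 < r) {T : Plane → Plane}
    (hT : ContDiff ℝ 1 T) :
    ∫ z in Metric.ball c r, divergence T z
      = ∫ θ in (-π)..π, r * inner ℝ (T !₂[c 0 + r * cos θ, c 1 + r * sin θ]) !₂[cos θ, sin θ] := by
  rw [setIntegral_ball_eq c hr (continuous_divergence hT)]
  set p : ℝ → ℝ → Plane := fun ρ θ => !₂[c 0 + ρ * cos θ, c 1 + ρ * sin θ] with hp
  have hpc : Continuous (fun q : ℝ × ℝ => p q.1 q.2) := by simp only [hp]; fun_prop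
  have hTc := hT.continuous
  have hDc := hT.continuous_fderiv one_ne_zero
  have hTd := hT.differentiable one_ne_zero
  -- derivative of `ρ ↦ ρ T_ρ`
  set q₁ : ℝ → ℝ → ℝ := fun ρ θ => (T (p ρ θ) 0 * cos θ + T (p ρ θ) 1 * sin θ)
    + ρ * ((fderiv ℝ T (p ρ θ) !₂[cos θ, sin θ]) 0 * cos θ
      + (fderiv ℝ T (p ρ θ) !₂[cos θ, sin θ]) 1 * sin θ) with hq₁
  -- derivative of `θ ↦ T_θ`
  set q₂ : ℝ → ℝ → ℝ := fun ρ θ => -(T (p ρ θ) 0 * cos θ + T (p ρ θ) 1 * sin θ)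
    + ρ * ((fderiv ℝ T (p ρ θ) !₂[-sin θ, cos θ]) 1 * cos θ
      - (fderiv ℝ T (p ρ θ) !₂[-sin θ, cos θ]) 0 * sin θ) with hq₂
  have hq₁c : Continuous (fun q : ℝ × ℝ => q₁ q.1 q.2) := by
    simp only [hq₁]
    have := hTc.comp hpc
    have h3 : Continuous (fun q : ℝ × ℝ => fderiv ℝ T (p q.1 q.2) !₂[cos q.2, sin q.2]) :=
      (hDc.comp hpc).clm_apply (by fun_prop)
    fun_prop
  have hq₂c : Continuous (fun q : ℝ × ℝ => q₂ q.1 q.2) := by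
    simp only [hq₂]
    have := hTc.comp hpc
    have h3 : Continuous (fun q : ℝ × ℝ => fderiv ℝ T (p q.1 q.2) !₂[-sin q.2, cos q.2]) :=
      (hDc.comp hpc).clm_apply (by fun_prop)
    fun_prop
  have hsum : ∀ ρ θ, ρ * divergence T (p ρ θ) = q₁ ρ θ + q₂ ρ θ := by
    intro ρ θ
    have e1 : (!₂[cos θ, sin θ] : Plane) = cos θ • EuclideanSpace.single 0 (1 : ℝ)
        + sin θ • EuclideanSpace.single 1 (1 : ℝ) := by apply plane_ext <;> simp
    have e2 : (!₂[-sin θ, cos θ] : Plane) = (-sin θ) • EuclideanSpace.single 0 (1 : ℝ)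
        + cos θ • EuclideanSpace.single 1 (1 : ℝ) := by apply plane_ext <;> simp
    simp only [hq₁, hq₂, divergence_eq, e1, e2, map_add, map_smul, PiLp.add_apply, PiLp.smul_apply,
      smul_eq_mul]
    linear_combination (-ρ * (fderiv ℝ T (p ρ θ) (EuclideanSpace.single 0 1) 0
      + fderiv ℝ T (p ρ θ) (EuclideanSpace.single 1 1) 1)) * sin_sq_add_cos_sq θ
  have hcomp : ∀ (v : ℝ → Plane) (v' : Plane) (t : ℝ), HasDerivAt v v' t →
      ∀ i, HasDerivAt (fun t => T (v t) i) (fderiv ℝ T (v t) v' i) t := by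
    intro v v' t hv i
    have h1 : HasDerivAt (fun t => T (v t)) (fderiv ℝ T (v t) v') t :=
      ((hTd (v t)).hasFDerivAt.comp_hasDerivAt t hv)
    exact ((EuclideanSpace.proj (𝕜 := ℝ) i).hasFDerivAt.comp_hasDerivAt t h1)
  have hderivρ : ∀ ρ θ, HasDerivAt (fun ρ => p ρ θ) (!₂[cos θ, sin θ] : Plane) ρ := by
    intro ρ θ
    have e : (fun ρ => p ρ θ) = fun ρ => c + ρ • (!₂[cos θ, sin θ] : Plane) := by
      funext ρ; apply plane_ext <;> simp [hp]
    rw [e]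
    simpa using ((hasDerivAt_id ρ).smul_const (!₂[cos θ, sin θ] : Plane)).const_add c
  have hderivθ : ∀ ρ θ, HasDerivAt (fun θ => p ρ θ) (ρ • !₂[-sin θ, cos θ] : Plane) θ := by
    intro ρ θ
    have e : (fun θ => p ρ θ) = fun θ => c + ((ρ * cos θ) • EuclideanSpace.single 0 (1 : ℝ)
        + (ρ * sin θ) • EuclideanSpace.single 1 (1 : ℝ)) := by
      funext θ; apply plane_ext <;> simp [hp]
    have e' : (ρ • !₂[-sin θ, cos θ] : Plane) = (ρ * -sin θ) • EuclideanSpace.single 0 (1 : ℝ)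
        + (ρ * cos θ) • EuclideanSpace.single 1 (1 : ℝ) := by
      apply plane_ext <;> simp
    rw [e, e']
    exact ((((hasDerivAt_cos θ).const_mul ρ).smul_const _).add
      (((hasDerivAt_sin θ).const_mul ρ).smul_const _)).const_add c
  have hint₁ : ∀ θ, ∫ ρ in (0 : ℝ)..r, q₁ ρ θ = r * (T (p r θ) 0 * cos θ + T (p r θ) 1 * sin θ) := by
    intro θ
    have := intervalIntegral.integral_eq_sub_of_hasDerivAt (a := 0) (b := r)
      (f := fun ρ => ρ * (T (p ρ θ) 0 * cos θ + T (p ρ θ) 1 * sin θ)) (f' := fun ρ => q₁ ρ θ) ?_ ?_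
    · simpa using this
    · intro ρ _
      have h0 := hcomp _ _ ρ (hderivρ ρ θ) 0
      have h1 := hcomp _ _ ρ (hderivρ ρ θ) 1
      have := (hasDerivAt_id ρ).mul ((h0.mul_const (cos θ)).add (h1.mul_const (sin θ)))
      exact this.congr_deriv (by simp [hq₁])
    · exact (hq₁c.comp (by fun_prop : Continuous fun ρ : ℝ => (ρ, θ))).intervalIntegrable _ _
  have hint₂ : ∀ ρ, ∫ θ in (-π)..π, q₂ ρ θ = 0 := by
    intro ρ
    have := intervalIntegral.integral_eq_sub_of_hasDerivAt (a := -π) (b := π)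
      (f := fun θ => T (p ρ θ) 1 * cos θ - T (p ρ θ) 0 * sin θ) (f' := fun θ => q₂ ρ θ) ?_ ?_
    · rw [this]; simp [hp]
    · intro θ _
      have h0 := hcomp _ _ θ (hderivθ ρ θ) 0
      have h1 := hcomp _ _ θ (hderivθ ρ θ) 1
      have := (h1.mul (hasDerivAt_cos θ)).sub (h0.mul (hasDerivAt_sin θ))
      refine this.congr_deriv ?_
      simp only [hq₂, map_smul, PiLp.smul_apply, smul_eq_mul]
      ring
    · exact (hq₂c.comp (by fun_prop : Continuous fun θ : ℝ => (ρ, θ))).intervalIntegrable _ _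
  calc ∫ ρ in (0 : ℝ)..r, ∫ θ in (-π)..π, ρ * divergence T (p ρ θ)
      = ∫ ρ in (0 : ℝ)..r, ∫ θ in (-π)..π, q₁ ρ θ := by
        refine intervalIntegral.integral_congr fun ρ _ => ?_
        simp only [hsum]
        rw [intervalIntegral.integral_add, hint₂, add_zero]
        · exact (hq₁c.comp (by fun_prop : Continuous fun θ : ℝ => (ρ, θ))).intervalIntegrable _ _
        · exact (hq₂c.comp (by fun_prop : Continuous fun θ : ℝ => (ρ, θ))).intervalIntegrable _ _
    _ = ∫ θ in (-π)..π, ∫ ρ in (0 : ℝ)..r, q₁ ρ θ := by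
        refine intervalIntegral_intervalIntegral_swap ?_
        refine (hq₁c.continuousOn.integrableOn_compact
          (isCompact_uIcc.prod isCompact_uIcc)).mono_set
          (prod_mono uIoc_subset_uIcc uIoc_subset_uIcc)
    _ = _ := by
        refine intervalIntegral.integral_congr fun θ _ => ?_
        simp only [hint₁, inner_plane]
        simp [hp]

theorem gaussGreenOn_ball (c : Plane) {r : ℝ} (hr : 0 < r) :
    GaussGreenOn (Metric.ball c r) (Metric.sphere c r) (fun z => r⁻¹ • (z - c)) := by
  intro T hT _
  have hTc := hT.continuous
  rw [setIntegral_ball_divergence c hr hT, hausdorffMeasure_restrict_sphere c hr 0,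
    integral_map (continuous_circleCurve c r 0).aemeasurable
      (Continuous.aestronglyMeasurable (by fun_prop)),
    ← intervalIntegral.integral_of_le (by nlinarith [pi_pos])]
  have h := intervalIntegral.mul_integral_comp_mul_left (a := -π) (b := π) (c := r)
    (f := fun t => inner ℝ (T (circleCurve c r 0 t)) (r⁻¹ • (circleCurve c r 0 t - c)))
  have e : (-(π * r)) = r * -π := by ring
  rw [e, mul_comm π r, ← h, intervalIntegral.integral_const_mul]
  congr 1
  refine intervalIntegral.integral_congr fun θ _ => ?_
  have e1 : circleCurve c r 0 (r * θ) = !₂[c 0 + r * cos θ, c 1 + r * sin θ] := by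
    simp [circleCurve, mul_div_cancel_left₀ _ hr.ne']
  simp only [e1]
  congr 1
  apply plane_ext <;> simp <;> field_simp

theorem integral_divergence_eq_zero {T : Plane → Plane} (hT : ContDiff ℝ 1 T)
    (hc : HasCompactSupport T) : ∫ x, divergence T x = 0 := by
  obtain ⟨r, hr, hsub⟩ := hc.isBounded.subset_ball_lt 0 0
  have hoff : ∀ x, x ∉ Metric.ball (0 : Plane) r → T x = 0 := fun x hx =>
    image_eq_zero_of_notMem_tsupport fun h => hx (hsub h)
  have h := gaussGreenOn_ball 0 hr T hT hc
  rw [setIntegral_eq_integral_of_forall_compl_eq_zero (fun x hx =>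
    divergence_eq_zero_of_notMem_tsupport fun h => hx (hsub h))] at h
  rw [h]
  refine setIntegral_eq_zero_of_forall_eq_zero fun x hx => ?_
  rw [hoff x (by rw [Metric.mem_ball, Metric.mem_sphere.1 hx]; exact lt_irrefl r), inner_zero_left]

/-- Passing to the complement reverses the normal. -/
theorem GaussGreenOn.compl {E E' Γ : Set Plane} {w : Plane → Plane} (h : GaussGreenOn E Γ w)
    (hE : MeasurableSet E) (hE' : E' =ᵐ[volume] (Eᶜ : Set Plane)) :
    GaussGreenOn E' Γ (fun z => -w z) := by
  intro T hT hc
  have h1 := integral_add_compl hE (integrable_divergence hT hc)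
  rw [integral_divergence_eq_zero hT hc, h T hT hc] at h1
  rw [setIntegral_congr_set hE']
  simp only [inner_neg_right, integral_neg]
  linarith

theorem gaussGreenOn_upperHalfPlane (s : ℝ) :
    GaussGreenOn {z | s < z 1} {z | z 1 = s} (fun _ => !₂[0, -1]) := by
  intro T hT hc
  have hTc := hT.continuous
  have hTd := hT.differentiable one_ne_zero
  have hDc := hT.continuous_fderiv one_ne_zero
  rw [hausdorffMeasure_restrict_line,
    integral_map (continuous_lineCurve s).aemeasurable
      (Continuous.aestronglyMeasurable (by fun_prop))]
  have hmeas : MeasurableSet {z : Plane | s < z 1} :=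
    (isOpen_lt continuous_const (by fun_prop)).measurableSet
  -- the two partial derivatives, as functions on `ℝ × ℝ`
  have hpc : Continuous (fun p : ℝ × ℝ => (!₂[p.1, p.2] : Plane)) := by fun_prop
  have hcs : ∀ {g : Plane → ℝ}, HasCompactSupport g →
      HasCompactSupport (fun p : ℝ × ℝ => g !₂[p.1, p.2]) := by
    intro g hg
    refine hg.comp_isClosedEmbedding (g := fun p : ℝ × ℝ => (!₂[p.1, p.2] : Plane)) ?_
    have hl : Function.LeftInverse (fun z : Plane => ((z 0, z 1) : ℝ × ℝ))
        (fun p : ℝ × ℝ => (!₂[p.1, p.2] : Plane)) := fun p => by simp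
    exact hl.isClosedEmbedding (by fun_prop) hpc
  have hcomp : ∀ (i : Fin 2), ContDiff ℝ 1 (fun p : ℝ × ℝ => T !₂[p.1, p.2] i) := by
    intro i
    have hp : ContDiff ℝ 1 (fun p : ℝ × ℝ => (!₂[p.1, p.2] : Plane)) := by
      rw [contDiff_euclidean]
      intro j; fin_cases j
      · exact contDiff_fst
      · exact contDiff_snd
    exact contDiff_euclidean.1 (hT.comp hp) i
  have hTi : ∀ i : Fin 2, HasCompactSupport (fun z => T z i) := fun i =>
    hc.comp_left (g := fun z : Plane => z i) (by simp)
  have hx : ∀ p : ℝ × ℝ, HasDerivAt (fun x => T !₂[x, p.2] 0)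
      (fderiv ℝ T !₂[p.1, p.2] (EuclideanSpace.single 0 1) 0) p.1 := by
    intro p
    have hv : HasDerivAt (fun x : ℝ => (!₂[x, p.2] : Plane)) (EuclideanSpace.single 0 1) p.1 := by
      have e : (fun x : ℝ => (!₂[x, p.2] : Plane))
          = fun x : ℝ => !₂[0, p.2] + x • EuclideanSpace.single 0 (1 : ℝ) := by
        funext x; apply plane_ext <;> simp
      rw [e]
      simpa using ((hasDerivAt_id p.1).smul_const
        (EuclideanSpace.single (0 : Fin 2) (1 : ℝ))).const_add (!₂[0, p.2] : Plane)
    exact ((EuclideanSpace.proj (𝕜 := ℝ) 0).hasFDerivAt.comp_hasDerivAt p.1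
      ((hTd _).hasFDerivAt.comp_hasDerivAt p.1 hv))
  have hy : ∀ p : ℝ × ℝ, HasDerivAt (fun y => T !₂[p.1, y] 1)
      (fderiv ℝ T !₂[p.1, p.2] (EuclideanSpace.single 1 1) 1) p.2 := by
    intro p
    have hv : HasDerivAt (fun y : ℝ => (!₂[p.1, y] : Plane)) (EuclideanSpace.single 1 1) p.2 := by
      have e : (fun y : ℝ => (!₂[p.1, y] : Plane))
          = fun y : ℝ => !₂[p.1, 0] + y • EuclideanSpace.single 1 (1 : ℝ) := by
        funext x; apply plane_ext <;> simp
      rw [e]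
      simpa using ((hasDerivAt_id p.2).smul_const
        (EuclideanSpace.single (1 : Fin 2) (1 : ℝ))).const_add (!₂[p.1, 0] : Plane)
    exact ((EuclideanSpace.proj (𝕜 := ℝ) 1).hasFDerivAt.comp_hasDerivAt p.2
      ((hTd _).hasFDerivAt.comp_hasDerivAt p.2 hv))
  have hint : ∀ i : Fin 2, Integrable
      (fun p : ℝ × ℝ => fderiv ℝ T !₂[p.1, p.2] (EuclideanSpace.single i 1) i)
      (volume.prod volume) := by
    intro i
    have hcd : HasCompactSupport (fun z => fderiv ℝ T z (EuclideanSpace.single i 1) i) :=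
      (hc.fderiv ℝ).comp_left (g := fun L : Plane →L[ℝ] Plane => L (EuclideanSpace.single i 1) i)
        (by simp)
    refine Continuous.integrable_of_hasCompactSupport ?_ (hcs hcd)
    have := (hDc.comp hpc).clm_apply (continuous_const (y := EuclideanSpace.single i (1 : ℝ)))
    exact (EuclideanSpace.proj (𝕜 := ℝ) i).continuous.comp this
  have hslice0 : ∀ y : ℝ, HasCompactSupport (fun x => T !₂[x, y] 0) := by
    intro y
    refine (hcs (hTi 0)).comp_isClosedEmbedding (g := fun x : ℝ => (x, y)) ?_
    have hl : Function.LeftInverse (fun z : ℝ × ℝ => z.1) (fun x : ℝ => (x, y)) := fun p => rfl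
    exact hl.isClosedEmbedding (by fun_prop) (by fun_prop)
  have hslice1 : ∀ x : ℝ, HasCompactSupport (fun y => T !₂[x, y] 1) := by
    intro x
    refine (hcs (hTi 1)).comp_isClosedEmbedding (g := fun y : ℝ => (x, y)) ?_
    have hl : Function.LeftInverse (fun z : ℝ × ℝ => z.2) (fun y : ℝ => (x, y)) := fun p => rfl
    exact hl.isClosedEmbedding (by fun_prop) (by fun_prop)
  have hset : ∀ p : ℝ × ℝ, ({z : Plane | s < z 1}.indicator (divergence T)) !₂[p.1, p.2]
      = (univ ×ˢ Ioi s).indicator (fun p : ℝ × ℝ => divergence T !₂[p.1, p.2]) p := by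
    intro p
    by_cases h : s < p.2
    · rw [indicator_of_mem (by simpa using h), indicator_of_mem (by simpa using h)]
    · rw [indicator_of_notMem (by simpa using h), indicator_of_notMem (by simpa using h)]
  rw [← integral_indicator hmeas, integral_plane]
  simp only [hset]
  rw [integral_indicator (MeasurableSet.univ.prod measurableSet_Ioi), Measure.volume_eq_prod]
  simp only [divergence_eq]
  rw [integral_add (hint 0).integrableOn (hint 1).integrableOn,
    setIntegral_prod _ (hint 1).integrableOn]
  have hswap : ∫ p in univ ×ˢ Ioi s, fderiv ℝ T !₂[p.1, p.2] (EuclideanSpace.single 0 1) 0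
        ∂((volume : Measure ℝ).prod (volume : Measure ℝ))
      = ∫ y in Ioi s, ∫ x in univ, fderiv ℝ T !₂[x, y] (EuclideanSpace.single 0 1) 0 := by
    rw [← setIntegral_prod_swap]
    exact setIntegral_prod _ (hint 0).swap.integrableOn
  rw [hswap]
  have e0 : ∀ y : ℝ, ∫ x in univ, fderiv ℝ T !₂[x, y] (EuclideanSpace.single 0 1) 0 = 0 := by
    intro y
    rw [setIntegral_univ]
    have hcd : ContDiff ℝ 1 (fun x => T !₂[x, y] 0) :=
      (hcomp 0).comp (contDiff_id.prodMk contDiff_const)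
    have h1 : ∀ x, deriv (fun x => T !₂[x, y] 0) x
        = fderiv ℝ T !₂[x, y] (EuclideanSpace.single 0 1) 0 := fun x => (hx (x, y)).deriv
    simp only [← h1]
    have h2 : Integrable (deriv fun x => T !₂[x, y] 0) :=
      (hcd.continuous_deriv le_rfl).integrable_of_hasCompactSupport (hslice0 y).deriv
    rw [← intervalIntegral.integral_Iic_add_Ioi (b := 0) h2.integrableOn h2.integrableOn,
      (hslice0 y).integral_Iic_deriv_eq hcd, (hslice0 y).integral_Ioi_deriv_eq hcd,
      add_neg_cancel]
  have e1 : ∀ x : ℝ, ∫ y in Ioi s, fderiv ℝ T !₂[x, y] (EuclideanSpace.single 1 1) 1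
      = -T !₂[x, s] 1 := by
    intro x
    have hcd : ContDiff ℝ 1 (fun y => T !₂[x, y] 1) :=
      (hcomp 1).comp (contDiff_const.prodMk contDiff_id)
    have h1 : ∀ y, deriv (fun y => T !₂[x, y] 1) y
        = fderiv ℝ T !₂[x, y] (EuclideanSpace.single 1 1) 1 := fun y => (hy (x, y)).deriv
    simp only [← h1]
    exact (hslice1 x).integral_Ioi_deriv_eq hcd s
  simp only [e0, e1, integral_zero, zero_add,
    setIntegral_univ]
  refine integral_congr_ae (Eventually.of_forall fun t => ?_)
  simp [inner_plane, lineCurve]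

/-! ### The divergence theorem in domains with corners -/

theorem integrable_inner_of_hasCompactSupport {μ : Measure Plane} [IsLocallyFiniteMeasure μ]
    {w : Plane → Plane} (hw : Measurable w) {b : Plane → ℝ} (hb : Continuous b)
    (hwb : ∀ z, ‖w z‖ ≤ b z) {T : Plane → Plane} (hT : Continuous T) (hc : HasCompactSupport T) :
    Integrable (fun z => inner ℝ (T z) (w z)) μ := by
  have hbound : Integrable (fun z => ‖T z‖ * b z) μ :=
    Continuous.integrable_of_hasCompactSupport (by fun_prop) (hc.norm.mul_right)
  refine hbound.mono' (hT.measurable.inner hw).aestronglyMeasurable (Eventually.of_forall fun z => ?_)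
  exact (norm_inner_le_norm _ _).trans (by gcongr; exact hwb z)

/-- Cutoff functions concentrating at a point, with gradients of the optimal order. -/
theorem exists_cutoff (p : Plane) : ∃ C : ℝ, 0 ≤ C ∧ ∀ n : ℕ, ∃ η : Plane → ℝ, ContDiff ℝ 1 η ∧
    (∀ z, |η z| ≤ 1) ∧ (∀ᶠ z in 𝓝 p, η z = 1) ∧
    (∀ z ∉ Metric.closedBall p (2 / ((n : ℝ) + 1)), η z = 0 ∧ fderiv ℝ η z = 0) ∧
    ∀ z, ‖fderiv ℝ η z‖ ≤ ((n : ℝ) + 1) * C := by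
  obtain ⟨f, hf1, hf2⟩ : ∃ f : ContDiffBump p, f.rIn = 1 ∧ f.rOut = 2 :=
    ⟨⟨1, 2, one_pos, one_lt_two⟩, rfl, rfl⟩
  have hfd : ContDiff ℝ 1 f := f.contDiff
  obtain ⟨C, hC⟩ := (f.hasCompactSupport.fderiv ℝ).exists_bound_of_continuous
    (hfd.continuous_fderiv one_ne_zero)
  refine ⟨C, (norm_nonneg _).trans (hC p), fun n => ?_⟩
  obtain ⟨k, hk, hk0⟩ : ∃ k : ℝ, k = (n : ℝ) + 1 ∧ 0 < k := ⟨_, rfl, by positivity⟩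
  rw [← hk]
  have hed : ContDiff ℝ 1 (fun z => p + k • (z - p)) := by fun_prop
  have hdist : ∀ z, dist (p + k • (z - p)) p = k * dist z p := by
    intro z
    rw [dist_eq_norm, dist_eq_norm, add_sub_cancel_left, norm_smul, Real.norm_of_nonneg hk0.le]
  have hfderiv : ∀ z, fderiv ℝ (fun z => f (p + k • (z - p))) z
      = (fderiv ℝ f (p + k • (z - p))).comp (k • ContinuousLinearMap.id ℝ Plane) := by
    intro z
    have h1 : HasFDerivAt (fun z => p + k • (z - p)) (k • ContinuousLinearMap.id ℝ Plane) z :=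
      (((hasFDerivAt_id z).sub_const p).const_smul k).const_add p
    exact ((hfd.differentiable one_ne_zero _).hasFDerivAt.comp z h1).fderiv
  refine ⟨fun z => f (p + k • (z - p)), hfd.comp hed, fun z => ?_, ?_, fun z hz => ?_, fun z => ?_⟩
  · rw [abs_of_nonneg f.nonneg]; exact f.le_one
  · filter_upwards [Metric.ball_mem_nhds p (show (0 : ℝ) < 1 / k by positivity)] with z hz
    refine f.one_of_mem_closedBall ?_
    rw [Metric.mem_closedBall, hdist, hf1]
    rw [Metric.mem_ball, lt_div_iff₀ hk0] at hz
    linarith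
  · have hoff : p + k • (z - p) ∉ tsupport f := by
      rw [f.tsupport_eq, Metric.mem_closedBall, hdist, not_le, hf2]
      rw [Metric.mem_closedBall, not_le, div_lt_iff₀ hk0] at hz
      linarith
    refine ⟨image_eq_zero_of_notMem_tsupport hoff, ?_⟩
    have : fderiv ℝ f (p + k • (z - p)) = 0 := by
      by_contra h
      exact hoff (support_fderiv_subset ℝ h)
    rw [hfderiv, this, ContinuousLinearMap.zero_comp]
  · rw [hfderiv, ContinuousLinearMap.comp_smul, ContinuousLinearMap.comp_id, norm_smul,
      Real.norm_of_nonneg hk0.le]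
    exact mul_le_mul_of_nonneg_left (hC _) hk0.le

/-- The divergence theorem need only be tested on fields that vanish near a given point `p` of
measure zero: a cutoff at scale `1 / n` has gradient of order `n`, on a disc of area of order
`1 / n ^ 2`. -/
theorem gaussGreen_of_forall_notMem_tsupport {E : Set Plane} {μ : Measure Plane}
    [IsLocallyFiniteMeasure μ] {w : Plane → Plane} (hw : Measurable w) {b : Plane → ℝ}
    (hb : Continuous b) (hwb : ∀ z, ‖w z‖ ≤ b z) {p : Plane} (hp : μ {p} = 0)
    {T : Plane → Plane} (hT : ContDiff ℝ 1 T) (hc : HasCompactSupport T)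
    (h : ∀ T' : Plane → Plane, ContDiff ℝ 1 T' → HasCompactSupport T' →
      tsupport T' ⊆ tsupport T → p ∉ tsupport T' →
      ∫ x in E, divergence T' x = ∫ x, inner ℝ (T' x) (w x) ∂μ) :
    ∫ x in E, divergence T x = ∫ x, inner ℝ (T x) (w x) ∂μ := by
  obtain ⟨C₁, hC₁', hcutoff⟩ := exists_cutoff p
  choose η hηd hη1 hηp hoff hηC using hcutoff
  obtain ⟨C₀, hC₀⟩ := hc.exists_bound_of_continuous hT.continuous
  obtain ⟨C₂, hC₂⟩ := (hasCompactSupport_divergence hc).exists_bound_of_continuous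
    (continuous_divergence hT)
  have hC₀' : 0 ≤ C₀ := (norm_nonneg _).trans (hC₀ p)
  have hC₂' : 0 ≤ C₂ := (norm_nonneg _).trans (hC₂ p)
  have hcutd : ∀ n, ContDiff ℝ 1 (fun z => (1 - η n z) • T z) := fun n =>
    (contDiff_const.sub (hηd n)).smul hT
  have hcutc : ∀ n, HasCompactSupport (fun z => (1 - η n z) • T z) := fun n =>
    hc.smul_left (f := fun z => 1 - η n z)
  -- the field cut off near `p`
  have hcut : ∀ n, ∫ x in E, divergence (fun z => (1 - η n z) • T z) x
      = ∫ x, inner ℝ ((1 - η n x) • T x) (w x) ∂μ := by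
    intro n
    refine h _ (hcutd n) (hcutc n)
      (tsupport_smul_subset_right (fun z => 1 - η n z) T) ?_
    rw [notMem_tsupport_iff_eventuallyEq]
    filter_upwards [hηp n] with z hz
    simp [hz]
  have hcη : ∀ n, HasCompactSupport (fun z => η n z • T z) := fun n =>
    hc.smul_left (f := η n)
  have hdη : ∀ n, ContDiff ℝ 1 (fun z => η n z • T z) := fun n => (hηd n).smul hT
  have hlim1 : Tendsto (fun n => ∫ x in E, divergence (fun z => η n z • T z) x) atTop (𝓝 0) := by
    have hb : ∀ n : ℕ, ‖∫ x in E, divergence (fun z => η n z • T z) x‖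
        ≤ (C₂ + C₁ * C₀) * (4 * π) * (1 / ((n : ℝ) + 1)) := by
      intro n
      have hn : (1 : ℝ) ≤ n + 1 := by linarith [n.cast_nonneg (α := ℝ)]
      set B := Metric.closedBall p (2 / ((n : ℝ) + 1))
      have hzero : ∀ x, x ∉ B → divergence (fun z => η n z • T z) x = 0 := by
        intro x hx
        obtain ⟨h3, h2⟩ := hoff n x hx
        rw [divergence_smul (hηd n) hT, h2, h3]
        simp
      have hle : ∀ x, ‖divergence (fun z => η n z • T z) x‖ ≤ ((n : ℝ) + 1) * (C₂ + C₁ * C₀) := by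
        intro x
        rw [divergence_smul (hηd n) hT]
        have h2 : |η n x * divergence T x| ≤ 1 * C₂ := by
          rw [abs_mul]; exact mul_le_mul (hη1 n x) (hC₂ x) (abs_nonneg _) zero_le_one
        have h3 : |fderiv ℝ (η n) x (T x)| ≤ ((n : ℝ) + 1) * (C₁ * C₀) := by
          rw [← mul_assoc]
          exact ContinuousLinearMap.le_of_opNorm_le_of_le _ (hηC n x) (hC₀ x)
        calc _ ≤ 1 * C₂ + ((n : ℝ) + 1) * (C₁ * C₀) := (abs_add_le _ _).trans (add_le_add h2 h3)
          _ ≤ ((n : ℝ) + 1) * C₂ + ((n : ℝ) + 1) * (C₁ * C₀) := by gcongr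
          _ = _ := by ring
      have hvol : volume.real B = 4 * π / ((n : ℝ) + 1) ^ 2 := by
        rw [Measure.real, EuclideanSpace.volume_closedBall_fin_two, ← ENNReal.ofReal_pow
          (by positivity), ← ENNReal.ofReal_mul (by positivity), ENNReal.toReal_ofReal
          (by positivity), div_pow]
        ring
      calc ‖∫ x in E, divergence (fun z => η n z • T z) x‖
          ≤ ∫ x in E, ‖divergence (fun z => η n z • T z) x‖ := norm_integral_le_integral_norm _
        _ ≤ ∫ x, ‖divergence (fun z => η n z • T z) x‖ :=
            setIntegral_le_integral (integrable_divergence (hdη n) (hcη n)).norm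
              (Eventually.of_forall fun _ => norm_nonneg _)
        _ = ∫ x in B, ‖divergence (fun z => η n z • T z) x‖ :=
            (setIntegral_eq_integral_of_forall_compl_eq_zero
              fun x hx => by rw [hzero x hx, norm_zero]).symm
        _ ≤ ‖∫ x in B, ‖divergence (fun z => η n z • T z) x‖‖ := le_norm_self _
        _ ≤ ((n : ℝ) + 1) * (C₂ + C₁ * C₀) * volume.real B := by
            refine norm_setIntegral_le_of_norm_le_const Metric.isBounded_closedBall.measure_lt_top
              fun x _ => ?_
            rw [norm_norm]; exact hle x
        _ = _ := by rw [hvol]; field_simp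
    refine squeeze_zero_norm hb ?_
    simpa using tendsto_one_div_add_atTop_nhds_zero_nat.const_mul ((C₂ + C₁ * C₀) * (4 * π))
  have hint := integrable_inner_of_hasCompactSupport (μ := μ) hw hb hwb hT.continuous hc
  have hlim2 : Tendsto (fun n => ∫ x, inner ℝ (η n x • T x) (w x) ∂μ) atTop (𝓝 0) := by
    rw [show (0 : ℝ) = ∫ x, (0 : ℝ) ∂μ by simp]
    refine tendsto_integral_of_dominated_convergence (fun x => ‖inner ℝ (T x) (w x)‖) (fun n => ?_)
      hint.norm (fun n => Eventually.of_forall fun x => ?_) ?_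
    · exact (((hηd n).continuous.smul hT.continuous).measurable.inner hw).aestronglyMeasurable
    · rw [inner_smul_left, norm_mul]
      simpa using mul_le_mul_of_nonneg_right (hη1 n x) (norm_nonneg (inner ℝ (T x) (w x)))
    · have hne : ∀ᵐ x ∂μ, x ≠ p := by
        rw [ae_iff]; simpa using hp
      filter_upwards [hne] with x hx
      refine tendsto_const_nhds.congr' ?_
      have hpos : 0 < dist x p := dist_pos.2 hx
      obtain ⟨N, hN⟩ := exists_nat_gt (2 / dist x p)
      filter_upwards [eventually_ge_atTop N] with n hn
      have h1 : η n x = 0 := by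
        refine (hoff n x ?_).1
        rw [Metric.mem_closedBall, not_le, div_lt_iff₀ (by positivity)]
        rw [div_lt_iff₀ hpos] at hN
        have : (N : ℝ) ≤ n := by exact_mod_cast hn
        nlinarith
      simp [h1]
  have hsplit : ∀ n, (∫ x in E, divergence T x) - ∫ x, inner ℝ (T x) (w x) ∂μ
      = (∫ x in E, divergence (fun z => η n z • T z) x)
        - ∫ x, inner ℝ (η n x • T x) (w x) ∂μ := by
    intro n
    have h1 : T = (fun z => (1 - η n z) • T z) + fun z => η n z • T z := by
      funext z
      simp only [Pi.add_apply, ← add_smul, sub_add_cancel, one_smul]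
    have h2 : ∫ x in E, divergence T x = (∫ x in E, divergence (fun z => (1 - η n z) • T z) x)
        + ∫ x in E, divergence (fun z => η n z • T z) x := by
      rw [← integral_add (integrable_divergence (hcutd n) (hcutc n)).integrableOn
        (integrable_divergence (hdη n) (hcη n)).integrableOn]
      conv_lhs => rw [h1]
      simp only [divergence_add (hcutd n) (hdη n)]
    have h3 : ∫ x, inner ℝ (T x) (w x) ∂μ = (∫ x, inner ℝ ((1 - η n x) • T x) (w x) ∂μ)
        + ∫ x, inner ℝ (η n x • T x) (w x) ∂μ := by
      rw [← integral_add
        (integrable_inner_of_hasCompactSupport hw hb hwb (hcutd n).continuous (hcutc n))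
        (integrable_inner_of_hasCompactSupport hw hb hwb (hdη n).continuous (hcη n))]
      simp only [← inner_add_left, ← add_smul, sub_add_cancel, one_smul]
    rw [h2, h3, hcut n]
    ring
  have hlim := hlim1.sub hlim2
  simp only [← hsplit, sub_zero] at hlim
  exact sub_eq_zero.1 (tendsto_nhds_unique tendsto_const_nhds hlim)

/-- A finite set of measure zero is negligible for the divergence theorem. -/
theorem gaussGreen_of_forall_disjoint_tsupport {E : Set Plane} {μ : Measure Plane}
    [IsLocallyFiniteMeasure μ] {w : Plane → Plane} (hw : Measurable w) {b : Plane → ℝ}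
    (hb : Continuous b) (hwb : ∀ z, ‖w z‖ ≤ b z) (S : Finset Plane) (hS : ∀ p ∈ S, μ {p} = 0)
    (h : ∀ T : Plane → Plane, ContDiff ℝ 1 T → HasCompactSupport T →
      (∀ p ∈ S, p ∉ tsupport T) → ∫ x in E, divergence T x = ∫ x, inner ℝ (T x) (w x) ∂μ)
    (T : Plane → Plane) (hT : ContDiff ℝ 1 T) (hc : HasCompactSupport T) :
    ∫ x in E, divergence T x = ∫ x, inner ℝ (T x) (w x) ∂μ := by
  classical
  induction S using Finset.induction_on generalizing T with
  | empty => exact h T hT hc (by simp)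
  | insert p S _ ih =>
    refine ih (fun q hq => hS q (Finset.mem_insert_of_mem hq)) ?_ T hT hc
    intro T hT hc hTS
    refine gaussGreen_of_forall_notMem_tsupport hw hb hwb (hS p (Finset.mem_insert_self p S)) hT hc ?_
    intro T' hT' hc' hsub hp
    refine h T' hT' hc' fun q hq => ?_
    rcases Finset.mem_insert.1 hq with rfl | hq
    · exact hp
    · exact fun h' => hTS q hq (hsub h')

/-- The divergence theorem for the intersection `{0 < f₁} ∩ {0 < f₂}` of two sets for which it
holds and whose boundaries meet in finitely many points. -/
theorem gaussGreenOn_inter {f₁ f₂ : Plane → ℝ} (hf₁ : Continuous f₁) (hf₂ : Continuous f₂)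
    {w₁ w₂ : Plane → Plane} (hw₁ : Continuous w₁) (hw₂ : Continuous w₂)
    (hΓ : IsLocallyFiniteMeasure ((Measure.hausdorffMeasure 1 : Measure Plane).restrict
      ({z | f₁ z = 0 ∧ 0 ≤ f₂ z} ∪ {z | f₂ z = 0 ∧ 0 ≤ f₁ z})))
    (h₁ : GaussGreenOn {z | 0 < f₁ z} {z | f₁ z = 0} w₁)
    (h₂ : GaussGreenOn {z | 0 < f₂ z} {z | f₂ z = 0} w₂)
    (S : Finset Plane) (hS : ∀ z, f₁ z = 0 → f₂ z = 0 → z ∈ S) [DecidablePred fun z => f₁ z = 0] :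
    GaussGreenOn {z | 0 < f₁ z ∧ 0 < f₂ z}
      ({z | f₁ z = 0 ∧ 0 ≤ f₂ z} ∪ {z | f₂ z = 0 ∧ 0 ≤ f₁ z})
      (fun z => if f₁ z = 0 then w₁ z else w₂ z) := by
  intro T hT hc
  set Γ : Set Plane := {z | f₁ z = 0 ∧ 0 ≤ f₂ z} ∪ {z | f₂ z = 0 ∧ 0 ≤ f₁ z} with hΓdef
  set w : Plane → Plane := fun z => if f₁ z = 0 then w₁ z else w₂ z with hw
  set E : Set Plane := {z | 0 < f₁ z ∧ 0 < f₂ z} with hE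
  have hz₁ : MeasurableSet {z | f₁ z = 0} := (isClosed_eq hf₁ continuous_const).measurableSet
  have hz₂ : MeasurableSet {z | f₂ z = 0} := (isClosed_eq hf₂ continuous_const).measurableSet
  have hp₁ : MeasurableSet {z | 0 < f₁ z} := (isOpen_lt continuous_const hf₁).measurableSet
  have hp₂ : MeasurableSet {z | 0 < f₂ z} := (isOpen_lt continuous_const hf₂).measurableSet
  have hEm : MeasurableSet E := hp₁.inter hp₂
  have hΓm : MeasurableSet Γ :=
    (hz₁.inter (isClosed_le continuous_const hf₂).measurableSet).union
      (hz₂.inter (isClosed_le continuous_const hf₁).measurableSet)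
  have hwm : Measurable w := Measurable.ite hz₁ hw₁.measurable hw₂.measurable
  have hb : Continuous fun z => ‖w₁ z‖ + ‖w₂ z‖ := by fun_prop
  have hwb : ∀ z, ‖w z‖ ≤ ‖w₁ z‖ + ‖w₂ z‖ := by
    intro z
    simp only [hw]
    split_ifs
    · linarith [norm_nonneg (w₂ z)]
    · linarith [norm_nonneg (w₁ z)]
  -- the three types of fields, according to the support
  have hT1 : ∀ T : Plane → Plane, ContDiff ℝ 1 T → HasCompactSupport T →
      tsupport T ⊆ {z | 0 < f₂ z} →
      ∫ x in E, divergence T x = ∫ x in Γ, inner ℝ (T x) (w x) ∂(Measure.hausdorffMeasure 1) := by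
    intro T hT hc hsub
    rw [← integral_indicator hEm, ← integral_indicator hΓm]
    have := h₁ T hT hc
    rw [← integral_indicator hp₁, ← integral_indicator hz₁] at this
    convert this using 2
    · funext z
      by_cases hz : z ∈ tsupport T
      · have h2 : 0 < f₂ z := hsub hz
        simp [indicator, hE, h2]
      · simp [indicator, divergence_eq_zero_of_notMem_tsupport hz]
    · funext z
      by_cases hz : z ∈ tsupport T
      · have h2 : 0 < f₂ z := hsub hz
        by_cases h1 : f₁ z = 0
        · simp [indicator, hΓdef, hw, h1, h2.le]
        · simp [indicator, hΓdef, h1, h2.ne']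
      · simp [indicator, image_eq_zero_of_notMem_tsupport hz]
  have hT2 : ∀ T : Plane → Plane, ContDiff ℝ 1 T → HasCompactSupport T →
      tsupport T ⊆ {z | 0 < f₁ z} →
      ∫ x in E, divergence T x = ∫ x in Γ, inner ℝ (T x) (w x) ∂(Measure.hausdorffMeasure 1) := by
    intro T hT hc hsub
    rw [← integral_indicator hEm, ← integral_indicator hΓm]
    have := h₂ T hT hc
    rw [← integral_indicator hp₂, ← integral_indicator hz₂] at this
    convert this using 2
    · funext z
      by_cases hz : z ∈ tsupport T
      · have h1 : 0 < f₁ z := hsub hz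
        simp [indicator, hE, h1]
      · simp [indicator, divergence_eq_zero_of_notMem_tsupport hz]
    · funext z
      by_cases hz : z ∈ tsupport T
      · have h1 : 0 < f₁ z := hsub hz
        by_cases h2 : f₂ z = 0
        · simp [indicator, hΓdef, hw, h2, h1.le, h1.ne']
        · simp [indicator, hΓdef, h2, h1.ne']
      · simp [indicator, image_eq_zero_of_notMem_tsupport hz]
  have hT3 : ∀ T : Plane → Plane, ContDiff ℝ 1 T → HasCompactSupport T →
      tsupport T ⊆ {z | f₁ z < 0} ∪ {z | f₂ z < 0} →
      ∫ x in E, divergence T x = ∫ x in Γ, inner ℝ (T x) (w x) ∂(Measure.hausdorffMeasure 1) := by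
    intro T hT hc hsub
    rw [setIntegral_eq_zero_of_forall_eq_zero, setIntegral_eq_zero_of_forall_eq_zero]
    · intro z hz
      by_cases hzT : z ∈ tsupport T
      · exfalso
        rcases hsub hzT with h | h <;> rcases hz with ⟨h1, h2⟩ | ⟨h1, h2⟩ <;>
          simp only [mem_ofPred_eq] at h <;> linarith
      · rw [image_eq_zero_of_notMem_tsupport hzT, inner_zero_left]
    · intro z hz
      by_cases hzT : z ∈ tsupport T
      · exfalso
        rcases hsub hzT with h | h <;> simp only [mem_ofPred_eq] at h <;> linarith [hz.1, hz.2]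
      · exact divergence_eq_zero_of_notMem_tsupport hzT
  refine gaussGreen_of_forall_disjoint_tsupport (μ := (Measure.hausdorffMeasure 1).restrict Γ)
    hwm hb hwb S ?_ ?_ T hT hc
  · intro p _
    have := Measure.nullSingletonClass_hausdorff Plane (d := 1) one_pos
    exact le_antisymm ((Measure.restrict_apply_le _ _).trans (measure_singleton p).le) zero_le
  intro T hT hc hTS
  set O : Fin 3 → Set Plane :=
    ![{z | 0 < f₂ z}, {z | 0 < f₁ z}, {z | f₁ z < 0} ∪ {z | f₂ z < 0}] with hO
  have hOo : ∀ i, IsOpen (O i) := by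
    intro i; fin_cases i
    · exact isOpen_lt continuous_const hf₂
    · exact isOpen_lt continuous_const hf₁
    · exact (isOpen_lt hf₁ continuous_const).union (isOpen_lt hf₂ continuous_const)
  have hcov : tsupport T ⊆ ⋃ i, O i := by
    intro z hz
    rw [mem_iUnion]
    rcases lt_trichotomy (f₂ z) 0 with h2 | h2 | h2
    · exact ⟨2, Or.inr h2⟩
    · rcases lt_trichotomy (f₁ z) 0 with h1 | h1 | h1
      · exact ⟨2, Or.inl h1⟩
      · exact absurd hz (hTS z (hS z h1 h2))
      · exact ⟨1, h1⟩
    · exact ⟨0, h2⟩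
  obtain ⟨ρ, hρ⟩ := SmoothPartitionOfUnity.exists_isSubordinate (modelWithCornersSelf ℝ Plane)
    (isClosed_tsupport T) O hOo hcov
  have hρd : ∀ i, ContDiff ℝ 1 (ρ i) := fun i =>
    ((ρ i).contMDiff.contDiff).of_le (by exact_mod_cast le_top)
  set T' : Fin 3 → Plane → Plane := fun i z => ρ i z • T z with hT'
  have hT'd : ∀ i, ContDiff ℝ 1 (T' i) := fun i => (hρd i).smul hT
  have hT'c : ∀ i, HasCompactSupport (T' i) := fun i => hc.smul_left (f := ρ i)
  have hT's : ∀ i, tsupport (T' i) ⊆ O i := fun i =>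
    (tsupport_smul_subset_left (ρ i) T).trans (hρ i)
  have hTsum : T = (T' 0 + T' 1) + T' 2 := by
    funext z
    simp only [hT', Pi.add_apply, ← add_smul]
    by_cases hz : z ∈ tsupport T
    · have h1 := ρ.sum_eq_one hz
      rw [finsum_eq_sum_of_fintype, Fin.sum_univ_three] at h1
      rw [h1, one_smul]
    · rw [image_eq_zero_of_notMem_tsupport hz, smul_zero]
  have hadd : ∀ T₁ T₂ : Plane → Plane, ContDiff ℝ 1 T₁ → ContDiff ℝ 1 T₂ → HasCompactSupport T₁ →
      HasCompactSupport T₂ →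
      ∫ x in E, divergence T₁ x = ∫ x in Γ, inner ℝ (T₁ x) (w x) ∂(Measure.hausdorffMeasure 1) →
      ∫ x in E, divergence T₂ x = ∫ x in Γ, inner ℝ (T₂ x) (w x) ∂(Measure.hausdorffMeasure 1) →
      ∫ x in E, divergence (T₁ + T₂) x
        = ∫ x in Γ, inner ℝ ((T₁ + T₂) x) (w x) ∂(Measure.hausdorffMeasure 1) := by
    intro T₁ T₂ d₁ d₂ c₁ c₂ e₁ e₂
    simp only [divergence_add d₁ d₂, Pi.add_apply, inner_add_left]
    rw [integral_add (integrable_divergence d₁ c₁).integrableOn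
      (integrable_divergence d₂ c₂).integrableOn, e₁, e₂, ← integral_add
      (integrable_inner_of_hasCompactSupport hwm hb hwb d₁.continuous c₁)
      (integrable_inner_of_hasCompactSupport hwm hb hwb d₂.continuous c₂)]
  rw [hTsum]
  refine hadd _ _ ((hT'd 0).add (hT'd 1)) (hT'd 2) ((hT'c 0).add (hT'c 1)) (hT'c 2)
    (hadd _ _ (hT'd 0) (hT'd 1) (hT'c 0) (hT'c 1) ?_ ?_) ?_
  · exact hT1 _ (hT'd 0) (hT'c 0) (hT's 0)
  · exact hT2 _ (hT'd 1) (hT'c 1) (hT's 1)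
  · exact hT3 _ (hT'd 2) (hT'c 2) (hT's 2)

/-! ### The reduced boundary -/

theorem IsGaussGreen.congr {E E' : Set Plane} (hE : E =ᵐ[volume] E') {μ : Measure Plane}
    {ν : Plane → Plane} (h : IsGaussGreen E μ ν) : IsGaussGreen E' μ ν :=
  ⟨h.locallyFinite, h.measurable, h.norm_eq_one, fun T hT hc => by
    rw [← h.gauss_green T hT hc, setIntegral_congr_set hE.symm]⟩

theorem reducedBoundary_congr {E E' : Set Plane} (hE : E =ᵐ[volume] E') :
    reducedBoundary E = reducedBoundary E' := by
  ext x
  exact ⟨fun ⟨μ, ν, h, h'⟩ => ⟨μ, ν, h.congr hE, h'⟩,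
    fun ⟨μ, ν, h, h'⟩ => ⟨μ, ν, h.congr hE.symm, h'⟩⟩

theorem HasLocallyFinitePerimeter.congr {E E' : Set Plane} (hE : E =ᵐ[volume] E')
    (h : HasLocallyFinitePerimeter E) : HasLocallyFinitePerimeter E' := by
  obtain ⟨hm, μ, ν, hG⟩ := h
  exact ⟨hm.congr hE, μ, ν, hG.congr hE⟩

/-- A Gauss-Green measure of `E` does not charge the exterior of `E`. -/
theorem reducedBoundary_subset_closure (E : Set Plane) : reducedBoundary E ⊆ closure E := by
  rintro x ⟨μ, ν, hG, hpos, -⟩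
  by_contra hx
  have := hG.locallyFinite
  have hU : IsOpen (closure E)ᶜ := isClosed_closure.isOpen_compl
  have hνint : ∀ i, LocallyIntegrable (fun z => ν z i) μ := by
    intro i
    refine (locallyIntegrable_const (1 : ℝ)).mono
      (((EuclideanSpace.proj (𝕜 := ℝ) i).continuous.measurable.comp
        hG.measurable).aestronglyMeasurable) ?_
    filter_upwards [hG.norm_eq_one] with z hz
    rw [norm_one, ← hz]
    exact PiLp.norm_apply_le (ν z) i
  have hzero : ∀ i : Fin 2, ∀ᵐ z ∂μ, z ∈ (closure E)ᶜ → ν z i = 0 := by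
    intro i
    refine hU.ae_eq_zero_of_integral_contDiff_smul_eq_zero ((hνint i).locallyIntegrableOn _) ?_
    intro g hg hgc hgs
    have h1 := hG.gauss_green (fun z => g z • EuclideanSpace.single i (1 : ℝ))
      ((hg.of_le (by exact_mod_cast le_top)).smul contDiff_const) (hgc.smul_right)
    have hsub : tsupport (fun z => g z • EuclideanSpace.single i (1 : ℝ)) ⊆ (closure E)ᶜ :=
      (tsupport_smul_subset_left g _).trans hgs
    rw [setIntegral_eq_zero_of_forall_eq_zero (fun z hz =>
      divergence_eq_zero_of_notMem_tsupport fun h => hsub h (subset_closure hz))] at h1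
    rw [h1]
    refine integral_congr_ae (Eventually.of_forall fun z => ?_)
    simp [inner_smul_left, EuclideanSpace.inner_single_left]
  obtain ⟨r, hr, hball⟩ := Metric.isOpen_iff.1 hU x hx
  refine (hpos r hr).ne' ?_
  rw [← compl_compl (Metric.ball x r), ← mem_ae_iff]
  filter_upwards [hzero 0, hzero 1, hG.norm_eq_one] with z h0 h1 h2 hz
  have : ν z = 0 := plane_ext (h0 (hball hz)) (h1 (hball hz))
  rw [this, norm_zero] at h2
  exact zero_ne_one h2

/-- A point of the support of the Gauss-Green measure near which the normal agrees with a
continuous field belongs to the reduced boundary. -/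
theorem mem_reducedBoundary_of_eqOn {E : Set Plane} {μ : Measure Plane} {ν w : Plane → Plane}
    (hG : IsGaussGreen E μ ν) {x : Plane} (hpos : ∀ r > 0, 0 < μ (Metric.ball x r))
    {V : Set Plane} (hV : V ∈ 𝓝 x) (hw : ContinuousAt w x) (hwx : ‖w x‖ = 1)
    (hνw : ∀ᵐ z ∂μ, z ∈ V → ν z = w z) : x ∈ reducedBoundary E := by
  have := hG.locallyFinite
  refine ⟨μ, ν, hG, hpos, w x, hwx, ?_⟩
  rw [Metric.tendsto_nhds]
  intro ε hε
  have h1 : {z | z ∈ V ∧ dist (w z) (w x) ≤ ε / 2} ∈ 𝓝 x :=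
    inter_mem hV (hw (Metric.closedBall_mem_nhds _ (by positivity)))
  obtain ⟨δ, hδ, hball⟩ := Metric.mem_nhds_iff.1 h1
  filter_upwards [Ioo_mem_nhdsGT hδ] with r hr
  have hfin : μ (Metric.ball x r) ≠ ∞ := measure_ball_lt_top.ne
  have hsub : Metric.ball x r ⊆ Metric.ball x δ := Metric.ball_subset_ball hr.2.le
  have hint : IntegrableOn ν (Metric.ball x r) μ := by
    refine Measure.integrableOn_of_bounded hfin hG.measurable.aestronglyMeasurable (M := 1) ?_
    exact ae_restrict_of_ae (hG.norm_eq_one.mono fun z hz => hz.le)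
  have := (convex_closedBall (w x) (ε / 2)).set_average_mem Metric.isClosed_closedBall
    (hpos r hr.1).ne' hfin ?_ hint
  · exact lt_of_le_of_lt (Metric.mem_closedBall.1 this) (by linarith)
  · rw [ae_restrict_iff' Metric.isOpen_ball.measurableSet]
    filter_upwards [hνw] with z hz hzr
    obtain ⟨hzV, hzd⟩ := hball (hsub hzr)
    rw [hz hzV]
    exact hzd

/-! ### The pencil of circles through two points -/

/-- The generalized circles through `(-h, s)` and `(h, s)` are the zero sets of these functions:
`arcFn s h φ` vanishes on the one that supports the arc of direction `φ`, and is negative just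
below that arc. -/
noncomputable def arcFn (s h φ : ℝ) (z : Plane) : ℝ :=
  sin φ * (z 0 ^ 2 + (z 1 - s) ^ 2 - h ^ 2) + cos φ * (2 * h * (z 1 - s))

theorem continuous_arcFn (s h φ : ℝ) : Continuous (arcFn s h φ) := by
  unfold arcFn
  fun_prop

theorem arcFn_add_pi (s h φ : ℝ) (z : Plane) : arcFn s h (φ + π) z = -arcFn s h φ z := by
  simp only [arcFn, sin_add_pi, cos_add_pi]; ring

theorem arcFn_add_two_pi (s h φ : ℝ) (z : Plane) : arcFn s h (φ + 2 * π) z = arcFn s h φ z := by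
  simp only [arcFn, sin_add_two_pi, cos_add_two_pi]

theorem cos_two_pi_div_three : cos (2 * π / 3) = -(1 / 2) := by
  rw [show 2 * π / 3 = π - π / 3 by ring, cos_pi_sub, cos_pi_div_three]

theorem sin_two_pi_div_three : sin (2 * π / 3) = √3 / 2 := by
  rw [show 2 * π / 3 = π - π / 3 by ring, sin_pi_sub, sin_pi_div_three]

/-- Three arcs meeting at 120 degrees: the three functions sum to zero. -/
theorem arcFn_sum (s h φ : ℝ) (z : Plane) :
    arcFn s h (φ - 2 * π / 3) z + arcFn s h φ z + arcFn s h (φ + 2 * π / 3) z = 0 := by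
  simp only [arcFn, sin_add, cos_add, sin_sub, cos_sub, cos_two_pi_div_three]
  ring

theorem arcFn_sum' (s h φ : ℝ) (z : Plane) :
    arcFn s h φ z + arcFn s h (φ + 2 * π / 3) z + arcFn s h (φ + 2 * π / 3 + 2 * π / 3) z = 0 := by
  have := arcFn_sum s h (φ + 2 * π / 3) z
  rwa [add_sub_cancel_right] at this

theorem arcFn_eq_of_sin_ne_zero (s h : ℝ) {φ : ℝ} (hφ : sin φ ≠ 0) (z : Plane) :
    arcFn s h φ z = sin φ * (dist z (arcCenter s h φ) ^ 2 - arcRadius h φ ^ 2) := by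
  rw [dist_plane_sq]
  simp only [arcFn, arcCenter, arcRadius, div_pow, sq_abs]
  simp
  field_simp
  linear_combination (-h ^ 2) * sin_sq_add_cos_sq φ

theorem arcFn_eq_of_sin_eq_zero (s h : ℝ) {φ : ℝ} (hφ : sin φ = 0) (z : Plane) :
    arcFn s h φ z = cos φ * (2 * h * (z 1 - s)) := by
  simp [arcFn, hφ]

theorem arcRadius_pos {h φ : ℝ} (hh : 0 < h) (hφ : sin φ ≠ 0) : 0 < arcRadius h φ :=
  div_pos hh (abs_pos.2 hφ)

theorem arcFn_pos_iff_of_sin_pos {s h φ : ℝ} (hh : 0 < h) (hφ : 0 < sin φ) {z : Plane} :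
    0 < arcFn s h φ z ↔ arcRadius h φ < dist z (arcCenter s h φ) := by
  rw [arcFn_eq_of_sin_ne_zero s h hφ.ne', mul_pos_iff_of_pos_left hφ, sub_pos,
    sq_lt_sq₀ (arcRadius_pos hh hφ.ne').le dist_nonneg]

theorem arcFn_neg_iff_of_sin_pos {s h φ : ℝ} (hh : 0 < h) (hφ : 0 < sin φ) {z : Plane} :
    arcFn s h φ z < 0 ↔ dist z (arcCenter s h φ) < arcRadius h φ := by
  rw [arcFn_eq_of_sin_ne_zero s h hφ.ne', mul_neg_iff,
    ← sq_lt_sq₀ dist_nonneg (arcRadius_pos hh hφ.ne').le]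
  simp [hφ, hφ.not_gt]

theorem arcFn_pos_iff_of_sin_neg {s h φ : ℝ} (hh : 0 < h) (hφ : sin φ < 0) {z : Plane} :
    0 < arcFn s h φ z ↔ dist z (arcCenter s h φ) < arcRadius h φ := by
  rw [arcFn_eq_of_sin_ne_zero s h hφ.ne, mul_pos_iff,
    ← sq_lt_sq₀ dist_nonneg (arcRadius_pos hh hφ.ne).le]
  simp [hφ, hφ.not_gt]

theorem arcFn_neg_iff_of_sin_neg {s h φ : ℝ} (hh : 0 < h) (hφ : sin φ < 0) {z : Plane} :
    arcFn s h φ z < 0 ↔ arcRadius h φ < dist z (arcCenter s h φ) := by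
  rw [arcFn_eq_of_sin_ne_zero s h hφ.ne, mul_neg_iff,
    ← sq_lt_sq₀ (arcRadius_pos hh hφ.ne).le dist_nonneg]
  simp [hφ, hφ.not_gt]

theorem setOf_arcFn_eq_zero_of_sin_ne_zero {s h φ : ℝ} (hh : 0 < h) (hφ : sin φ ≠ 0) :
    {z | arcFn s h φ z = 0} = Metric.sphere (arcCenter s h φ) (arcRadius h φ) := by
  ext z
  rw [mem_ofPred_eq, arcFn_eq_of_sin_ne_zero s h hφ, Metric.mem_sphere,
    mul_eq_zero_iff_left hφ, sub_eq_zero, sq_eq_sq₀ dist_nonneg (arcRadius_pos hh hφ).le]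

theorem setOf_arcFn_eq_zero_of_sin_eq_zero {s h φ : ℝ} (hh : 0 < h) (hφ : sin φ = 0) :
    {z | arcFn s h φ z = 0} = {z | z 1 = s} := by
  have hc : cos φ ≠ 0 := by
    intro hc
    have := sin_sq_add_cos_sq φ
    rw [hφ, hc] at this
    norm_num at this
  ext z
  simp only [mem_ofPred_eq, arcFn_eq_of_sin_eq_zero s h hφ, mul_eq_zero, hc, hh.ne', sub_eq_zero]
  simp

/-- The outer unit normal of `{0 < arcFn s h φ}` on its boundary. -/
noncomputable def arcNormal (s h φ : ℝ) (z : Plane) : Plane :=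
  !₂[-(sin φ * z 0) / h, -(sin φ * (z 1 - s) + h * cos φ) / h]

theorem continuous_arcNormal (s h φ : ℝ) : Continuous (arcNormal s h φ) := by
  unfold arcNormal
  fun_prop

/-- The gradient of `arcFn s h φ` has constant length `2 * h` on the zero set. -/
theorem norm_arcNormal {s h φ : ℝ} (hh : 0 < h) {z : Plane} (hz : arcFn s h φ z = 0) :
    ‖arcNormal s h φ z‖ = 1 := by
  rw [← sq_eq_sq₀ (norm_nonneg _) zero_le_one, ← dist_zero_right, dist_plane_sq]
  simp only [arcNormal, arcFn] at *
  simp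
  field_simp
  linear_combination sin φ * hz + h ^ 2 * sin_sq_add_cos_sq φ

theorem GaussGreenOn.congr {E E' Γ : Set Plane} {w w' : Plane → Plane} (h : GaussGreenOn E Γ w)
    (hE : E =ᵐ[volume] E') (hΓ : MeasurableSet Γ) (hw : ∀ z ∈ Γ, w z = w' z) :
    GaussGreenOn E' Γ w' := by
  intro T hT hc
  rw [← setIntegral_congr_set hE, h T hT hc]
  exact setIntegral_congr_fun hΓ fun z hz => by simp only [hw z hz]

theorem volume_line (s : ℝ) : volume {z : Plane | z 1 = s} = 0 := by
  have h1 := (EuclideanSpace.volume_preserving_symm_measurableEquiv_toLp (Fin 2))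
  have h2 : {z : Plane | z 1 = s}
      = (MeasurableEquiv.toLp 2 (Fin 2 → ℝ)).symm ⁻¹' {v | v 1 = s} := rfl
  rw [h2, h1.measure_preimage_equiv]
  exact Measure.pi_hyperplane (fun _ : Fin 2 => (volume : Measure ℝ)) 1 s

theorem volume_setOf_arcFn_eq_zero {h : ℝ} (hh : 0 < h) (s φ : ℝ) :
    volume {z | arcFn s h φ z = 0} = 0 := by
  by_cases hφ : sin φ = 0
  · rw [setOf_arcFn_eq_zero_of_sin_eq_zero hh hφ]; exact volume_line s
  · rw [setOf_arcFn_eq_zero_of_sin_ne_zero hh hφ]; exact Measure.addHaar_sphere _ _ _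

theorem ae_arcFn_ne_zero {h : ℝ} (hh : 0 < h) (s φ : ℝ) :
    ∀ᵐ z : Plane, arcFn s h φ z ≠ 0 := by
  rw [ae_iff]
  simpa using volume_setOf_arcFn_eq_zero hh s φ

theorem isLocallyFiniteMeasure_hausdorffMeasure_restrict_arcFn {h : ℝ} (hh : 0 < h) (s φ : ℝ) :
    IsLocallyFiniteMeasure
      ((Measure.hausdorffMeasure 1 : Measure Plane).restrict {z | arcFn s h φ z = 0}) := by
  by_cases hφ : sin φ = 0
  · rw [setOf_arcFn_eq_zero_of_sin_eq_zero hh hφ]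
    refine ⟨fun x => ⟨Metric.ball x 1, Metric.ball_mem_nhds x one_pos, ?_⟩⟩
    rw [Measure.restrict_apply Metric.isOpen_ball.measurableSet, hausdorffMeasure_inter_line]
    refine lt_of_le_of_lt (measure_mono fun t ht => ?_)
      (measure_ball_lt_top (x := x 0) (r := 1) (μ := (volume : Measure ℝ)))
    rw [mem_preimage, Metric.mem_ball] at ht
    rw [Metric.mem_ball]
    refine lt_of_le_of_lt ?_ ht
    rw [← sq_le_sq₀ dist_nonneg dist_nonneg, dist_plane_sq, Real.dist_eq, sq_abs, lineCurve_zero]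
    nlinarith [sq_nonneg (lineCurve s t 1 - x 1)]
  · rw [setOf_arcFn_eq_zero_of_sin_ne_zero hh hφ,
      hausdorffMeasure_restrict_sphere _ (arcRadius_pos hh hφ) 0]
    have : IsFiniteMeasure ((volume.restrict (Ioc (-(π * arcRadius h φ)) (π * arcRadius h φ))).map
        (circleCurve (arcCenter s h φ) (arcRadius h φ) 0)) := inferInstance
    infer_instance

/-- A generalized circle has positive length near each of its points. -/
theorem hausdorffMeasure_inter_setOf_arcFn_pos {h : ℝ} (hh : 0 < h) {s φ : ℝ} {x : Plane}
    (hx : arcFn s h φ x = 0) {V : Set Plane} (hV : IsOpen V) (hxV : x ∈ V) :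
    0 < Measure.hausdorffMeasure 1 (V ∩ {z | arcFn s h φ z = 0}) := by
  have hx' : x ∈ {z | arcFn s h φ z = 0} := hx
  by_cases hφ : sin φ = 0
  · rw [setOf_arcFn_eq_zero_of_sin_eq_zero hh hφ] at hx' ⊢
    rw [hausdorffMeasure_inter_line]
    refine (hV.preimage (continuous_lineCurve s)).measure_pos _ ⟨x 0, ?_⟩
    have : lineCurve s (x 0) = x := plane_ext (by simp) (by simpa using hx'.symm)
    rwa [mem_preimage, this]
  · rw [setOf_arcFn_eq_zero_of_sin_ne_zero hh hφ] at hx' ⊢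
    set r := arcRadius h φ with hr
    have hr0 : 0 < r := arcRadius_pos hh hφ
    rw [← circleCurve_image _ hr0 0] at hx'
    obtain ⟨t, -, rfl⟩ := hx'
    -- move the base point of the parametrization to the given point
    have e : circleCurve (arcCenter s h φ) r (t / r) 0 = circleCurve (arcCenter s h φ) r 0 t := by
      simp [circleCurve]
    rw [hausdorffMeasure_inter_sphere _ hr0 (t / r) hV.measurableSet]
    have hpr : 0 < π * r := mul_pos pi_pos hr0
    refine lt_of_lt_of_le ((isOpen_Ioo.inter (hV.preimage
      (continuous_circleCurve (arcCenter s h φ) r (t / r)))).measure_pos volume ⟨0, ?_, ?_⟩)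
      (measure_mono (inter_subset_inter_left _ Ioo_subset_Ioc_self))
    · exact ⟨by linarith, hpr⟩
    · rwa [mem_preimage, e]

theorem measurableSet_setOf_arcFn_eq_zero (s h φ : ℝ) : MeasurableSet {z | arcFn s h φ z = 0} :=
  (isClosed_eq (continuous_arcFn s h φ) continuous_const).measurableSet

/-- The divergence theorem on the two sides of a generalized circle of the pencil. -/
theorem gaussGreenOn_arcFn {h : ℝ} (hh : 0 < h) (s φ : ℝ) :
    GaussGreenOn {z | 0 < arcFn s h φ z} {z | arcFn s h φ z = 0} (arcNormal s h φ) := by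
  have hm := measurableSet_setOf_arcFn_eq_zero s h φ
  rcases lt_trichotomy (sin φ) 0 with hφ | hφ | hφ
  · have e : {z | 0 < arcFn s h φ z} = Metric.ball (arcCenter s h φ) (arcRadius h φ) := by
      ext z; exact arcFn_pos_iff_of_sin_neg hh hφ
    rw [setOf_arcFn_eq_zero_of_sin_ne_zero hh hφ.ne] at hm ⊢
    rw [e]
    refine (gaussGreenOn_ball _ (arcRadius_pos hh hφ.ne)).congr (ae_eq_refl _) hm fun z _ => ?_
    have := hφ.ne
    apply plane_ext <;> simp [arcNormal, arcCenter, arcRadius, abs_of_neg hφ] <;> field_simp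
    ring
  · rw [setOf_arcFn_eq_zero_of_sin_eq_zero hh hφ] at hm ⊢
    have hc : cos φ = 1 ∨ cos φ = -1 := by
      have := sin_sq_add_cos_sq φ
      rw [hφ] at this
      exact mul_self_eq_one_iff.1 (by linarith)
    have hU : MeasurableSet {z : Plane | s < z 1} :=
      (isOpen_lt continuous_const (by fun_prop)).measurableSet
    rcases hc with hc | hc
    · have e : {z | 0 < arcFn s h φ z} = {z | s < z 1} := by
        ext z
        simp only [mem_ofPred_eq, arcFn_eq_of_sin_eq_zero s h hφ, hc]
        rw [one_mul, mul_pos_iff_of_pos_left (by positivity), sub_pos]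
      rw [e]
      refine (gaussGreenOn_upperHalfPlane s).congr (ae_eq_refl _) hm fun z _ => ?_
      apply plane_ext <;> simp [arcNormal, hφ, hc]
      field_simp
    · have e : {z | 0 < arcFn s h φ z} = {z | z 1 < s} := by
        ext z
        simp only [mem_ofPred_eq, arcFn_eq_of_sin_eq_zero s h hφ, hc]
        rw [neg_one_mul, neg_pos]
        constructor <;> intro h' <;> nlinarith
      rw [e]
      have hcompl : {z : Plane | z 1 < s} =ᵐ[volume] ({z : Plane | s < z 1}ᶜ : Set Plane) := by
        have : ∀ᵐ z : Plane, z 1 ≠ s := by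
          rw [ae_iff]; simpa using volume_line s
        filter_upwards [this] with z hz
        apply propext
        change z 1 < s ↔ ¬ s < z 1
        rw [not_lt]
        exact ⟨le_of_lt, fun h => lt_of_le_of_ne h hz⟩
      refine ((gaussGreenOn_upperHalfPlane s).compl hU hcompl).congr (ae_eq_refl _) hm fun z _ => ?_
      apply plane_ext <;> simp [arcNormal, hφ, hc]
      field_simp
  · have e : {z | 0 < arcFn s h φ z}
        =ᵐ[volume] ((Metric.ball (arcCenter s h φ) (arcRadius h φ))ᶜ : Set Plane) := by
      filter_upwards [ae_arcFn_ne_zero hh s φ] with z hz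
      apply propext
      change 0 < arcFn s h φ z ↔ ¬ dist z (arcCenter s h φ) < arcRadius h φ
      rw [← arcFn_neg_iff_of_sin_pos hh hφ, not_lt]
      exact ⟨le_of_lt, fun h => lt_of_le_of_ne h hz.symm⟩
    rw [setOf_arcFn_eq_zero_of_sin_ne_zero hh hφ.ne'] at hm ⊢
    refine ((gaussGreenOn_ball _ (arcRadius_pos hh hφ.ne')).compl
      Metric.isOpen_ball.measurableSet e).congr (ae_eq_refl _) hm fun z _ => ?_
    have := hφ.ne'
    apply plane_ext <;> simp [arcNormal, arcCenter, arcRadius, abs_of_pos hφ] <;> field_simp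
    ring

/-! ### Sectors between two arcs of the pencil -/

/-- The points strictly between the arc of direction `φ` and the arc of direction `φ + 2π/3`, as
seen on the circle of directions: in bipolar coordinates this is an angular sector. -/
def sector (s h φ : ℝ) : Set Plane := {z | 0 < arcFn s h φ z ∧ arcFn s h (φ + 2 * π / 3) z < 0}

/-- The closed arc of direction `φ`, cut out of its generalized circle by the next one of the three
generalized circles. For `φ = π` it consists of the two half-lines which complete the chord. -/
def closedArc (s h φ : ℝ) : Set Plane :=
  {z | arcFn s h φ z = 0 ∧ arcFn s h (φ + 2 * π / 3) z ≤ 0}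

/-- The arc of direction `φ` without its endpoints. -/
def openArc (s h φ : ℝ) : Set Plane :=
  {z | arcFn s h φ z = 0 ∧ arcFn s h (φ + 2 * π / 3) z < 0}

theorem isOpen_sector (s h φ : ℝ) : IsOpen (sector s h φ) :=
  (isOpen_lt continuous_const (continuous_arcFn s h φ)).inter
    (isOpen_lt (continuous_arcFn s h _) continuous_const)

theorem measurableSet_closedArc (s h φ : ℝ) : MeasurableSet (closedArc s h φ) :=
  (measurableSet_setOf_arcFn_eq_zero s h φ).inter
    (isClosed_le (continuous_arcFn s h _) continuous_const).measurableSet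

theorem arcFn_add_four_pi_div_three (s h φ : ℝ) (z : Plane) :
    arcFn s h (φ + 2 * π / 3 + 2 * π / 3) z = arcFn s h (φ - 2 * π / 3) z := by
  rw [← arcFn_add_two_pi s h (φ - 2 * π / 3)]
  congr 1
  ring

theorem sector_add_four_pi_div_three (s h φ : ℝ) :
    sector s h (φ + 2 * π / 3 + 2 * π / 3) = sector s h (φ - 2 * π / 3) := by
  ext z
  have e : φ + 2 * π / 3 + 2 * π / 3 + 2 * π / 3 = φ + 2 * π := by ring
  simp only [sector, mem_ofPred_eq, arcFn_add_four_pi_div_three, e, arcFn_add_two_pi,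
    sub_add_cancel]

/-- Two different circles of the pencil only meet at the two base points. -/
theorem eq_or_eq_of_arcFn_eq_zero {s h φ ψ : ℝ} (hh : 0 < h) (hφψ : sin (ψ - φ) ≠ 0) {z : Plane}
    (hφ : arcFn s h φ z = 0) (hψ : arcFn s h ψ z = 0) : z = !₂[h, s] ∨ z = !₂[-h, s] := by
  simp only [arcFn] at hφ hψ
  rw [sin_sub] at hφψ
  have h1 : (sin ψ * cos φ - cos ψ * sin φ) * (2 * h * (z 1 - s)) = 0 := by
    linear_combination sin ψ * hφ - sin φ * hψ
  have h2 : (sin ψ * cos φ - cos ψ * sin φ) * (z 0 ^ 2 + (z 1 - s) ^ 2 - h ^ 2) = 0 := by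
    linear_combination cos φ * hψ - cos ψ * hφ
  have h3 := (mul_eq_zero.1 h1).resolve_left hφψ
  have h4 := (mul_eq_zero.1 h2).resolve_left hφψ
  have h5 : z 1 - s = 0 := (mul_eq_zero.1 h3).resolve_left (by positivity)
  rw [h5] at h4
  have h6 : (z 0 - h) * (z 0 + h) = 0 := by linarith
  rcases mul_eq_zero.1 h6 with h | h
  · exact Or.inl (plane_ext (by simp; linarith) (by simp; linarith))
  · exact Or.inr (plane_ext (by simp; linarith) (by simp; linarith))

theorem sin_two_pi_div_three_ne_zero : sin (2 * π / 3) ≠ 0 := by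
  rw [sin_two_pi_div_three]; positivity

/-- The length measure on the boundary of a sector. -/
noncomputable def sectorMeasure (s h φ : ℝ) : Measure Plane :=
  (Measure.hausdorffMeasure 1).restrict (closedArc s h φ ∪ closedArc s h (φ + 2 * π / 3))

open Classical in
/-- The outer unit normal on the boundary of a sector. -/
noncomputable def sectorNormal (s h φ : ℝ) (z : Plane) : Plane :=
  if arcFn s h φ z = 0 then arcNormal s h φ z else arcNormal s h (φ + 2 * π / 3 + π) z

theorem isGaussGreen_sector {h : ℝ} (hh : 0 < h) (s φ : ℝ) :
    IsGaussGreen (sector s h φ) (sectorMeasure s h φ) (sectorNormal s h φ) := by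
  classical
  set ψ := φ + 2 * π / 3 with hψ
  have hsum := fun z => arcFn_sum' s h φ z
  have hE : {z | 0 < arcFn s h φ z ∧ 0 < arcFn s h (ψ + π) z} = sector s h φ := by
    ext z; simp only [mem_ofPred_eq, sector, arcFn_add_pi, neg_pos, hψ]
  have hΓ : {z | arcFn s h φ z = 0 ∧ 0 ≤ arcFn s h (ψ + π) z}
      ∪ {z | arcFn s h (ψ + π) z = 0 ∧ 0 ≤ arcFn s h φ z}
      = closedArc s h φ ∪ closedArc s h ψ := by
    ext z
    simp only [mem_union, mem_ofPred_eq, closedArc, arcFn_add_pi, neg_nonneg, neg_eq_zero, ← hψ]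
    refine or_congr Iff.rfl (and_congr_right fun h0 => ?_)
    have := hsum z
    rw [← hψ, h0] at this
    constructor <;> intro <;> linarith
  have hfin : IsLocallyFiniteMeasure (sectorMeasure s h φ) := by
    have h1 := isLocallyFiniteMeasure_hausdorffMeasure_restrict_arcFn hh s φ
    have h2 := isLocallyFiniteMeasure_hausdorffMeasure_restrict_arcFn hh s ψ
    refine ⟨fun x => ?_⟩
    obtain ⟨V₁, hV₁, hf₁⟩ := h1.finiteAtNhds x
    obtain ⟨V₂, hV₂, hf₂⟩ := h2.finiteAtNhds x
    refine ⟨V₁ ∩ V₂, inter_mem hV₁ hV₂, ?_⟩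
    refine lt_of_le_of_lt (Measure.restrict_union_le _ _ _) (ENNReal.add_lt_top.2 ⟨?_, ?_⟩)
    · exact lt_of_le_of_lt ((Measure.restrict_mono (fun z hz => hz.1) le_rfl _).trans
        (measure_mono inter_subset_left)) hf₁
    · exact lt_of_le_of_lt ((Measure.restrict_mono (fun z hz => hz.1) le_rfl _).trans
        (measure_mono inter_subset_right)) hf₂
  have key := gaussGreenOn_inter (continuous_arcFn s h φ) (continuous_arcFn s h (ψ + π))
    (continuous_arcNormal s h φ) (continuous_arcNormal s h (ψ + π)) (by rw [hΓ]; exact hfin)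
    (gaussGreenOn_arcFn hh s φ) (gaussGreenOn_arcFn hh s (ψ + π)) {!₂[h, s], !₂[-h, s]} ?_
  · rw [hE, hΓ] at key
    refine ⟨hfin, ?_, ?_, fun T hT hc => ?_⟩
    · exact Measurable.ite (measurableSet_setOf_arcFn_eq_zero s h φ)
        (continuous_arcNormal s h φ).measurable (continuous_arcNormal s h _).measurable
    · rw [sectorMeasure, ae_restrict_iff'
        ((measurableSet_closedArc s h φ).union (measurableSet_closedArc s h _))]
      refine Eventually.of_forall fun z hz => ?_
      rw [sectorNormal]
      split_ifs with h0
      · exact norm_arcNormal hh h0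
      · refine norm_arcNormal hh ?_
        rw [arcFn_add_pi, neg_eq_zero]
        rcases hz with hz | hz
        · exact absurd hz.1 h0
        · exact hz.1
    · exact key T hT hc
  · intro z h1 h2
    rw [arcFn_add_pi, neg_eq_zero] at h2
    simp only [Finset.mem_insert, Finset.mem_singleton]
    refine eq_or_eq_of_arcFn_eq_zero hh ?_ h1 h2
    rw [hψ, add_sub_cancel_left]
    exact sin_two_pi_div_three_ne_zero

theorem hasLocallyFinitePerimeter_sector {h : ℝ} (hh : 0 < h) (s φ : ℝ) :
    HasLocallyFinitePerimeter (sector s h φ) :=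
  ⟨(isOpen_sector s h φ).measurableSet.nullMeasurableSet, _, _, isGaussGreen_sector hh s φ⟩

theorem openArc_subset_closedArc (s h φ : ℝ) : openArc s h φ ⊆ closedArc s h φ :=
  fun _ hz => ⟨hz.1, hz.2.le⟩

/-- The interior points of the lower boundary arc belong to the reduced boundary. -/
theorem openArc_subset_reducedBoundary {h : ℝ} (hh : 0 < h) (s φ : ℝ) :
    openArc s h φ ⊆ reducedBoundary (sector s h φ) := by
  intro x hx
  have hV : IsOpen {z | arcFn s h (φ + 2 * π / 3) z < 0} :=
    isOpen_lt (continuous_arcFn s h _) continuous_const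
  refine mem_reducedBoundary_of_eqOn (isGaussGreen_sector hh s φ) ?_ (hV.mem_nhds hx.2)
    (continuous_arcNormal s h φ).continuousAt (norm_arcNormal hh hx.1) ?_
  · intro r hr
    refine lt_of_lt_of_le (hausdorffMeasure_inter_setOf_arcFn_pos hh hx.1
      (Metric.isOpen_ball.inter hV) ⟨Metric.mem_ball_self hr, hx.2⟩) ?_
    rw [sectorMeasure, Measure.restrict_apply Metric.isOpen_ball.measurableSet]
    exact measure_mono fun z hz => ⟨hz.1.1, Or.inl ⟨hz.2, le_of_lt hz.1.2⟩⟩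
  · rw [sectorMeasure, ae_restrict_iff'
      ((measurableSet_closedArc s h φ).union (measurableSet_closedArc s h _))]
    refine Eventually.of_forall fun z hz hzV => ?_
    rw [sectorNormal, if_pos]
    rcases hz with hz | hz
    · exact hz.1
    · exact absurd hz.1 (ne_of_lt hzV)

/-- The interior points of the upper boundary arc belong to the reduced boundary. -/
theorem openArc_add_subset_reducedBoundary {h : ℝ} (hh : 0 < h) (s φ : ℝ) :
    openArc s h (φ + 2 * π / 3) ⊆ reducedBoundary (sector s h φ) := by
  intro x hx
  have hV : IsOpen {z | 0 < arcFn s h φ z} :=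
    isOpen_lt continuous_const (continuous_arcFn s h _)
  have hsum := fun z => arcFn_sum' s h φ z
  have hxV : 0 < arcFn s h φ x := by linarith [hsum x, hx.1, hx.2]
  have hx0 : arcFn s h (φ + 2 * π / 3 + π) x = 0 := by rw [arcFn_add_pi, hx.1, neg_zero]
  refine mem_reducedBoundary_of_eqOn (isGaussGreen_sector hh s φ) ?_ (hV.mem_nhds hxV)
    (continuous_arcNormal s h (φ + 2 * π / 3 + π)).continuousAt (norm_arcNormal hh hx0) ?_
  · intro r hr
    refine lt_of_lt_of_le (hausdorffMeasure_inter_setOf_arcFn_pos hh hx.1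
      (Metric.isOpen_ball.inter hV) ⟨Metric.mem_ball_self hr, hxV⟩) ?_
    rw [sectorMeasure, Measure.restrict_apply Metric.isOpen_ball.measurableSet]
    refine measure_mono fun z hz => ⟨hz.1.1, Or.inr ⟨hz.2, ?_⟩⟩
    have h1 : 0 < arcFn s h φ z := hz.1.2
    have h2 : arcFn s h (φ + 2 * π / 3) z = 0 := hz.2
    linarith [hsum z]
  · rw [sectorMeasure, ae_restrict_iff'
      ((measurableSet_closedArc s h φ).union (measurableSet_closedArc s h _))]
    refine Eventually.of_forall fun z _ hzV => ?_
    rw [sectorNormal, if_neg (ne_of_gt hzV)]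

theorem closure_sector_subset (s h φ : ℝ) :
    closure (sector s h φ) ⊆ {z | 0 ≤ arcFn s h φ z ∧ arcFn s h (φ + 2 * π / 3) z ≤ 0} :=
  closure_minimal (fun _ hz => ⟨hz.1.le, hz.2.le⟩)
    ((isClosed_le continuous_const (continuous_arcFn s h _)).inter
      (isClosed_le (continuous_arcFn s h _) continuous_const))

theorem reducedBoundary_sector_inter_subset (s h φ : ℝ) :
    reducedBoundary (sector s h φ) ∩ reducedBoundary (sector s h (φ + 2 * π / 3))
      ⊆ closedArc s h (φ + 2 * π / 3) := by
  rintro z ⟨h1, h2⟩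
  have h3 := closure_sector_subset s h φ (reducedBoundary_subset_closure _ h1)
  have h4 := closure_sector_subset s h _ (reducedBoundary_subset_closure _ h2)
  exact ⟨le_antisymm h3.2 h4.1, h4.2⟩

theorem openArc_subset_reducedBoundary_inter {h : ℝ} (hh : 0 < h) (s φ : ℝ) :
    openArc s h (φ + 2 * π / 3)
      ⊆ reducedBoundary (sector s h φ) ∩ reducedBoundary (sector s h (φ + 2 * π / 3)) :=
  subset_inter (openArc_add_subset_reducedBoundary hh s φ) (openArc_subset_reducedBoundary hh s _)

/-! ### Clusters of three sectors -/

/-- The three sectors bounded by the arcs of directions `φ - 2π/3`, `φ` and `φ + 2π/3`. -/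
def sectorCluster (s h φ : ℝ) : Fin 3 → Set Plane :=
  ![sector s h (φ - 2 * π / 3), sector s h φ, sector s h (φ + 2 * π / 3)]

theorem mem_sectorCluster_zero {s h φ : ℝ} {z : Plane} : z ∈ sectorCluster s h φ 0 ↔
    0 < arcFn s h (φ - 2 * π / 3) z ∧ arcFn s h φ z < 0 := by
  change _ ∧ _ ↔ _
  rw [sub_add_cancel]

theorem mem_sectorCluster_one {s h φ : ℝ} {z : Plane} : z ∈ sectorCluster s h φ 1 ↔
    0 < arcFn s h φ z ∧ arcFn s h (φ + 2 * π / 3) z < 0 := Iff.rfl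

theorem mem_sectorCluster_two {s h φ : ℝ} {z : Plane} : z ∈ sectorCluster s h φ 2 ↔
    0 < arcFn s h (φ + 2 * π / 3) z ∧ arcFn s h (φ - 2 * π / 3) z < 0 := by
  change _ ∧ _ ↔ _
  rw [arcFn_add_four_pi_div_three]

theorem relPerimeter_fin_three (X : Fin 3 → Set Plane) (F : Set Plane) :
    relPerimeter X F = Measure.hausdorffMeasure 1 (F ∩ interface X 0 1)
      + Measure.hausdorffMeasure 1 (F ∩ interface X 0 2)
      + Measure.hausdorffMeasure 1 (F ∩ interface X 1 2) := by
  have h0 : Finset.Ioi (0 : Fin 3) = {1, 2} := by decide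
  have h1 : Finset.Ioi (1 : Fin 3) = {2} := by decide
  have h2 : Finset.Ioi (2 : Fin 3) = ∅ := by decide
  simp [relPerimeter, Fin.sum_univ_three, h0, h1, h2]

theorem relPerimeter_congr {m : ℕ} {X Y : Fin m → Set Plane} (h : ∀ j, X j =ᵐ[volume] Y j)
    (F : Set Plane) : relPerimeter X F = relPerimeter Y F := by
  simp only [relPerimeter, interface, fun j => reducedBoundary_congr (h j)]

theorem relPerimeter_sectorCluster_le (s h φ : ℝ) (F : Set Plane) :
    relPerimeter (sectorCluster s h φ) F ≤
      Measure.hausdorffMeasure 1 (F ∩ closedArc s h φ)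
        + Measure.hausdorffMeasure 1 (F ∩ closedArc s h (φ - 2 * π / 3))
        + Measure.hausdorffMeasure 1 (F ∩ closedArc s h (φ + 2 * π / 3)) := by
  rw [relPerimeter_fin_three]
  have h01 := reducedBoundary_sector_inter_subset s h (φ - 2 * π / 3)
  rw [sub_add_cancel] at h01
  have h12 := reducedBoundary_sector_inter_subset s h φ
  have h20 := reducedBoundary_sector_inter_subset s h (φ + 2 * π / 3)
  rw [sector_add_four_pi_div_three] at h20
  have e : closedArc s h (φ + 2 * π / 3 + 2 * π / 3) = closedArc s h (φ - 2 * π / 3) := by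
    ext z
    have e : φ + 2 * π / 3 + 2 * π / 3 + 2 * π / 3 = φ + 2 * π := by ring
    simp only [closedArc, mem_ofPred_eq, arcFn_add_four_pi_div_three, e, arcFn_add_two_pi,
      sub_add_cancel]
  rw [e, inter_comm] at h20
  gcongr
  · exact h01
  · exact h20
  · exact h12

theorem le_relPerimeter_sectorCluster {h : ℝ} (hh : 0 < h) (s φ : ℝ) (F : Set Plane) :
    Measure.hausdorffMeasure 1 (F ∩ openArc s h φ)
        + Measure.hausdorffMeasure 1 (F ∩ openArc s h (φ - 2 * π / 3))
        + Measure.hausdorffMeasure 1 (F ∩ openArc s h (φ + 2 * π / 3))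
      ≤ relPerimeter (sectorCluster s h φ) F := by
  rw [relPerimeter_fin_three]
  have h01 := openArc_subset_reducedBoundary_inter hh s (φ - 2 * π / 3)
  rw [sub_add_cancel] at h01
  have h12 := openArc_subset_reducedBoundary_inter hh s φ
  have h20 := openArc_subset_reducedBoundary_inter hh s (φ + 2 * π / 3)
  rw [sector_add_four_pi_div_three] at h20
  have e : openArc s h (φ + 2 * π / 3 + 2 * π / 3) = openArc s h (φ - 2 * π / 3) := by
    ext z
    have e : φ + 2 * π / 3 + 2 * π / 3 + 2 * π / 3 = φ + 2 * π := by ring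
    simp only [openArc, mem_ofPred_eq, arcFn_add_four_pi_div_three, e, arcFn_add_two_pi,
      sub_add_cancel]
  rw [e, inter_comm (reducedBoundary _)] at h20
  gcongr
  · exact h01
  · exact h20
  · exact h12

/-- A family that agrees almost everywhere with three sectors is a cluster as soon as its areas
are as they should be. -/
theorem isCluster_of_ae_eq_sectorCluster {N M : ℕ} (hNM : N + M = 3) {s h φ : ℝ} (hh : 0 < h)
    {X : Fin (N + M) → Set Plane} (hX : ∀ j, X j =ᵐ[volume] sectorCluster s h φ (Fin.cast hNM j))
    (hproper : ∀ j, j.val < N → 0 < volume (X j) ∧ volume (X j) < ∞)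
    (himproper : ∀ j, N ≤ j.val → volume (X j) = ∞) : IsCluster N M X := by
  refine ⟨fun j => ?_, hproper, himproper, fun j k hjk => ?_, ?_⟩
  · refine HasLocallyFinitePerimeter.congr (hX j).symm ?_
    have : ∀ i : Fin 3, HasLocallyFinitePerimeter (sectorCluster s h φ i) := by
      intro i
      fin_cases i <;> exact hasLocallyFinitePerimeter_sector hh _ _
    exact this _
  · rw [measure_congr ((hX j).inter (hX k))]
    have : ∀ i l : Fin 3, i ≠ l → sectorCluster s h φ i ∩ sectorCluster s h φ l = ∅ := by
      intro i l hil
      rw [eq_empty_iff_forall_notMem]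
      rintro z ⟨h1, h2⟩
      fin_cases i <;> fin_cases l <;>
        first
        | exact hil rfl
        | (simp only [Fin.mk_zero, Fin.mk_one, Fin.reduceFinMk, mem_sectorCluster_zero,
            mem_sectorCluster_one, mem_sectorCluster_two] at h1 h2
           linarith [h1.1, h1.2, h2.1, h2.2])
    rw [this _ _ fun hc => hjk (Fin.cast_injective hNM hc), measure_empty]
  · have hall : ∀ᵐ z : Plane, ∀ j, z ∈ X j ↔ z ∈ sectorCluster s h φ (Fin.cast hNM j) := by
      rw [ae_all_iff]
      intro j
      filter_upwards [hX j] with z hz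
      exact iff_of_eq hz
    have : ∀ᵐ z : Plane, z ∈ ⋃ j, X j := by
      filter_upwards [hall, ae_arcFn_ne_zero hh s φ, ae_arcFn_ne_zero hh s (φ - 2 * π / 3),
        ae_arcFn_ne_zero hh s (φ + 2 * π / 3)] with z hz hb ha hc
      obtain ⟨i, hi⟩ : ∃ i : Fin 3, z ∈ sectorCluster s h φ i := by
        have hsum := arcFn_sum s h φ z
        rcases lt_or_gt_of_ne hb with hb | hb
        · rcases lt_or_gt_of_ne ha with ha | ha
          · exact ⟨2, mem_sectorCluster_two.2 ⟨by linarith, ha⟩⟩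
          · exact ⟨0, mem_sectorCluster_zero.2 ⟨ha, hb⟩⟩
        · rcases lt_or_gt_of_ne hc with hc | hc
          · exact ⟨1, mem_sectorCluster_one.2 ⟨hb, hc⟩⟩
          · exact ⟨2, mem_sectorCluster_two.2 ⟨hc, by linarith⟩⟩
      exact mem_iUnion.2 ⟨Fin.cast hNM.symm i, (hz _).2 hi⟩
    exact this

/-! ### The double bubble and the lens in terms of sectors -/

theorem mem_belowArc_iff {s h φ : ℝ} (hh : 0 < h) (h1 : -π < φ) (h2 : φ < π) {z : Plane} :
    z ∈ belowArc s h φ ↔ arcFn s h φ z < 0 := by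
  simp only [belowArc, mem_ofPred_eq]
  rcases lt_trichotomy φ 0 with hφ | hφ | hφ
  · rw [arcFn_neg_iff_of_sin_neg hh (sin_neg_of_neg_of_neg_pi_lt hφ h1)]
    simp [hφ, hφ.ne, hφ.not_gt]
  · subst hφ
    rw [arcFn_eq_of_sin_eq_zero s h sin_zero, cos_zero, one_mul]
    simp only [lt_self_iff_false, false_and, true_and, or_false, false_or]
    constructor <;> intro _ <;> nlinarith
  · rw [arcFn_neg_iff_of_sin_pos hh (sin_pos_of_pos_of_lt_pi hφ h2)]
    simp [hφ, hφ.ne', hφ.not_gt]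

theorem mem_aboveArc_iff {s h φ : ℝ} (hh : 0 < h) (h1 : -π < φ) (h2 : φ < π) {z : Plane} :
    z ∈ aboveArc s h φ ↔ 0 < arcFn s h φ z := by
  simp only [aboveArc, mem_ofPred_eq]
  rcases lt_trichotomy φ 0 with hφ | hφ | hφ
  · rw [arcFn_pos_iff_of_sin_neg hh (sin_neg_of_neg_of_neg_pi_lt hφ h1)]
    simp [hφ, hφ.ne, hφ.not_gt]
  · subst hφ
    rw [arcFn_eq_of_sin_eq_zero s h sin_zero, cos_zero, one_mul]
    simp only [lt_self_iff_false, false_and, true_and, or_false, false_or]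
    constructor <;> intro _ <;> nlinarith
  · rw [arcFn_pos_iff_of_sin_pos hh (sin_pos_of_pos_of_lt_pi hφ h2)]
    simp [hφ, hφ.ne', hφ.not_gt]

theorem mem_enclosedRegion_iff {s h φ₁ φ₂ : ℝ} (hh : 0 < h) (h1 : -π < φ₁) (h1' : φ₁ < 0)
    (h2 : 0 < φ₂) (h2' : φ₂ < π) {z : Plane} :
    z ∈ enclosedRegion s h φ₁ φ₂ ↔
      (s ≤ z 1 ∧ arcFn s h φ₂ z < 0) ∨ (z 1 ≤ s ∧ 0 < arcFn s h φ₁ z) := by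
  simp only [enclosedRegion, mem_ofPred_eq, Metric.mem_ball,
    arcFn_neg_iff_of_sin_pos hh (sin_pos_of_pos_of_lt_pi h2 h2'),
    arcFn_pos_iff_of_sin_neg hh (sin_neg_of_neg_of_neg_pi_lt h1' h1)]

/-- The functions of the two outer arcs determine the height of `z` above the chord. This relates
the two clauses in the definition of the enclosed region. -/
theorem arcFn_mul_sin_sub (s h φ : ℝ) (z : Plane) :
    arcFn s h (φ - 2 * π / 3) z * sin (φ + 2 * π / 3)
      - arcFn s h (φ + 2 * π / 3) z * sin (φ - 2 * π / 3) = -(√3 * h * (z 1 - s)) := by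
  have h1 : sin ((φ + 2 * π / 3) - (φ - 2 * π / 3)) = -(√3 / 2) := by
    rw [show (φ + 2 * π / 3) - (φ - 2 * π / 3) = π / 3 + π by ring, sin_add_pi, sin_pi_div_three]
  rw [sin_sub] at h1
  simp only [arcFn]
  linear_combination 2 * h * (z 1 - s) * h1

theorem bubbleCluster_zero_eq {s h φ : ℝ} (hh : 0 < h) (h1 : -(π / 3) < φ) (h2 : φ < π / 3) :
    enclosedRegion s h (φ - 2 * π / 3) (φ + 2 * π / 3) ∩ belowArc s h φ
      = sectorCluster s h φ 0 := by
  have hπ := pi_pos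
  ext z
  have hsum := arcFn_sum s h φ z
  have hrel := arcFn_mul_sin_sub s h φ z
  have hs1 : sin (φ - 2 * π / 3) < 0 :=
    sin_neg_of_neg_of_neg_pi_lt (by linarith) (by linarith)
  have hs2 : 0 < sin (φ + 2 * π / 3) := sin_pos_of_pos_of_lt_pi (by linarith) (by linarith)
  have h3 : 0 < √3 * h := by positivity
  rw [mem_inter_iff, mem_belowArc_iff hh (by linarith) (by linarith),
    mem_enclosedRegion_iff hh (by linarith) (by linarith) (by linarith) (by linarith),
    mem_sectorCluster_zero]
  constructor
  · rintro ⟨⟨_, hc⟩ | ⟨_, ha⟩, hb⟩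
    · exact ⟨by linarith, hb⟩
    · exact ⟨ha, hb⟩
  · rintro ⟨ha, hb⟩
    refine ⟨?_, hb⟩
    rcases le_total s (z 1) with hz | hz
    · refine Or.inl ⟨hz, ?_⟩
      have := mul_nonneg h3.le (sub_nonneg.2 hz)
      have := mul_pos ha hs2
      by_contra hc
      rw [not_lt] at hc
      nlinarith
    · exact Or.inr ⟨hz, ha⟩

theorem bubbleCluster_one_eq {s h φ : ℝ} (hh : 0 < h) (h1 : -(π / 3) < φ) (h2 : φ < π / 3) :
    enclosedRegion s h (φ - 2 * π / 3) (φ + 2 * π / 3) ∩ aboveArc s h φ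
      = sectorCluster s h φ 1 := by
  have hπ := pi_pos
  ext z
  have hsum := arcFn_sum s h φ z
  have hrel := arcFn_mul_sin_sub s h φ z
  have hs1 : sin (φ - 2 * π / 3) < 0 :=
    sin_neg_of_neg_of_neg_pi_lt (by linarith) (by linarith)
  have hs2 : 0 < sin (φ + 2 * π / 3) := sin_pos_of_pos_of_lt_pi (by linarith) (by linarith)
  have h3 : 0 < √3 * h := by positivity
  rw [mem_inter_iff, mem_aboveArc_iff hh (by linarith) (by linarith),
    mem_enclosedRegion_iff hh (by linarith) (by linarith) (by linarith) (by linarith),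
    mem_sectorCluster_one]
  constructor
  · rintro ⟨⟨_, hc⟩ | ⟨_, ha⟩, hb⟩
    · exact ⟨hb, hc⟩
    · exact ⟨hb, by linarith⟩
  · rintro ⟨hb, hc⟩
    refine ⟨?_, hb⟩
    rcases le_total s (z 1) with hz | hz
    · exact Or.inl ⟨hz, hc⟩
    · refine Or.inr ⟨hz, ?_⟩
      have := mul_nonneg h3.le (sub_nonneg.2 hz)
      have := mul_pos_of_neg_of_neg hc hs1
      by_contra ha
      rw [not_lt] at ha
      nlinarith

theorem bubbleCluster_ae_eq {s h φ : ℝ} (hh : 0 < h) (h1 : -(π / 3) < φ) (h2 : φ < π / 3)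
    (j : Fin 3) :
    bubbleCluster s h φ (φ - 2 * π / 3) (φ + 2 * π / 3) j =ᵐ[volume] sectorCluster s h φ j := by
  have e0 := bubbleCluster_zero_eq (s := s) hh h1 h2
  have e1 := bubbleCluster_one_eq (s := s) hh h1 h2
  fin_cases j
  · exact Eventually.of_forall fun z => congrFun e0 z
  · exact Eventually.of_forall fun z => congrFun e1 z
  · change ((closure (enclosedRegion s h (φ - 2 * π / 3) (φ + 2 * π / 3) ∩ belowArc s h φ ∪
      enclosedRegion s h (φ - 2 * π / 3) (φ + 2 * π / 3) ∩ aboveArc s h φ))ᶜ : Set Plane)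
      =ᵐ[volume] sectorCluster s h φ 2
    rw [e0, e1, closure_union]
    filter_upwards [ae_arcFn_ne_zero hh s φ, ae_arcFn_ne_zero hh s (φ - 2 * π / 3),
      ae_arcFn_ne_zero hh s (φ + 2 * π / 3)] with z hb ha hc
    have hsum := arcFn_sum s h φ z
    have hc0 : closure (sectorCluster s h φ 0) ⊆ _ := closure_sector_subset s h (φ - 2 * π / 3)
    have hc1 : closure (sectorCluster s h φ 1) ⊆ _ := closure_sector_subset s h φ
    rw [sub_add_cancel] at hc0
    apply propext
    change ¬ (z ∈ closure (sectorCluster s h φ 0) ∨ z ∈ closure (sectorCluster s h φ 1))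
      ↔ z ∈ sectorCluster s h φ 2
    rw [mem_sectorCluster_two, not_or]
    constructor
    · rintro ⟨hz0, hz1⟩
      replace hz0 : ¬ z ∈ sectorCluster s h φ 0 := fun h => hz0 (subset_closure h)
      replace hz1 : ¬ z ∈ sectorCluster s h φ 1 := fun h => hz1 (subset_closure h)
      rw [mem_sectorCluster_zero, not_and, not_lt] at hz0
      rw [mem_sectorCluster_one, not_and, not_lt] at hz1
      rcases lt_or_gt_of_ne ha with ha | ha
      · refine ⟨?_, ha⟩
        rcases lt_or_gt_of_ne hb with hb | hb
        · linarith
        · exact lt_of_le_of_ne (hz1 hb) hc.symm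
      · have hb' := lt_of_le_of_ne (hz0 ha) hb.symm
        linarith [hz1 hb']
    · rintro ⟨hc, ha⟩
      exact ⟨fun hz => by linarith [(hc0 hz).1], fun hz => by linarith [(hc1 hz).2]⟩

theorem two_pi_div_three_sub_pos : 0 < 2 * π / 3 - √3 / 2 := by
  have h3 : √3 < 2 := by rw [sqrt_lt' two_pos]; norm_num
  linarith [pi_gt_three]

theorem lensRadius_pos : 0 < lensRadius := inv_pos.2 (sqrt_pos.2 two_pi_div_three_sub_pos)

theorem lensRadius_sq : lensRadius ^ 2 * (2 * π / 3 - √3 / 2) = 1 := by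
  rw [lensRadius, inv_pow, sq_sqrt two_pi_div_three_sub_pos.le,
    inv_mul_cancel₀ two_pi_div_three_sub_pos.ne']

theorem mem_lens_iff {z : Plane} : z ∈ lens ↔
    z 0 ^ 2 + (z 1 + lensRadius / 2) ^ 2 ≤ lensRadius ^ 2 ∧
      z 0 ^ 2 + (z 1 - lensRadius / 2) ^ 2 ≤ lensRadius ^ 2 := by
  have hR := lensRadius_pos
  set R := lensRadius
  have h3 : √3 ^ 2 = 3 := sq_sqrt (by norm_num)
  have h3' : 0 < √3 := by positivity
  simp only [lens, mem_ofPred_eq]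
  constructor
  · rintro ⟨hx, hy⟩
    have hx2 : z 0 ^ 2 ≤ (√3 / 2 * R) ^ 2 := by
      rw [← sq_abs]
      gcongr
    have hq0 : 0 ≤ √(R ^ 2 - z 0 ^ 2) := sqrt_nonneg _
    have hq : √(R ^ 2 - z 0 ^ 2) ^ 2 = R ^ 2 - z 0 ^ 2 := by
      apply sq_sqrt
      rw [mul_pow, div_pow, h3] at hx2
      nlinarith
    obtain ⟨hy1, hy2⟩ := abs_le.1 hy
    constructor <;> nlinarith
  · rintro ⟨h1, h2⟩
    have hkey : (|z 1| + R / 2) ^ 2 ≤ R ^ 2 - z 0 ^ 2 := by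
      rcases abs_choice (z 1) with h | h <;> rw [h] <;> nlinarith
    have hy0 := abs_nonneg (z 1)
    constructor
    · refine abs_le_of_sq_le_sq ?_ (by positivity)
      rw [mul_pow, div_pow, h3]
      nlinarith
    · have := Real.le_sqrt_of_sq_le hkey
      linarith

theorem arcFn_lens_upper (z : Plane) : arcFn 0 (√3 / 2 * lensRadius) (π / 3) z
    = √3 / 2 * (z 0 ^ 2 + (z 1 + lensRadius / 2) ^ 2 - lensRadius ^ 2) := by
  have h3 : √3 ^ 2 = 3 := sq_sqrt (by norm_num)
  simp only [arcFn, sin_pi_div_three, cos_pi_div_three]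
  linear_combination (-√3 / 8 * lensRadius ^ 2) * h3

theorem arcFn_lens_lower (z : Plane) : arcFn 0 (√3 / 2 * lensRadius) (π / 3 - 2 * π / 3) z
    = -(√3 / 2 * (z 0 ^ 2 + (z 1 - lensRadius / 2) ^ 2 - lensRadius ^ 2)) := by
  have h3 : √3 ^ 2 = 3 := sq_sqrt (by norm_num)
  rw [show π / 3 - 2 * π / 3 = -(π / 3) by ring]
  simp only [arcFn, sin_neg, cos_neg, sin_pi_div_three, cos_pi_div_three]
  linear_combination (√3 / 8 * lensRadius ^ 2) * h3

theorem arcFn_lens_axis (h : ℝ) (z : Plane) : arcFn 0 h (π / 3 + 2 * π / 3) z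
    = -(2 * h * z 1) := by
  rw [show π / 3 + 2 * π / 3 = π by ring]
  simp [arcFn]

theorem lensWidth_pos : 0 < √3 / 2 * lensRadius := by
  have := lensRadius_pos
  positivity

theorem lensCluster_ae_eq (j : Fin 3) :
    lensCluster j =ᵐ[volume] sectorCluster 0 (√3 / 2 * lensRadius) (π / 3) j := by
  have hR := lensRadius_pos
  have hh := lensWidth_pos
  have h3 : 0 < √3 / 2 := by positivity
  -- off the three circles, the lens, its interior and the first sector agree
  have hopen : sectorCluster 0 (√3 / 2 * lensRadius) (π / 3) 0 ⊆ interior lens := by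
    refine interior_maximal (fun z hz => ?_) (isOpen_sector _ _ _)
    rw [mem_sectorCluster_zero, arcFn_lens_upper, arcFn_lens_lower] at hz
    rw [mem_lens_iff]
    constructor <;> nlinarith [hz.1, hz.2]
  have hlens : ∀ᵐ z : Plane, z ∈ lens → z ∈ sectorCluster 0 (√3 / 2 * lensRadius) (π / 3) 0 := by
    filter_upwards [ae_arcFn_ne_zero hh 0 (π / 3), ae_arcFn_ne_zero hh 0 (π / 3 - 2 * π / 3)] with
      z hb ha hz
    rw [mem_lens_iff] at hz
    rw [mem_sectorCluster_zero]
    constructor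
    · refine lt_of_le_of_ne ?_ ha.symm
      rw [arcFn_lens_lower]; nlinarith [hz.2]
    · refine lt_of_le_of_ne ?_ hb
      rw [arcFn_lens_upper]; nlinarith [hz.1]
  fin_cases j
  · filter_upwards [hlens] with z hz
    exact propext ⟨hz, fun h => interior_subset (s := lens) (hopen h)⟩
  · filter_upwards [hlens, ae_arcFn_ne_zero hh 0 (π / 3),
      ae_arcFn_ne_zero hh 0 (π / 3 + 2 * π / 3)] with z hz hb hc
    have hsum := arcFn_sum 0 (√3 / 2 * lensRadius) (π / 3) z
    apply propext
    change 0 ≤ z 1 ∧ z ∉ interior lens ↔ z ∈ sectorCluster 0 (√3 / 2 * lensRadius) (π / 3) 1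
    have hc' : arcFn 0 (√3 / 2 * lensRadius) (π / 3 + 2 * π / 3) z < 0 ↔ 0 ≤ z 1 := by
      rw [arcFn_lens_axis] at hc ⊢
      constructor
      · intro h; by_contra hlt; rw [not_le] at hlt; nlinarith
      · intro h; exact lt_of_le_of_ne (by rw [neg_nonpos]; positivity) hc
    rw [mem_sectorCluster_one, hc', and_comm]
    refine and_congr_left fun hz1 => ?_
    have hc1 := hc'.2 hz1
    constructor
    · intro hint
      rcases lt_or_gt_of_ne hb with hb | hb
      · exact absurd (hopen (mem_sectorCluster_zero.2 ⟨by linarith, hb⟩)) hint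
      · exact hb
    · intro hb hint
      have := (mem_sectorCluster_zero.1 (hz (interior_subset hint))).2
      linarith
  · filter_upwards [hlens, ae_arcFn_ne_zero hh 0 (π / 3 - 2 * π / 3),
      ae_arcFn_ne_zero hh 0 (π / 3 + 2 * π / 3)] with z hz ha hc
    have hsum := arcFn_sum 0 (√3 / 2 * lensRadius) (π / 3) z
    apply propext
    change z 1 ≤ 0 ∧ z ∉ interior lens ↔ z ∈ sectorCluster 0 (√3 / 2 * lensRadius) (π / 3) 2
    have hc' : 0 < arcFn 0 (√3 / 2 * lensRadius) (π / 3 + 2 * π / 3) z ↔ z 1 ≤ 0 := by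
      rw [arcFn_lens_axis] at hc ⊢
      constructor
      · intro h; by_contra hlt; rw [not_le] at hlt; nlinarith
      · intro h; exact lt_of_le_of_ne (by nlinarith) hc.symm
    rw [mem_sectorCluster_two, hc']
    refine and_congr_right fun hz1 => ?_
    have hc1 := hc'.2 hz1
    constructor
    · intro hint
      rcases lt_or_gt_of_ne ha with ha | ha
      · exact ha
      · exact absurd (hopen (mem_sectorCluster_zero.2 ⟨ha, by linarith⟩)) hint
    · intro ha hint
      have := (mem_sectorCluster_zero.1 (hz (interior_subset hint))).1
      linarith

theorem volume_plane_eq (S : Set Plane) :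
    volume S = volume {p : ℝ × ℝ | (!₂[p.1, p.2] : Plane) ∈ S} := by
  have h1 := (EuclideanSpace.volume_preserving_symm_measurableEquiv_toLp (Fin 2)).symm
  have h2 := (volume_preserving_finTwoArrow ℝ).symm
  rw [← h1.measure_preimage_equiv, ← h2.measure_preimage_equiv]
  rfl

theorem isClosed_lens : IsClosed lens := by
  have : lens = {z | z 0 ^ 2 + (z 1 + lensRadius / 2) ^ 2 ≤ lensRadius ^ 2} ∩
      {z | z 0 ^ 2 + (z 1 - lensRadius / 2) ^ 2 ≤ lensRadius ^ 2} := by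
    ext z; exact mem_lens_iff
  rw [this]
  exact (isClosed_le (by fun_prop) continuous_const).inter
    (isClosed_le (by fun_prop) continuous_const)

theorem integral_lens : ∫ x in (-(√3 / 2 * lensRadius))..(√3 / 2 * lensRadius),
    2 * (√(lensRadius ^ 2 - x ^ 2) - lensRadius / 2) = 1 := by
  have hR := lensRadius_pos
  have hR2 := lensRadius_sq
  set R := lensRadius
  have h3 : √3 ^ 2 = 3 := sq_sqrt (by norm_num)
  have h3' : 0 < √3 := by positivity
  have h32 : √3 < 2 := by rw [sqrt_lt' two_pos]; norm_num
  have ha : 0 < √3 / 2 * R := by positivity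
  rw [intervalIntegral.integral_eq_sub_of_hasDerivAt
    (f := fun x => x * √(R ^ 2 - x ^ 2) + R ^ 2 * arcsin (x / R) - R * x)]
  · have e1 : √(R ^ 2 - (√3 / 2 * R) ^ 2) = R / 2 := by
      rw [sqrt_eq_iff_mul_self_eq_of_pos (by positivity), mul_pow, div_pow, h3]
      ring
    have e2 : arcsin (√3 / 2 * R / R) = π / 3 := by
      rw [mul_div_cancel_right₀ _ hR.ne', ← sin_pi_div_three,
        arcsin_sin (by linarith [pi_pos]) (by linarith [pi_pos])]
    simp only [neg_sq, neg_div, arcsin_neg, e1, e2]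
    linarith
  · intro x hx
    rw [uIcc_of_le (by linarith)] at hx
    have hx2 : x ^ 2 < R ^ 2 := by
      have : x ^ 2 ≤ (√3 / 2 * R) ^ 2 := sq_le_sq' hx.1 hx.2
      rw [mul_pow, div_pow, h3] at this
      nlinarith
    have hq : 0 < R ^ 2 - x ^ 2 := by linarith
    have hq0 := sqrt_pos.2 hq
    have hq2 : √(R ^ 2 - x ^ 2) ^ 2 = R ^ 2 - x ^ 2 := sq_sqrt hq.le
    have hxR : |x| < R := abs_lt_of_sq_lt_sq hx2 hR.le
    have hd1 : HasDerivAt (fun x : ℝ => √(R ^ 2 - x ^ 2)) (-(x / √(R ^ 2 - x ^ 2))) x := by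
      have h0 : HasDerivAt (fun x : ℝ => R ^ 2 - x ^ 2) (-(2 * x)) x := by
        simpa using ((hasDerivAt_pow 2 x).const_sub (R ^ 2))
      refine (h0.sqrt hq.ne').congr_deriv ?_
      field_simp
    have hd2 : HasDerivAt (fun x : ℝ => arcsin (x / R)) (1 / √(R ^ 2 - x ^ 2)) x := by
      have h1 : x / R ≠ -1 := by
        rw [Ne, div_eq_iff hR.ne']; linarith [(abs_lt.1 hxR).1]
      have h2 : x / R ≠ 1 := by
        rw [Ne, div_eq_iff hR.ne']; linarith [(abs_lt.1 hxR).2]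
      refine ((hasDerivAt_arcsin h1 h2).comp x ((hasDerivAt_id x).div_const R)).congr_deriv ?_
      have : √(1 - (x / R) ^ 2) = √(R ^ 2 - x ^ 2) / R := by
        rw [div_pow, one_sub_div (by positivity), sqrt_div hq.le, sqrt_sq hR.le]
      rw [this]
      field_simp
    have := (((hasDerivAt_id x).mul hd1).add (hd2.const_mul (R ^ 2))).sub
      ((hasDerivAt_id x).const_mul R)
    refine this.congr_deriv ?_
    simp only [id]
    field_simp
    linarith
  · exact Continuous.intervalIntegrable (by fun_prop) _ _

/-- The lens has unit area. -/
theorem volume_lens : volume lens = 1 := by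
  have hR := lensRadius_pos
  have ha := lensWidth_pos
  have hm : MeasurableSet {p : ℝ × ℝ | (!₂[p.1, p.2] : Plane) ∈ lens} :=
    (isClosed_lens.preimage (by fun_prop : Continuous fun p : ℝ × ℝ =>
      (!₂[p.1, p.2] : Plane))).measurableSet
  rw [volume_plane_eq, Measure.volume_eq_prod, Measure.prod_apply hm]
  have hslice : ∀ x : ℝ, volume (Prod.mk x ⁻¹' {p : ℝ × ℝ | (!₂[p.1, p.2] : Plane) ∈ lens})
      = (Icc (-(√3 / 2 * lensRadius)) (√3 / 2 * lensRadius)).indicator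
        (fun x => ENNReal.ofReal (2 * (√(lensRadius ^ 2 - x ^ 2) - lensRadius / 2))) x := by
    intro x
    by_cases hx : x ∈ Icc (-(√3 / 2 * lensRadius)) (√3 / 2 * lensRadius)
    · rw [indicator_of_mem hx]
      have : Prod.mk x ⁻¹' {p : ℝ × ℝ | (!₂[p.1, p.2] : Plane) ∈ lens}
          = Icc (-(√(lensRadius ^ 2 - x ^ 2) - lensRadius / 2))
            (√(lensRadius ^ 2 - x ^ 2) - lensRadius / 2) := by
        ext y
        have hx' : |x| ≤ √3 / 2 * lensRadius := abs_le.2 hx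
        simp only [lens, mem_preimage, mem_ofPred_eq, mem_Icc, ← abs_le]
        simp [hx']
      rw [this, Real.volume_Icc]
      congr 1
      ring
    · rw [indicator_of_notMem hx]
      have : Prod.mk x ⁻¹' {p : ℝ × ℝ | (!₂[p.1, p.2] : Plane) ∈ lens} = ∅ := by
        rw [eq_empty_iff_forall_notMem]
        intro y hy
        exact hx (abs_le.1 hy.1)
      rw [this, measure_empty]
  simp only [hslice]
  rw [lintegral_indicator measurableSet_Icc, ← ofReal_integral_eq_lintegral_ofReal]
  · rw [integral_Icc_eq_integral_Ioc, ← intervalIntegral.integral_of_le (by linarith),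
      integral_lens, ENNReal.ofReal_one]
  · exact (by fun_prop : Continuous fun x : ℝ =>
      2 * (√(lensRadius ^ 2 - x ^ 2) - lensRadius / 2)).continuousOn.integrableOn_compact
      isCompact_Icc
  · rw [EventuallyLE, ae_restrict_iff' measurableSet_Icc]
    refine Eventually.of_forall fun x hx => ?_
    have h3 : √3 ^ 2 = 3 := sq_sqrt (by norm_num)
    have : x ^ 2 ≤ (√3 / 2 * lensRadius) ^ 2 := sq_le_sq' hx.1 hx.2
    rw [mul_pow, div_pow, h3] at this
    have : lensRadius / 2 ≤ √(lensRadius ^ 2 - x ^ 2) := Real.le_sqrt_of_sq_le (by nlinarith)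
    simp only [Pi.zero_apply]
    linarith

/-! ### Convergence of sectors and of arcs -/

/-- Fatou's lemma for sets. -/
theorem eventually_lt_measure_of_forall_ae {ι α : Type*} [MeasurableSpace α] {μ : Measure α}
    [SigmaFinite μ] {l : Filter ι} [l.IsCountablyGenerated] {B : Set α} {C : ι → Set α}
    (hB : MeasurableSet B) (hC : ∀ i, MeasurableSet (C i))
    (h : ∀ᵐ x ∂μ, x ∈ B → ∀ᶠ i in l, x ∈ C i) {c : ℝ≥0∞} (hc : c < μ B) :
    ∀ᶠ i in l, c < μ (C i) := by
  obtain ⟨t, ht, htB, hct, htfin⟩ := Measure.exists_subset_measure_lt_top hB hc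
  have hlim : Tendsto (fun i => μ (C i ∩ t)) l (𝓝 (μ t)) := by
    refine tendsto_measure_of_ae_tendsto_indicator l ht (fun i => (hC i).inter ht) ht htfin.ne
      (Eventually.of_forall fun i => inter_subset_right) ?_
    filter_upwards [h] with x hx
    by_cases hxt : x ∈ t
    · filter_upwards [hx (htB hxt)] with i hi
      exact iff_of_true ⟨hi, hxt⟩ hxt
    · exact Eventually.of_forall fun i => iff_of_false (fun h' => hxt h'.2) hxt
  filter_upwards [hlim.eventually (lt_mem_nhds hct)] with i hi
  exact hi.trans_le (measure_mono inter_subset_left)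

theorem measure_le_liminf_of_forall_ae {ι α : Type*} [MeasurableSpace α] {μ : Measure α}
    [SigmaFinite μ] {l : Filter ι} [l.IsCountablyGenerated] {B : Set α} {C : ι → Set α}
    (hB : MeasurableSet B) (hC : ∀ i, MeasurableSet (C i))
    (h : ∀ᵐ x ∂μ, x ∈ B → ∀ᶠ i in l, x ∈ C i) : μ B ≤ liminf (fun i => μ (C i)) l := by
  refine le_of_forall_lt fun c hc => ?_
  obtain ⟨d, hcd, hdB⟩ := exists_between hc
  refine hcd.trans_le (le_liminf_of_le (by isBoundedDefault) ?_)
  filter_upwards [eventually_lt_measure_of_forall_ae hB hC h hdB] with i hi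
  exact hi.le

section Limits

variable {ι : Type*} {l : Filter ι} {s h φ : ι → ℝ} {s₀ h₀ φ₀ : ℝ}

theorem tendsto_arcFn (hs : Tendsto s l (𝓝 s₀)) (hh : Tendsto h l (𝓝 h₀))
    (hφ : Tendsto φ l (𝓝 φ₀)) {z : ι → Plane} {z₀ : Plane} (hz : Tendsto z l (𝓝 z₀)) :
    Tendsto (fun i => arcFn (s i) (h i) (φ i) (z i)) l (𝓝 (arcFn s₀ h₀ φ₀ z₀)) := by
  have h0 : Tendsto (fun i => z i 0) l (𝓝 (z₀ 0)) :=
    ((EuclideanSpace.proj (𝕜 := ℝ) (0 : Fin 2)).continuous.tendsto z₀).comp hz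
  have h1 : Tendsto (fun i => z i 1) l (𝓝 (z₀ 1)) :=
    ((EuclideanSpace.proj (𝕜 := ℝ) (1 : Fin 2)).continuous.tendsto z₀).comp hz
  exact (((continuous_sin.tendsto _).comp hφ).mul
    (((h0.pow 2).add ((h1.sub hs).pow 2)).sub (hh.pow 2))).add
      (((continuous_cos.tendsto _).comp hφ).mul ((hh.const_mul 2).mul (h1.sub hs)))

theorem tendsto_plane {f : ι → Plane} {z : Plane} (h0 : Tendsto (fun i => f i 0) l (𝓝 (z 0)))
    (h1 : Tendsto (fun i => f i 1) l (𝓝 (z 1))) : Tendsto f l (𝓝 z) := by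
  have := (h0.smul_const (EuclideanSpace.single (0 : Fin 2) (1 : ℝ))).add
    (h1.smul_const (EuclideanSpace.single (1 : Fin 2) (1 : ℝ)))
  rw [← plane_eq_sum z] at this
  exact this.congr fun i => (plane_eq_sum (f i)).symm

theorem eventually_mem_sector (hs : Tendsto s l (𝓝 s₀)) (hh : Tendsto h l (𝓝 h₀))
    (hφ : Tendsto φ l (𝓝 φ₀)) {z : Plane} (hz : z ∈ sector s₀ h₀ φ₀) :
    ∀ᶠ i in l, z ∈ sector (s i) (h i) (φ i) := by
  filter_upwards [(tendsto_arcFn hs hh hφ tendsto_const_nhds).eventually (lt_mem_nhds hz.1),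
    (tendsto_arcFn hs hh (hφ.add_const (2 * π / 3)) tendsto_const_nhds).eventually
      (gt_mem_nhds hz.2)] with i h1 h2
  exact ⟨h1, h2⟩

theorem ae_eventually_mem_sector_iff (hs : Tendsto s l (𝓝 s₀)) (hh : Tendsto h l (𝓝 h₀))
    (hφ : Tendsto φ l (𝓝 φ₀)) (hh₀ : 0 < h₀) :
    ∀ᵐ z : Plane, ∀ᶠ i in l, z ∈ sector (s i) (h i) (φ i) ↔ z ∈ sector s₀ h₀ φ₀ := by
  filter_upwards [ae_arcFn_ne_zero hh₀ s₀ φ₀, ae_arcFn_ne_zero hh₀ s₀ (φ₀ + 2 * π / 3)] with z h1 h2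
  by_cases hz : z ∈ sector s₀ h₀ φ₀
  · filter_upwards [eventually_mem_sector hs hh hφ hz] with i hi
    exact iff_of_true hi hz
  · rcases lt_or_gt_of_ne h1 with h1 | h1
    · filter_upwards [(tendsto_arcFn hs hh hφ tendsto_const_nhds).eventually (gt_mem_nhds h1)]
        with i hi
      exact iff_of_false (fun h' => absurd h'.1 hi.not_gt) hz
    · rcases lt_or_gt_of_ne h2 with h2 | h2
      · exact absurd ⟨h1, h2⟩ hz
      · filter_upwards [(tendsto_arcFn hs hh (hφ.add_const (2 * π / 3))
          tendsto_const_nhds).eventually (lt_mem_nhds h2)] with i hi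
        exact iff_of_false (fun h' => absurd h'.2 hi.not_gt) hz

theorem tendsto_volume_inter_symmDiff_sector [l.IsCountablyGenerated] (hs : Tendsto s l (𝓝 s₀))
    (hh : Tendsto h l (𝓝 h₀)) (hφ : Tendsto φ l (𝓝 φ₀)) (hh₀ : 0 < h₀) {K : Set Plane}
    (hK : MeasurableSet K) (hKfin : volume K ≠ ∞) :
    Tendsto (fun i => volume (K ∩ symmDiff (sector (s i) (h i) (φ i)) (sector s₀ h₀ φ₀))) l
      (𝓝 0) := by
  rw [← measure_empty (μ := (volume : Measure Plane))]
  refine tendsto_measure_of_ae_tendsto_indicator l .empty (fun i => hK.inter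
    ((isOpen_sector _ _ _).measurableSet.symmDiff (isOpen_sector _ _ _).measurableSet)) hK hKfin
      (Eventually.of_forall fun i => inter_subset_left) ?_
  filter_upwards [ae_eventually_mem_sector_iff hs hh hφ hh₀] with z hz
  filter_upwards [hz] with i hi
  refine iff_of_false (fun h' => ?_) (notMem_empty z)
  rcases h'.2 with ⟨h1, h2⟩ | ⟨h1, h2⟩
  · exact h2 (hi.1 h1)
  · exact h2 (hi.2 h1)

/-- The endpoints of an arc have no length. -/
theorem hausdorffMeasure_inter_closedArc (hh₀ : 0 < h₀) (s₀ φ₀ : ℝ) (U : Set Plane) :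
    Measure.hausdorffMeasure 1 (U ∩ closedArc s₀ h₀ φ₀)
      = Measure.hausdorffMeasure 1 (U ∩ openArc s₀ h₀ φ₀) := by
  have hsub : U ∩ closedArc s₀ h₀ φ₀ ⊆ U ∩ openArc s₀ h₀ φ₀ ∪ {!₂[h₀, s₀], !₂[-h₀, s₀]} := by
    rintro z ⟨hzU, hz1, hz2⟩
    rcases hz2.lt_or_eq with hz2 | hz2
    · exact Or.inl ⟨hzU, hz1, hz2⟩
    · refine Or.inr (eq_or_eq_of_arcFn_eq_zero hh₀ ?_ hz1 hz2)
      rw [add_sub_cancel_left]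
      exact sin_two_pi_div_three_ne_zero
  have h0 : Measure.hausdorffMeasure 1 ({!₂[h₀, s₀], !₂[-h₀, s₀]} : Set Plane) = 0 := by
    have := Measure.nullSingletonClass_hausdorff Plane (d := 1) one_pos
    exact (toFinite _).measure_zero _
  refine le_antisymm ((measure_mono hsub).trans ((measure_union_le _ _).trans ?_))
    (measure_mono (inter_subset_inter_right _ (openArc_subset_closedArc _ _ _)))
  rw [h0, add_zero]

theorem openArc_eq_inter (s h φ : ℝ) (U : Set Plane) :
    U ∩ openArc s h φ
      = (U ∩ {z | arcFn s h (φ + 2 * π / 3) z < 0}) ∩ {z | arcFn s h φ z = 0} := by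
  ext z; simp only [openArc, mem_inter_iff, mem_ofPred_eq]; tauto

theorem hausdorffMeasure_inter_openArc_of_sin_ne_zero {s h φ : ℝ} (hh : 0 < h) (hφ : sin φ ≠ 0)
    {U : Set Plane} (hU : IsOpen U) :
    Measure.hausdorffMeasure 1 (U ∩ openArc s h φ)
      = volume (Ioc (-(π * arcRadius h φ)) (π * arcRadius h φ) ∩
        circleCurve (arcCenter s h φ) (arcRadius h φ) (-(π / 2)) ⁻¹'
          (U ∩ {z | arcFn s h (φ + 2 * π / 3) z < 0})) := by
  rw [openArc_eq_inter, setOf_arcFn_eq_zero_of_sin_ne_zero hh hφ,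
    hausdorffMeasure_inter_sphere _ (arcRadius_pos hh hφ) (-(π / 2))]
  exact hU.measurableSet.inter (isOpen_lt (continuous_arcFn _ _ _) continuous_const).measurableSet

/-- Lower semicontinuity of the length of an arc in an open set, when the parametrized arcs
converge pointwise to a parametrized arc. Parameter `0` is the lowest point of the circle: for
the outer circle of a normalized double bubble this is the origin, whatever the radius. -/
theorem volume_le_liminf_openArc [l.IsCountablyGenerated] (hs : Tendsto s l (𝓝 s₀))
    (hh : Tendsto h l (𝓝 h₀)) (hφ : Tendsto φ l (𝓝 φ₀)) (hh₀ : 0 < h₀)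
    (hsin : ∀ᶠ i in l, sin (φ i) ≠ 0) {U : Set Plane} (hU : IsOpen U) {I : Set ℝ}
    (hI : MeasurableSet I) {γ : ℝ → Plane} (hγ : Continuous γ)
    (hIlim : ∀ t ∈ I, ∀ᶠ i in l,
      t ∈ Ioc (-(π * arcRadius (h i) (φ i))) (π * arcRadius (h i) (φ i)))
    (hlim : ∀ t ∈ I, Tendsto (fun i => circleCurve (arcCenter (s i) (h i) (φ i))
      (arcRadius (h i) (φ i)) (-(π / 2)) t) l (𝓝 (γ t))) :
    volume (I ∩ γ ⁻¹' (U ∩ {z | arcFn s₀ h₀ (φ₀ + 2 * π / 3) z < 0}))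
      ≤ liminf (fun i => Measure.hausdorffMeasure 1 (U ∩ openArc (s i) (h i) (φ i))) l := by
  have hopen : ∀ s h φ : ℝ, IsOpen (U ∩ {z | arcFn s h φ z < 0}) := fun s h φ =>
    hU.inter (isOpen_lt (continuous_arcFn _ _ _) continuous_const)
  refine (measure_le_liminf_of_forall_ae (l := l) (C := fun i =>
    Ioc (-(π * arcRadius (h i) (φ i))) (π * arcRadius (h i) (φ i)) ∩
        circleCurve (arcCenter (s i) (h i) (φ i)) (arcRadius (h i) (φ i)) (-(π / 2)) ⁻¹'
          (U ∩ {z | arcFn (s i) (h i) (φ i + 2 * π / 3) z < 0}))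
    (hI.inter (hγ.measurable (hopen _ _ _).measurableSet)) (fun i => measurableSet_Ioc.inter
      ((continuous_circleCurve _ _ _).measurable (hopen _ _ _).measurableSet))
    (Eventually.of_forall ?_)).trans_eq (liminf_congr ?_)
  · rintro t ⟨htI, htU, htφ⟩
    filter_upwards [hIlim t htI, (hlim t htI).eventually (hU.mem_nhds htU),
      (tendsto_arcFn hs hh (hφ.add_const (2 * π / 3)) (hlim t htI)).eventually
        (gt_mem_nhds htφ)] with i h1 h2 h3
    exact ⟨h1, h2, h3⟩
  · filter_upwards [hsin, hh.eventually (lt_mem_nhds hh₀)] with i h1 h2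
    exact (hausdorffMeasure_inter_openArc_of_sin_ne_zero h2 h1 hU).symm

/-- Arcs of circles converging to an arc of a circle. -/
theorem hausdorffMeasure_le_liminf_openArc_of_sin_ne_zero [l.IsCountablyGenerated]
    (hs : Tendsto s l (𝓝 s₀)) (hh : Tendsto h l (𝓝 h₀)) (hφ : Tendsto φ l (𝓝 φ₀)) (hh₀ : 0 < h₀)
    (hsin : sin φ₀ ≠ 0) {U : Set Plane} (hU : IsOpen U) :
    Measure.hausdorffMeasure 1 (U ∩ openArc s₀ h₀ φ₀)
      ≤ liminf (fun i => Measure.hausdorffMeasure 1 (U ∩ openArc (s i) (h i) (φ i))) l := by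
  have hr₀ := arcRadius_pos hh₀ hsin
  have hsinlim : Tendsto (fun i => sin (φ i)) l (𝓝 (sin φ₀)) :=
    (continuous_sin.tendsto φ₀).comp hφ
  have hr : Tendsto (fun i => arcRadius (h i) (φ i)) l (𝓝 (arcRadius h₀ φ₀)) :=
    hh.div hsinlim.abs (abs_ne_zero.2 hsin)
  have hcen : Tendsto (fun i => s i - h i * cos (φ i) / sin (φ i)) l
      (𝓝 (s₀ - h₀ * cos φ₀ / sin φ₀)) :=
    hs.sub ((hh.mul ((continuous_cos.tendsto φ₀).comp hφ)).div hsinlim hsin)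
  have hae : volume (Ioc (-(π * arcRadius h₀ φ₀)) (π * arcRadius h₀ φ₀) ∩
        circleCurve (arcCenter s₀ h₀ φ₀) (arcRadius h₀ φ₀) (-(π / 2)) ⁻¹'
          (U ∩ {z | arcFn s₀ h₀ (φ₀ + 2 * π / 3) z < 0}))
      = volume (Ioo (-(π * arcRadius h₀ φ₀)) (π * arcRadius h₀ φ₀) ∩
        circleCurve (arcCenter s₀ h₀ φ₀) (arcRadius h₀ φ₀) (-(π / 2)) ⁻¹'
          (U ∩ {z | arcFn s₀ h₀ (φ₀ + 2 * π / 3) z < 0})) :=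
    measure_congr (Ioo_ae_eq_Ioc.symm.inter (ae_eq_refl _))
  rw [hausdorffMeasure_inter_openArc_of_sin_ne_zero hh₀ hsin hU, hae]
  refine volume_le_liminf_openArc hs hh hφ hh₀ (hsinlim.eventually_ne hsin) hU measurableSet_Ioo
    (continuous_circleCurve _ _ _) (fun t ht => ?_) (fun t ht => ?_)
  · have hπr := hr.const_mul π
    filter_upwards [hπr.eventually (lt_mem_nhds ht.2), hπr.neg.eventually (gt_mem_nhds ht.1)]
      with i h1 h2
    exact ⟨h2, h1.le⟩
  · have hang : Tendsto (fun i => t / arcRadius (h i) (φ i) + -(π / 2)) l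
        (𝓝 (t / arcRadius h₀ φ₀ + -(π / 2))) :=
      (tendsto_const_nhds.div hr hr₀.ne').add_const _
    refine tendsto_plane ?_ ?_
    · simp only [circleCurve_zero]
      exact tendsto_const_nhds.add (hr.mul ((continuous_cos.tendsto _).comp hang))
    · simp only [circleCurve_one]
      exact hcen.add (hr.mul ((continuous_sin.tendsto _).comp hang))

/-- Arcs of circles of large radius, tangent to the `x`-axis at the origin, converging to the two
half-lines which are the arc of direction `π`. -/
theorem hausdorffMeasure_le_liminf_openArc_pi [l.IsCountablyGenerated] (hs : Tendsto s l (𝓝 0))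
    (hh : Tendsto h l (𝓝 h₀)) (hφ : Tendsto φ l (𝓝 π)) (hh₀ : 0 < h₀)
    (hsin : ∀ᶠ i in l, 0 < sin (φ i))
    (hcen : ∀ᶠ i in l, arcCenter (s i) (h i) (φ i) = !₂[0, arcRadius (h i) (φ i)])
    {U : Set Plane} (hU : IsOpen U) :
    Measure.hausdorffMeasure 1 (U ∩ openArc 0 h₀ π)
      ≤ liminf (fun i => Measure.hausdorffMeasure 1 (U ∩ openArc (s i) (h i) (φ i))) l := by
  have hr : Tendsto (fun i => arcRadius (h i) (φ i)) l atTop := by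
    have h1 : Tendsto (fun i => |sin (φ i)|) l (𝓝[>] 0) := by
      refine tendsto_nhdsWithin_iff.2 ⟨?_, hsin.mono fun i hi => abs_pos.2 hi.ne'⟩
      have := ((continuous_sin.tendsto π).comp hφ).abs
      rwa [sin_pi, abs_zero] at this
    exact hh.pos_mul_atTop hh₀ (tendsto_inv_nhdsGT_zero.comp h1)
  rw [openArc_eq_inter, setOf_arcFn_eq_zero_of_sin_eq_zero hh₀ sin_pi,
    hausdorffMeasure_inter_line, ← univ_inter (lineCurve 0 ⁻¹' _)]
  refine volume_le_liminf_openArc hs hh hφ hh₀ (hsin.mono fun i hi => hi.ne') hU .univ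
    (continuous_lineCurve 0) (fun t _ => ?_) (fun t _ => ?_)
  · have hπr := hr.const_mul_atTop pi_pos
    filter_upwards [hπr.eventually_gt_atTop |t|] with i hi
    exact ⟨(abs_lt.1 hi).1, (abs_lt.1 hi).2.le⟩
  · have hq : Tendsto (fun i => t / arcRadius (h i) (φ i)) l (𝓝 0) := hr.const_div_atTop t
    have hx : Tendsto (fun i => t * sinc (t / arcRadius (h i) (φ i))) l (𝓝 t) := by
      have := ((continuous_sinc.tendsto 0).comp hq).const_mul t
      rwa [sinc_zero, mul_one] at this
    have hy : Tendsto (fun i => arcRadius (h i) (φ i)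
        - arcRadius (h i) (φ i) * cos (t / arcRadius (h i) (φ i))) l (𝓝 0) := by
      have hb : Tendsto (fun i => t ^ 2 / 2 / arcRadius (h i) (φ i)) l (𝓝 0) :=
        hr.const_div_atTop _
      refine squeeze_zero' ?_ ?_ hb
      · filter_upwards [hr.eventually_gt_atTop 0] with i hi
        nlinarith [cos_le_one (t / arcRadius (h i) (φ i))]
      · filter_upwards [hr.eventually_gt_atTop 0] with i hi
        have := one_sub_sq_div_two_le_cos (x := t / arcRadius (h i) (φ i))
        have h2 := mul_le_mul_of_nonneg_left this hi.le
        have h3 : arcRadius (h i) (φ i) * (1 - (t / arcRadius (h i) (φ i)) ^ 2 / 2)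
          = arcRadius (h i) (φ i) - t ^ 2 / 2 / arcRadius (h i) (φ i) := by field_simp
        linarith
    refine tendsto_plane ?_ ?_
    · rw [lineCurve_zero]
      refine hx.congr' ?_
      filter_upwards [hcen, hr.eventually_gt_atTop 0] with i hi hri
      rw [circleCurve_zero, ← sub_eq_add_neg, cos_sub_pi_div_two, hi]
      rcases eq_or_ne t 0 with rfl | ht
      · simp
      · rw [sinc_of_ne_zero (by positivity)]
        simp
        field_simp
    · rw [lineCurve_one]
      refine hy.congr' ?_
      filter_upwards [hcen] with i hi
      rw [circleCurve_one, ← sub_eq_add_neg, sin_sub_pi_div_two, hi]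
      simp
      ring

end Limits

/-! ### Areas of sectors -/

theorem volume_sector {h : ℝ} (hh : 0 < h) (s φ : ℝ) :
    volume (sector s h φ) = ENNReal.ofReal (h ^ 2) * volume (sector 0 1 φ) := by
  have harc : ∀ ψ z, arcFn s h ψ z = h ^ 2 * arcFn 0 1 ψ (h⁻¹ • (z - !₂[0, s])) := by
    intro ψ z
    simp [arcFn]
    field_simp
  have e : sector s h φ
      = (fun z => z - !₂[0, s]) ⁻¹' ((fun z => h⁻¹ • z) ⁻¹' sector 0 1 φ) := by
    ext z
    simp only [sector, mem_preimage, mem_ofPred_eq, harc]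
    rw [mul_pos_iff_of_pos_left (by positivity), ← neg_pos, ← mul_neg,
      mul_pos_iff_of_pos_left (by positivity), neg_pos]
  rw [e]
  simp only [sub_eq_add_neg]
  rw [measure_preimage_add_right, Measure.addHaar_preimage_smul _ (inv_ne_zero hh.ne')]
  congr 2
  rw [finrank_euclideanSpace_fin, inv_pow, inv_inv, abs_of_pos (by positivity)]

theorem sector_subset_ball_of_sin_neg {s h φ : ℝ} (hh : 0 < h) (hφ : sin φ < 0) :
    sector s h φ ⊆ Metric.ball (arcCenter s h φ) (arcRadius h φ) :=
  fun _ hz => (arcFn_pos_iff_of_sin_neg hh hφ).1 hz.1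

theorem sector_subset_ball_of_sin_pos {s h φ : ℝ} (hh : 0 < h) (hφ : 0 < sin (φ + 2 * π / 3)) :
    sector s h φ ⊆ Metric.ball (arcCenter s h (φ + 2 * π / 3)) (arcRadius h (φ + 2 * π / 3)) :=
  fun _ hz => (arcFn_neg_iff_of_sin_pos hh hφ).1 hz.2

/-- Discs supporting arcs of nearby directions are uniformly bounded. -/
theorem eventually_ball_subset_ball {φ₀ : ℝ} (hφ₀ : sin φ₀ ≠ 0) : ∃ M : ℝ,
    ∀ᶠ φ in 𝓝 φ₀, Metric.ball (arcCenter 0 1 φ) (arcRadius 1 φ) ⊆ Metric.ball (0 : Plane) M := by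
  have h1 : Tendsto (fun φ => |1 * cos φ / sin φ|) (𝓝 φ₀) (𝓝 |1 * cos φ₀ / sin φ₀|) :=
    (((continuous_cos.tendsto φ₀).const_mul 1).div (continuous_sin.tendsto φ₀) hφ₀).abs
  have h2 : Tendsto (fun φ => arcRadius 1 φ) (𝓝 φ₀) (𝓝 (arcRadius 1 φ₀)) :=
    tendsto_const_nhds.div (continuous_sin.tendsto φ₀).abs (abs_ne_zero.2 hφ₀)
  refine ⟨|1 * cos φ₀ / sin φ₀| + arcRadius 1 φ₀ + 1, ?_⟩
  filter_upwards [(h1.add h2).eventually (gt_mem_nhds (lt_add_one _))] with φ hφ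
  refine Metric.ball_subset_ball' ?_
  have : dist (arcCenter 0 1 φ) 0 = |1 * cos φ / sin φ| := by
    rw [← sq_eq_sq₀ dist_nonneg (abs_nonneg _), dist_plane_sq, sq_abs]
    simp [arcCenter]
  rw [this, add_comm]
  exact hφ.le

theorem eventually_sector_subset_ball {φ₀ : ℝ} (h1 : -π < φ₀) (h2 : φ₀ < π / 3) : ∃ M : ℝ,
    ∀ᶠ φ in 𝓝 φ₀, sector 0 1 φ ⊆ Metric.ball (0 : Plane) M := by
  rcases lt_or_ge φ₀ 0 with h0 | h0
  · have hs : sin φ₀ < 0 := sin_neg_of_neg_of_neg_pi_lt h0 h1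
    obtain ⟨M, hM⟩ := eventually_ball_subset_ball hs.ne
    refine ⟨M, ?_⟩
    filter_upwards [hM, (continuous_sin.tendsto φ₀).eventually (gt_mem_nhds hs)] with φ hφ hφs
    exact (sector_subset_ball_of_sin_neg one_pos hφs).trans hφ
  · have hs : 0 < sin (φ₀ + 2 * π / 3) :=
      sin_pos_of_pos_of_lt_pi (by linarith [pi_pos]) (by linarith)
    obtain ⟨M, hM⟩ := eventually_ball_subset_ball hs.ne'
    have hadd : Tendsto (fun φ => φ + 2 * π / 3) (𝓝 φ₀) (𝓝 (φ₀ + 2 * π / 3)) :=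
      (continuous_add_const _).tendsto _
    refine ⟨M, ?_⟩
    filter_upwards [hadd.eventually hM, ((continuous_sin.tendsto _).comp hadd).eventually
      (lt_mem_nhds hs)] with φ hφ hφs
    exact (sector_subset_ball_of_sin_pos one_pos hφs).trans hφ

theorem volume_sector_lt_top {φ : ℝ} (h1 : -π < φ) (h2 : φ < π / 3) :
    volume (sector 0 1 φ) < ∞ := by
  obtain ⟨M, hM⟩ := eventually_sector_subset_ball h1 h2
  exact (measure_mono hM.self_of_nhds).trans_lt measure_ball_lt_top

/-- The area of a bounded sector depends continuously on the direction. -/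
theorem continuousAt_volume_sector {φ₀ : ℝ} (h1 : -π < φ₀) (h2 : φ₀ < π / 3) :
    ContinuousAt (fun φ => volume (sector 0 1 φ)) φ₀ := by
  obtain ⟨M, hM⟩ := eventually_sector_subset_ball h1 h2
  exact tendsto_measure_of_ae_tendsto_indicator (𝓝 φ₀) (isOpen_sector _ _ _).measurableSet
    (fun φ => (isOpen_sector _ _ _).measurableSet) Metric.isOpen_ball.measurableSet
    measure_ball_lt_top.ne hM (ae_eventually_mem_sector_iff tendsto_const_nhds tendsto_const_nhds
      tendsto_id one_pos)

theorem lowerSemicontinuous_volume_sector : LowerSemicontinuous fun φ => volume (sector 0 1 φ) :=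
  fun _ _ hc => eventually_lt_measure_of_forall_ae (isOpen_sector _ _ _).measurableSet
    (fun _ => (isOpen_sector _ _ _).measurableSet) (Eventually.of_forall fun _ hz =>
      eventually_mem_sector tendsto_const_nhds tendsto_const_nhds tendsto_id hz) hc

theorem volume_sector_pos {φ : ℝ} (h1 : -π ≤ φ) (h2 : φ ≤ π / 3) :
    0 < volume (sector 0 1 φ) := by
  have hπ := pi_pos
  refine (isOpen_sector 0 1 φ).measure_pos _ ⟨!₂[0, tan ((φ + π / 3) / 2)], ?_⟩
  -- the middle point of the arc of direction `φ + π / 3`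
  have hc : 0 < cos ((φ + π / 3) / 2) :=
    cos_pos_of_mem_Ioo ⟨by linarith, by linarith⟩
  have harc : ∀ ψ, arcFn 0 1 ψ !₂[0, tan ((φ + π / 3) / 2)]
      = sin (φ + π / 3 - ψ) / cos ((φ + π / 3) / 2) ^ 2 := by
    intro ψ
    obtain ⟨x, hx⟩ : ∃ x, x = (φ + π / 3) / 2 := ⟨_, rfl⟩
    rw [show φ + π / 3 - ψ = 2 * x - ψ by rw [hx]; ring, ← hx, sin_sub, sin_two_mul, cos_two_mul',
      tan_eq_sin_div_cos]
    rw [← hx] at hc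
    simp [arcFn]
    field_simp
    ring
  have h3 : 0 < sin (π / 3) := sin_pos_of_pos_of_lt_pi (by linarith) (by linarith)
  constructor
  · rw [harc, add_sub_cancel_left]
    positivity
  · rw [harc, show φ + π / 3 - (φ + 2 * π / 3) = -(π / 3) by ring, sin_neg]
    exact div_neg_of_neg_of_pos (by linarith) (by positivity)

theorem volume_setOf_eq_top_of_forall {S : Set Plane} {I : Set ℝ} (hI : volume I = ∞)
    (hS : ∀ z : Plane, z 1 ∈ I → z ∈ S) : volume S = ∞ := by
  rw [eq_top_iff, volume_plane_eq]
  have : volume ((univ : Set ℝ) ×ˢ I) = ∞ := by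
    rw [Measure.volume_eq_prod, Measure.prod_prod, hI, Real.volume_univ, ENNReal.top_mul_top]
  rw [← this]
  refine measure_mono fun p hp => hS _ ?_
  simpa using hp.2

theorem volume_sector_pi_div_three : volume (sector 0 1 (π / 3)) = ∞ := by
  refine volume_setOf_eq_top_of_forall (I := Ioi 1) Real.volume_Ioi fun z hz => ?_
  have h3 : 0 < √3 := by positivity
  have hz : 1 < z 1 := hz
  constructor
  · simp only [arcFn, sin_pi_div_three, cos_pi_div_three]
    have : 0 < z 0 ^ 2 + (z 1 - 0) ^ 2 - 1 ^ 2 := by nlinarith [sq_nonneg (z 0)]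
    have := mul_pos h3 this
    linarith
  · rw [show π / 3 + 2 * π / 3 = π by ring]
    simp only [arcFn, sin_pi, cos_pi]
    linarith

theorem volume_sector_neg_pi : volume (sector 0 1 (-π)) = ∞ := by
  refine volume_setOf_eq_top_of_forall (I := Iio (-1)) Real.volume_Iio fun z hz => ?_
  have h3 : 0 < √3 := by positivity
  have hz : z 1 < -1 := hz
  constructor
  · simp only [arcFn, sin_neg, cos_neg, sin_pi, cos_pi]
    linarith
  · rw [show -π + 2 * π / 3 = -(π / 3) by ring]
    simp only [arcFn, sin_neg, cos_neg, sin_pi_div_three, cos_pi_div_three]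
    have : 0 < z 0 ^ 2 + (z 1 - 0) ^ 2 - 1 ^ 2 := by nlinarith [sq_nonneg (z 0)]
    have := mul_pos h3 this
    linarith

theorem volume_sector_pi : volume (sector 0 1 π) = ∞ := by
  have := sector_add_four_pi_div_three 0 1 (-(π / 3))
  rw [show -(π / 3) + 2 * π / 3 + 2 * π / 3 = π by ring,
    show -(π / 3) - 2 * π / 3 = -π by ring] at this
  rw [this, volume_sector_neg_pi]

theorem volume_sector_lens :
    ENNReal.ofReal ((√3 / 2 * lensRadius) ^ 2) * volume (sector 0 1 (π / 3 - 2 * π / 3)) = 1 := by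
  rw [← volume_sector lensWidth_pos 0, ← volume_lens]
  exact (measure_congr (lensCluster_ae_eq 0)).symm

/-- Every ratio of areas is attained: the ratio of the areas of two adjacent sectors is continuous
in the direction and runs from `0` to `∞`. -/
theorem exists_volume_sector_eq_mul {A : ℝ} (hA : 0 < A) : ∃ φ : ℝ, -(π / 3) < φ ∧ φ < π / 3 ∧
    volume (sector 0 1 φ) = ENNReal.ofReal A * volume (sector 0 1 (φ - 2 * π / 3)) := by
  have hπ := pi_pos
  set V : ℝ → ℝ≥0∞ := fun φ => volume (sector 0 1 φ) with hV
  have hVfin : ∀ φ, -π < φ → φ < π / 3 → V φ ≠ ∞ := fun φ h1 h2 => (volume_sector_lt_top h1 h2).ne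
  have hmid : V (-(π / 3)) ≠ ∞ := hVfin _ (by linarith) (by linarith)
  have hcont : ContinuousAt V (-(π / 3)) := continuousAt_volume_sector (by linarith) (by linarith)
  have hlt : V (-(π / 3)) < V (-(π / 3)) + 1 := ENNReal.lt_add_right hmid one_ne_zero
  -- near the right end the second area is as large as we please
  obtain ⟨b, hb1, hb2, hb3⟩ : ∃ b, -(π / 3) < b ∧ b < π / 3 ∧
      ENNReal.ofReal A * V (b - 2 * π / 3) ≤ V b := by
    have hc1 : ENNReal.ofReal A * (V (-(π / 3)) + 1) < V (π / 3) := by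
      simp only [hV, volume_sector_pi_div_three]
      exact ENNReal.mul_lt_top ENNReal.ofReal_lt_top (ENNReal.add_lt_top.2 ⟨hmid.lt_top, by simp⟩)
    have e1 : ∀ᶠ φ in 𝓝[<] (π / 3), ENNReal.ofReal A * (V (-(π / 3)) + 1) < V φ :=
      nhdsWithin_le_nhds (lowerSemicontinuous_volume_sector (π / 3) _ hc1)
    have ht : Tendsto (fun φ => φ - 2 * π / 3) (𝓝[<] (π / 3)) (𝓝 (-(π / 3))) := by
      have : Tendsto (fun φ : ℝ => φ - 2 * π / 3) (𝓝 (π / 3)) (𝓝 (π / 3 - 2 * π / 3)) :=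
        (continuous_sub_right _).tendsto _
      rw [show π / 3 - 2 * π / 3 = -(π / 3) by ring] at this
      exact this.mono_left nhdsWithin_le_nhds
    have e2 := (hcont.tendsto.comp ht).eventually (gt_mem_nhds hlt)
    obtain ⟨b, h1, h2, h3⟩ := (e1.and (e2.and
      (Ioo_mem_nhdsLT (show -(π / 3) < π / 3 by linarith)))).exists
    exact ⟨b, h3.1, h3.2, (mul_le_mul_right (le_of_lt h2) _).trans h1.le⟩
  -- near the left end the first area is as large as we please
  obtain ⟨a, ha1, ha2, ha3⟩ : ∃ a, -(π / 3) < a ∧ a < π / 3 ∧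
      V a ≤ ENNReal.ofReal A * V (a - 2 * π / 3) := by
    have hc1 : (V (-(π / 3)) + 1) / ENNReal.ofReal A < V (-π) := by
      simp only [hV, volume_sector_neg_pi]
      exact ENNReal.div_lt_top (ENNReal.add_lt_top.2 ⟨hmid.lt_top, by simp⟩).ne (by simpa using hA)
    have ht : Tendsto (fun φ => φ - 2 * π / 3) (𝓝[>] (-(π / 3))) (𝓝 (-π)) := by
      have : Tendsto (fun φ : ℝ => φ - 2 * π / 3) (𝓝 (-(π / 3))) (𝓝 (-(π / 3) - 2 * π / 3)) :=
        (continuous_sub_right _).tendsto _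
      rw [show -(π / 3) - 2 * π / 3 = -π by ring] at this
      exact this.mono_left nhdsWithin_le_nhds
    have e1 := ht.eventually (lowerSemicontinuous_volume_sector (-π) _ hc1)
    have e2 : ∀ᶠ φ in 𝓝[>] (-(π / 3)), V φ < V (-(π / 3)) + 1 :=
      nhdsWithin_le_nhds (hcont.tendsto.eventually (gt_mem_nhds hlt))
    obtain ⟨a, h1, h2, h3⟩ := (e1.and (e2.and
      (Ioo_mem_nhdsGT (show -(π / 3) < π / 3 by linarith)))).exists
    refine ⟨a, h3.1, h3.2, h2.le.trans ?_⟩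
    rw [mul_comm]
    exact (ENNReal.div_le_iff (by simpa using hA) ENNReal.ofReal_ne_top).1 h1.le
  have hsub : uIcc a b ⊆ Ioo (-(π / 3)) (π / 3) :=
    OrdConnected.uIcc_subset ordConnected_Ioo ⟨ha1, ha2⟩ ⟨hb1, hb2⟩
  have hcontOn : ContinuousOn (fun φ => (V φ).toReal - A * (V (φ - 2 * π / 3)).toReal)
      (uIcc a b) := by
    intro φ hφ
    obtain ⟨h1, h2⟩ := hsub hφ
    refine ContinuousAt.continuousWithinAt
      (ContinuousAt.sub ?_ (ContinuousAt.mul continuousAt_const ?_))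
    · exact (ENNReal.tendsto_toReal (hVfin φ (by linarith) h2)).comp
        (continuousAt_volume_sector (by linarith) h2)
    · refine (ENNReal.tendsto_toReal (hVfin (φ - 2 * π / 3) (by linarith) (by linarith))).comp ?_
      have h3 : ContinuousAt V (φ - 2 * π / 3) :=
        continuousAt_volume_sector (by linarith) (by linarith)
      exact h3.tendsto.comp ((continuous_sub_right _).tendsto φ)
  have key : ∀ φ, -(π / 3) < φ → φ < π / 3 → (ENNReal.ofReal A * V (φ - 2 * π / 3)).toReal
      = A * (V (φ - 2 * π / 3)).toReal := fun φ _ _ => by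
    rw [ENNReal.toReal_mul, ENNReal.toReal_ofReal hA.le]
  have hne : ∀ φ, -(π / 3) < φ → φ < π / 3 → ENNReal.ofReal A * V (φ - 2 * π / 3) ≠ ∞ :=
    fun φ h1 h2 => ENNReal.mul_ne_top ENNReal.ofReal_ne_top (hVfin _ (by linarith) (by linarith))
  obtain ⟨φ, hφ, h0⟩ := intermediate_value_uIcc hcontOn (show (0 : ℝ) ∈ _ from by
    refine mem_uIcc.2 (Or.inl ⟨?_, ?_⟩)
    · rw [sub_nonpos, ← key a ha1 ha2]
      exact ENNReal.toReal_mono (hne a ha1 ha2) ha3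
    · rw [sub_nonneg, ← key b hb1 hb2]
      exact ENNReal.toReal_mono (hVfin b (by linarith) hb2) hb3)
  obtain ⟨h1, h2⟩ := hsub hφ
  refine ⟨φ, h1, h2, ?_⟩
  simp only [sub_eq_zero] at h0
  rw [← key φ h1 h2] at h0
  exact (ENNReal.toReal_eq_toReal_iff' (hVfin φ (by linarith) h2) (hne φ h1 h2)).1 h0

/-- When the ratio of the areas tends to infinity, the direction of the middle arc tends to
`π / 3`. -/
theorem tendsto_direction {φ : ℝ → ℝ} (h1 : ∀ A, 0 < A → -(π / 3) < φ A)
    (h2 : ∀ A, 0 < A → φ A < π / 3)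
    (h3 : ∀ A, 0 < A → volume (sector 0 1 (φ A))
      = ENNReal.ofReal A * volume (sector 0 1 (φ A - 2 * π / 3))) :
    Tendsto φ atTop (𝓝 (π / 3)) := by
  have hπ := pi_pos
  rw [tendsto_order]
  refine ⟨fun c hc => ?_, fun c hc => ?_⟩
  · set d := max c 0
    have hd : d < π / 3 := max_lt hc (by linarith)
    have hd0 : 0 ≤ d := le_max_right _ _
    -- for directions up to `d` the numerator is bounded above and the denominator below
    obtain ⟨x, hx, hxmax⟩ := isCompact_Icc.exists_isMaxOn (nonempty_Icc.2 (by linarith : -(π / 3) ≤ d))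
      (f := fun φ => volume (sector 0 1 φ)) (fun φ hφ =>
        (continuousAt_volume_sector (by linarith [hφ.1]) (by linarith [hφ.2])).continuousWithinAt)
    obtain ⟨y, hy, hymin⟩ := (lowerSemicontinuous_volume_sector.lowerSemicontinuousOn
      (Icc (-π) (-(π / 3)))).exists_isMinOn (nonempty_Icc.2 (by linarith)) isCompact_Icc
    have hxfin := (volume_sector_lt_top (φ := x) (by linarith [hx.1]) (by linarith [hx.2])).ne
    have hypos := volume_sector_pos hy.1 (by linarith [hy.2] : y ≤ π / 3)
    have hq : volume (sector 0 1 x) / volume (sector 0 1 y) ≠ ∞ :=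
      (ENNReal.div_lt_top hxfin hypos.ne').ne
    filter_upwards [eventually_gt_atTop 0,
      eventually_gt_atTop (volume (sector 0 1 x) / volume (sector 0 1 y)).toReal] with A hA hAq
    by_contra hcon
    rw [not_lt] at hcon
    have hx' : volume (sector 0 1 (φ A)) ≤ volume (sector 0 1 x) :=
      hxmax ⟨(h1 A hA).le, hcon.trans (le_max_left _ _)⟩
    have hy' : volume (sector 0 1 y) ≤ volume (sector 0 1 (φ A - 2 * π / 3)) :=
      hymin ⟨by linarith [h1 A hA], by linarith [h2 A hA]⟩
    rw [h3 A hA] at hx'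
    have hle : ENNReal.ofReal A ≤ volume (sector 0 1 x) / volume (sector 0 1 y) := by
      rw [ENNReal.le_div_iff_mul_le (Or.inl hypos.ne') (Or.inr hxfin)]
      exact (mul_le_mul_right hy' _).trans hx'
    exact absurd ((ENNReal.ofReal_le_iff_le_toReal hq).1 hle) (not_le.2 hAq)
  · filter_upwards [eventually_gt_atTop 0] with A hA
    exact (h2 A hA).trans hc

/-! ### Normalized double bubbles -/

theorem volume_sector_add_two_pi_div_three {s h φ : ℝ} (hh : 0 < h) (h1 : -(π / 3) < φ)
    (h2 : φ < π / 3) : volume (sector s h (φ + 2 * π / 3)) = ∞ := by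
  rw [volume_sector hh, ENNReal.mul_eq_top]
  refine Or.inl ⟨(ENNReal.ofReal_pos.2 (pow_pos hh 2)).ne', ?_⟩
  have hπ := pi_pos
  by_contra htop
  have h0 := (volume_sector_lt_top (φ := φ - 2 * π / 3) (by linarith) (by linarith)).ne
  have h1' := (volume_sector_lt_top (φ := φ) (by linarith) h2).ne
  have huniv : volume (univ : Set Plane)
      ≤ volume (sectorCluster 0 1 φ 0 ∪ sectorCluster 0 1 φ 1 ∪ sectorCluster 0 1 φ 2) := by
    refine measure_mono_ae ?_
    filter_upwards [ae_arcFn_ne_zero one_pos 0 φ, ae_arcFn_ne_zero one_pos 0 (φ - 2 * π / 3),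
      ae_arcFn_ne_zero one_pos 0 (φ + 2 * π / 3)] with z hb ha hc _
    have hsum := arcFn_sum 0 1 φ z
    change (z ∈ sectorCluster 0 1 φ 0 ∨ z ∈ sectorCluster 0 1 φ 1) ∨ z ∈ sectorCluster 0 1 φ 2
    rw [mem_sectorCluster_zero, mem_sectorCluster_one, mem_sectorCluster_two]
    rcases lt_or_gt_of_ne ha with ha | ha <;> rcases lt_or_gt_of_ne hb with hb | hb <;>
      rcases lt_or_gt_of_ne hc with hc | hc <;> first | tauto | (exfalso; linarith)
  refine absurd (huniv.trans_lt (c := ∞) ?_) (by simp)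
  refine (measure_union_le _ _).trans_lt (ENNReal.add_lt_top.2
    ⟨(measure_union_le _ _).trans_lt (ENNReal.add_lt_top.2 ⟨?_, ?_⟩), ?_⟩)
  · exact h0.lt_top
  · exact h1'.lt_top
  · exact lt_top_iff_ne_top.2 htop

/-- The parameters of a normalized double bubble: the half-width `h` of the chord joining the
triple junctions and the direction `φ` of the middle arc are determined by the two areas, and the
height of the chord by the tangency to the `x`-axis. -/
theorem IsNormalizedDoubleBubble.exists_parameters {A : ℝ} {D : Fin 3 → Set Plane}
    (hD : IsNormalizedDoubleBubble A D) : ∃ s h φ : ℝ, 0 < h ∧ -(π / 3) < φ ∧ φ < π / 3 ∧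
      s = h * (sin (φ + 2 * π / 3) / (1 - cos (φ + 2 * π / 3))) ∧
      arcCenter s h (φ + 2 * π / 3) = !₂[0, arcRadius h (φ + 2 * π / 3)] ∧
      (∀ j, D j =ᵐ[volume] sectorCluster s h φ j) ∧
      volume (D 0) = 1 ∧ volume (D 1) = ENNReal.ofReal A ∧ volume (D 2) = ∞ := by
  obtain ⟨s, h, φ, φ₁, φ₂, hh, ⟨h1, -⟩, ⟨-, h2⟩, e1, e2, hDeq, harea, ρ, -, hc, rfl⟩ := hD
  obtain rfl : φ₁ = φ - 2 * π / 3 := by linarith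
  obtain rfl : φ₂ = φ + 2 * π / 3 := by linarith
  have l1 : -(π / 3) < φ := by linarith
  have l2 : φ < π / 3 := by linarith
  refine ⟨s, h, φ, hh, l1, l2, ?_, hc, fun j => ?_, congrFun harea 0, congrFun harea 1,
    congrFun harea 2⟩
  · have hsin : 0 < sin (φ + 2 * π / 3) := sin_pos_of_pos_of_lt_pi (by linarith [pi_pos]) h2
    have hcos : 0 < 1 - cos (φ + 2 * π / 3) := by
      nlinarith [sin_sq_add_cos_sq (φ + 2 * π / 3), pow_pos hsin 2]
    have h3 : s - h * cos (φ + 2 * π / 3) / sin (φ + 2 * π / 3) = h / |sin (φ + 2 * π / 3)| := by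
      simpa [arcCenter, arcRadius] using congrArg (fun z : Plane => z 1) hc
    rw [abs_of_pos hsin, sub_eq_iff_eq_add] at h3
    rw [h3, ← add_div, ← mul_one_add, mul_div_assoc]
    congr 1
    rw [div_eq_div_iff hsin.ne' hcos.ne']
    linear_combination -sin_sq_add_cos_sq (φ + 2 * π / 3)
  · rw [hDeq]
    exact bubbleCluster_ae_eq hh l1 l2 j

theorem exists_isNormalizedDoubleBubble {A : ℝ} (hA : 0 < A) :
    ∃ D : Fin 3 → Set Plane, IsNormalizedDoubleBubble A D := by
  have hπ := pi_pos
  obtain ⟨φ, h1, h2, hφ⟩ := exists_volume_sector_eq_mul hA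
  have hfin := (volume_sector_lt_top (φ := φ - 2 * π / 3) (by linarith) (by linarith)).ne
  have hpos := volume_sector_pos (φ := φ - 2 * π / 3) (by linarith) (by linarith)
  set v := (volume (sector 0 1 (φ - 2 * π / 3))).toReal with hv
  have hvpos : 0 < v := ENNReal.toReal_pos hpos.ne' hfin
  have hvol : volume (sector 0 1 (φ - 2 * π / 3)) = ENNReal.ofReal v := (ENNReal.ofReal_toReal hfin).symm
  set h := √(v⁻¹) with hh_def
  have hh : 0 < h := sqrt_pos.2 (inv_pos.2 hvpos)
  have hh2 : ENNReal.ofReal (h ^ 2) * ENNReal.ofReal v = 1 := by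
    rw [← ENNReal.ofReal_mul (by positivity), hh_def, sq_sqrt (by positivity),
      inv_mul_cancel₀ hvpos.ne', ENNReal.ofReal_one]
  have hsin : 0 < sin (φ + 2 * π / 3) := sin_pos_of_pos_of_lt_pi (by linarith) (by linarith)
  set s := h * (1 + cos (φ + 2 * π / 3)) / sin (φ + 2 * π / 3) with hs
  have harea : ∀ j, volume (bubbleCluster s h φ (φ - 2 * π / 3) (φ + 2 * π / 3) j)
      = volume (sectorCluster s h φ j) := fun j => measure_congr (bubbleCluster_ae_eq hh h1 h2 j)
  refine ⟨bubbleCluster s h φ (φ - 2 * π / 3) (φ + 2 * π / 3), s, h, φ, φ - 2 * π / 3,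
    φ + 2 * π / 3, hh, ⟨by linarith, by linarith⟩, ⟨by linarith, by linarith⟩, by ring, by ring,
    rfl, funext fun j => (harea j).trans ?_, h / sin (φ + 2 * π / 3), by positivity, ?_, ?_⟩
  · fin_cases j
    · change volume (sector s h (φ - 2 * π / 3)) = 1
      rw [volume_sector hh, hvol, hh2]
    · change volume (sector s h φ) = ENNReal.ofReal A
      rw [volume_sector hh, hφ, hvol, mul_left_comm, hh2, mul_one]
    · exact volume_sector_add_two_pi_div_three hh h1 h2
  · ext i
    fin_cases i
    · simp [arcCenter]
    · simp only [arcCenter, hs]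
      change h * (1 + cos (φ + 2 * π / 3)) / sin (φ + 2 * π / 3)
        - h * cos (φ + 2 * π / 3) / sin (φ + 2 * π / 3) = h / sin (φ + 2 * π / 3)
      ring
  · rw [arcRadius, abs_of_pos hsin]

theorem IsNormalizedDoubleBubble.isCluster {A : ℝ} (hA : 0 < A) {D : Fin 3 → Set Plane}
    (hD : IsNormalizedDoubleBubble A D) : IsCluster 2 1 D := by
  obtain ⟨s, h, φ, hh, -, -, -, -, hae, v0, v1, v2⟩ := hD.exists_parameters
  refine isCluster_of_ae_eq_sectorCluster rfl hh hae (fun j hj => ?_) fun j hj => ?_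
  · fin_cases j
    · exact ⟨v0 ▸ one_pos, v0 ▸ ENNReal.one_lt_top⟩
    · exact ⟨v1 ▸ ENNReal.ofReal_pos.2 hA, v1 ▸ ENNReal.ofReal_lt_top⟩
    · exact absurd hj (by decide)
  · fin_cases j
    · exact absurd hj (by decide)
    · exact absurd hj (by decide)
    · exact v2

theorem isCluster_lensCluster : IsCluster 1 2 lensCluster := by
  have hw := lensWidth_pos
  have hw2 : ENNReal.ofReal ((√3 / 2 * lensRadius) ^ 2) ≠ 0 := 
    (ENNReal.ofReal_pos.2 (pow_pos hw 2)).ne'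
  refine isCluster_of_ae_eq_sectorCluster (N := 1) (M := 2) rfl hw lensCluster_ae_eq
    (fun j hj => ?_) fun j hj => ?_
  · fin_cases j
    · change 0 < volume lens ∧ volume lens < ∞
      rw [volume_lens]
      exact ⟨one_pos, ENNReal.one_lt_top⟩
    · exact absurd hj (by decide)
    · exact absurd hj (by decide)
  · refine (measure_congr (lensCluster_ae_eq j)).trans ?_
    fin_cases j
    · exact absurd hj (by decide)
    · change volume (sector 0 (√3 / 2 * lensRadius) (π / 3)) = ∞
      rw [volume_sector hw, volume_sector_pi_div_three, ENNReal.mul_top hw2]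
    · change volume (sector 0 (√3 / 2 * lensRadius) (π / 3 + 2 * π / 3)) = ∞
      rw [volume_sector hw, show π / 3 + 2 * π / 3 = π by ring, volume_sector_pi,
        ENNReal.mul_top hw2]

/-! ### Convergence to the lens cluster -/

/-- As `A → ∞` the parameters of normalized double bubbles converge to those of the lens. -/
theorem tendsto_parameters {s h φ : ℝ → ℝ} (hh : ∀ A, 0 < A → 0 < h A)
    (h1 : ∀ A, 0 < A → -(π / 3) < φ A) (h2 : ∀ A, 0 < A → φ A < π / 3)
    (hs : ∀ A, 0 < A →
      s A = h A * (sin (φ A + 2 * π / 3) / (1 - cos (φ A + 2 * π / 3))))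
    (hv0 : ∀ A, 0 < A → volume (sector (s A) (h A) (φ A - 2 * π / 3)) = 1)
    (hv1 : ∀ A, 0 < A → volume (sector (s A) (h A) (φ A)) = ENNReal.ofReal A) :
    Tendsto s atTop (𝓝 0) ∧ Tendsto h atTop (𝓝 (√3 / 2 * lensRadius)) ∧
      Tendsto φ atTop (𝓝 (π / 3)) := by
  have hπ := pi_pos
  have hφ : Tendsto φ atTop (𝓝 (π / 3)) := by
    refine tendsto_direction h1 h2 fun A hA => ?_
    have e0 := hv0 A hA
    have e1 := hv1 A hA
    rw [volume_sector (hh A hA)] at e0 e1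
    have hne : ENNReal.ofReal (h A ^ 2) ≠ 0 := (ENNReal.ofReal_pos.2 (pow_pos (hh A hA) 2)).ne'
    refine (ENNReal.mul_right_inj hne ENNReal.ofReal_ne_top).1 ?_
    rw [e1, mul_left_comm, e0, mul_one]
  have hφ' : Tendsto (fun A => φ A - 2 * π / 3) atTop (𝓝 (π / 3 - 2 * π / 3)) := hφ.sub_const _
  have hφ'' : Tendsto (fun A => φ A + 2 * π / 3) atTop (𝓝 π) := by
    have := hφ.add_const (2 * π / 3)
    rwa [show π / 3 + 2 * π / 3 = π by ring] at this
  have hwidth : ∀ {x ψ : ℝ}, 0 < x → ENNReal.ofReal (x ^ 2) * volume (sector 0 1 ψ) = 1 →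
      x = √((volume (sector 0 1 ψ)).toReal⁻¹) := by
    intro x ψ hx hxψ
    have := congrArg ENNReal.toReal hxψ
    rw [ENNReal.toReal_mul, ENNReal.toReal_ofReal (by positivity), ENNReal.toReal_one] at this
    rw [← eq_inv_of_mul_eq_one_left this, sqrt_sq hx.le]
  have hvpos := volume_sector_pos (φ := π / 3 - 2 * π / 3) (by linarith) (by linarith)
  have hvfin := volume_sector_lt_top (φ := π / 3 - 2 * π / 3) (by linarith) (by linarith)
  have hhlim : Tendsto h atTop (𝓝 (√3 / 2 * lensRadius)) := by
    rw [hwidth lensWidth_pos volume_sector_lens]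
    have hV : Tendsto (fun A => volume (sector 0 1 (φ A - 2 * π / 3))) atTop
        (𝓝 (volume (sector 0 1 (π / 3 - 2 * π / 3)))) :=
      (continuousAt_volume_sector (by linarith) (by linarith)).tendsto.comp hφ'
    have hlim := (((ENNReal.tendsto_toReal hvfin.ne).comp hV).inv₀
      (ENNReal.toReal_pos hvpos.ne' hvfin.ne).ne').sqrt
    refine hlim.congr' ?_
    filter_upwards [eventually_gt_atTop 0] with A hA
    exact (hwidth (hh A hA) ((volume_sector (hh A hA) _ _).symm.trans (hv0 A hA))).symm
  refine ⟨?_, hhlim, hφ⟩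
  have hcos : Tendsto (fun A => 1 - cos (φ A + 2 * π / 3)) atTop (𝓝 (1 - cos π)) :=
    ((continuous_cos.tendsto π).comp hφ'').const_sub 1
  have hlim := hhlim.mul (((continuous_sin.tendsto π).comp hφ'').div hcos
    (by rw [cos_pi]; norm_num))
  rw [sin_pi, zero_div, mul_zero] at hlim
  refine hlim.congr' ?_
  filter_upwards [eventually_gt_atTop 0] with A hA
  exact (hs A hA).symm

theorem locallyConverges_of_ae_eq_sectorCluster {ι : Type*} {l : Filter ι} [l.IsCountablyGenerated]
    {s h φ : ι → ℝ} {s₀ h₀ φ₀ : ℝ} (hs : Tendsto s l (𝓝 s₀)) (hh : Tendsto h l (𝓝 h₀))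
    (hφ : Tendsto φ l (𝓝 φ₀)) (hh₀ : 0 < h₀) {X : ι → Fin 3 → Set Plane} {Y : Fin 3 → Set Plane}
    (hX : ∀ᶠ i in l, ∀ j, X i j =ᵐ[volume] sectorCluster (s i) (h i) (φ i) j)
    (hY : ∀ j, Y j =ᵐ[volume] sectorCluster s₀ h₀ φ₀ j) : LocallyConverges l X Y := by
  intro K hK
  have hlim : ∀ j : Fin 3, Tendsto (fun i => volume (K ∩ symmDiff
      (sectorCluster (s i) (h i) (φ i) j) (sectorCluster s₀ h₀ φ₀ j))) l (𝓝 0) := by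
    intro j
    have key := fun {ψ : ι → ℝ} {ψ₀ : ℝ} (hψ : Tendsto ψ l (𝓝 ψ₀)) =>
      tendsto_volume_inter_symmDiff_sector hs hh hψ hh₀ hK.measurableSet hK.measure_lt_top.ne
    fin_cases j
    · exact key (hφ.sub_const (2 * π / 3))
    · exact key hφ
    · exact key (hφ.add_const (2 * π / 3))
  have hsum := tendsto_finsetSum (Finset.univ : Finset (Fin 3)) fun j _ => hlim j
  rw [Finset.sum_const_zero] at hsum
  refine hsum.congr' ?_
  filter_upwards [hX] with i hi
  refine Finset.sum_congr rfl fun j _ => measure_congr ?_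
  exact (Filter.EventuallyEq.refl _ K).inter ((hi j).symmDiff (hY j)).symm

theorem liminf_add_liminf_le_liminf_add {ι : Type*} {l : Filter ι} (f g : ι → ℝ≥0∞) :
    liminf f l + liminf g l ≤ liminf (fun i => f i + g i) l := by
  rw [liminf_eq_iSup_iInf, liminf_eq_iSup_iInf]
  refine ENNReal.biSup_add_biSup_le' ⟨univ, univ_mem⟩ ⟨univ, univ_mem⟩ fun s hs t ht => ?_
  refine le_liminf_of_le (by isBoundedDefault) ?_
  filter_upwards [hs, ht] with i hi hi'
  exact add_le_add (iInf₂_le i hi) (iInf₂_le i hi')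

/-- Lower semicontinuity of the relative perimeter along sectors whose outer arc straightens. -/
theorem relPerimeter_le_liminf_of_ae_eq_sectorCluster {ι : Type*} {l : Filter ι}
    [l.IsCountablyGenerated] {s h φ : ι → ℝ} {h₀ : ℝ} (hs : Tendsto s l (𝓝 0))
    (hh : Tendsto h l (𝓝 h₀)) (hφ : Tendsto φ l (𝓝 (π / 3))) (hh₀ : 0 < h₀)
    (hsin : ∀ᶠ i in l, 0 < sin (φ i + 2 * π / 3))
    (hcen : ∀ᶠ i in l, arcCenter (s i) (h i) (φ i + 2 * π / 3)
      = !₂[0, arcRadius (h i) (φ i + 2 * π / 3)])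
    {X : ι → Fin 3 → Set Plane} {Y : Fin 3 → Set Plane}
    (hX : ∀ᶠ i in l, ∀ j, X i j =ᵐ[volume] sectorCluster (s i) (h i) (φ i) j)
    (hY : ∀ j, Y j =ᵐ[volume] sectorCluster 0 h₀ (π / 3) j) {U : Set Plane} (hU : IsOpen U) :
    relPerimeter Y U ≤ liminf (fun i => relPerimeter (X i) U) l := by
  have h3 : 0 < √3 := by positivity
  have l0 := hausdorffMeasure_le_liminf_openArc_of_sin_ne_zero hs hh hφ hh₀
    (by rw [sin_pi_div_three]; positivity) hU
  have l1 := hausdorffMeasure_le_liminf_openArc_of_sin_ne_zero hs hh (hφ.sub_const (2 * π / 3)) hh₀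
    (by rw [show π / 3 - 2 * π / 3 = -(π / 3) by ring, sin_neg, sin_pi_div_three]
        exact neg_ne_zero.2 (by positivity)) hU
  have eπ : π / 3 + 2 * π / 3 = π := by ring
  have hφπ := hφ.add_const (2 * π / 3)
  rw [eπ] at hφπ
  have l2 := hausdorffMeasure_le_liminf_openArc_pi hs hh hφπ hh₀ hsin hcen hU
  rw [relPerimeter_congr hY]
  refine (relPerimeter_sectorCluster_le 0 h₀ (π / 3) U).trans ?_
  simp only [hausdorffMeasure_inter_closedArc hh₀, eπ]
  refine (add_le_add (add_le_add l0 l1) l2).trans ?_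
  refine (add_le_add_left (liminf_add_liminf_le_liminf_add _ _) _).trans
    ((liminf_add_liminf_le_liminf_add _ _).trans (liminf_le_liminf ?_))
  filter_upwards [hX, hh.eventually (lt_mem_nhds hh₀)] with i hi hhi
  rw [relPerimeter_congr hi]
  exact le_relPerimeter_sectorCluster hhi (s i) (φ i) U

theorem lemma2p2 :
    IsCluster 1 2 lensCluster ∧
    (∀ A : ℝ, 0 < A → ∃ D : Fin 3 → Set Plane, IsNormalizedDoubleBubble A D) ∧
    ∀ D : ℝ → Fin 3 → Set Plane, (∀ A : ℝ, 0 < A → IsNormalizedDoubleBubble A (D A)) →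
      (∀ A : ℝ, 0 < A → IsCluster 2 1 (D A)) ∧
      LocallyConverges atTop D lensCluster ∧
      ∀ U : Set Plane, IsOpen U → Bornology.IsBounded U →
        relPerimeter lensCluster U ≤ liminf (fun A : ℝ => relPerimeter (D A) U) atTop := by
  refine ⟨isCluster_lensCluster, fun A hA => exists_isNormalizedDoubleBubble hA, fun D hD => ?_⟩
  have hex := fun A (hA : 0 < A) => (hD A hA).exists_parameters
  choose! s h φ hh h1 h2 hs hcen hae hv0 hv1 _ using hex
  obtain ⟨hslim, hhlim, hφlim⟩ := tendsto_parameters hh h1 h2 hs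
    (fun A hA => (measure_congr (hae A hA 0)).symm.trans (hv0 A hA))
    (fun A hA => (measure_congr (hae A hA 1)).symm.trans (hv1 A hA))
  have hpos : ∀ᶠ A : ℝ in atTop, 0 < A := eventually_gt_atTop 0
  refine ⟨fun A hA => (hD A hA).isCluster hA,
    locallyConverges_of_ae_eq_sectorCluster hslim hhlim hφlim lensWidth_pos (hpos.mono hae)
      lensCluster_ae_eq, fun U hU _ => ?_⟩
  exact relPerimeter_le_liminf_of_ae_eq_sectorCluster hslim hhlim hφlim lensWidth_pos
    (hpos.mono fun A hA => sin_pos_of_pos_of_lt_pi (by linarith [h1 A hA, pi_pos])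
      (by linarith [h2 A hA])) (hpos.mono hcen) (hpos.mono hae) lensCluster_ae_eq hU
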